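/- Let $M$ be the space of positive definite symmetric real $3\times 3$ matrices $V$ with $\det V=1$. It is identified with $\mathrm{SL}(3)/\mathrm{SO}(3)$ (real groups) through $A\cdot \mathrm{SO}(3)\mapsto (AA^t)^{1/2}$, so that $B\in \mathrm{SL}(3)$ acts on $M$ by $\phi_B(V)=(BV^2B^t)^{1/2}$. Let $g$ be the $\mathrm{SL}(3)$-invariant Riemannian metric on $M$ which on $T_{\mathrm{Id}}M=\{A=A^t,\ \operatorname{Tr}A=0\}$ is $g(A,A)=6\operatorname{Tr}(AA^t)$, and let $\Delta_g=-\operatorname{div}_g\operatorname{grad}_g$ be its (positive) Laplacian. *The compactification.* For $V\in M$ with eigenvalues $\lambda_1\le\lambda_2\le\lambda_3$ put $\mu=\lambda_1/\lambda_2$ and $\nu=\lambda_2/\lambda_3$. Let $\overline M$ be the closure of the set of pairs $\left(\frac{V}{\operatorname{Tr}V},\frac{V^{-1}}{\operatorname{Tr}V^{-1}}\right)$, $V\in M$; it is the compact set of all pairs $(P,Q)$ of positive semidefinite symmetric matrices of trace one for which $PQ$ is a scalar matrix. $\overline M$ is a smooth manifold with corners of codimension two with interior $M$, whose smooth structure is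 given by polar coordinates: by $(\mu,\nu,O)$, where $V=O\operatorname{diag}(\lambda_1,\lambda_2,\lambda_3)O^t$ and $O$ varies in a small open subset of $\mathrm{SO}(3)$, in the region $\mu,\nu<1$, with the faces $\mu=0$ and $\nu=0$ added; and by $(s,C,O)$, where $V$ is a multiple of $O\operatorname{diag}(sC,1)O^t$ (respectively of $O\operatorname{diag}(s,C)O^t$), $C$ is a positive definite symmetric $2\times2$ matrix of determinant one and $O$ varies in a local slice for $\mathrm{SO}(3)/\mathrm{O}(2)$, in regions where $\mu$ (respectively $\nu$) is bounded away from $0$, with the face $s=0$ added. The two boundary hypersurfaces are $H_\sharp=\{\nu=0\}=\{\operatorname{rank}P=1\}$ and $H^\sharp=\{\mu=0\}=\{\operatorname{rank}Q=1\}$. They are fibred by closed discs over $\mathrm{SO}(3)/\mathrm{O}(2)=\mathbb{RP}^2$ by $\phi_\sharp:H_\sharp\to\mathbb{RP}^2$, $(P,Q)\mapsto\operatorname{range}P$ (the eigenline of the largest eigenvalue), and $\phi^\sharp:H^\sharp\to\mathbb{RP}^2$, $(P,Q)\mapsto\operatorname{range}Q$ (the eigenline of the smallest eigenvalue). *The edge-to-edge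 structure.* Let $\mathcal V_{ee}$ be the Lie algebra of the smooth vector fields on $\overline M$ which are tangent to the fibres of $\phi_\sharp$ at all points of $H_\sharp$ and to the fibres of $\phi^\sharp$ at all points of $H^\sharp$. It is the space of all smooth sections of a vector bundle ${}^{ee}T\overline M$ over $\overline M$, with fibre $\mathcal V_{ee}/I_p\mathcal V_{ee}$ at $p$, where $I_p\subset C^\infty(\overline M)$ is the ideal of functions vanishing at $p$; let ${}^{ee}T^*\overline M$ be its dual. Thus a smooth section of $S^2({}^{ee}T^*\overline M)$ is a family $\gamma$ of symmetric bilinear forms $\gamma_p$ on ${}^{ee}T_p\overline M$, $p\in\overline M$, such that $p\mapsto\gamma_p(X,Y)$ is in $C^\infty(\overline M)$ for all $X,Y\in\mathcal V_{ee}$. Let $\mathrm{Diff}^2_{ee}(\overline M)$ be the set of finite sums of products of at most two elements of $\mathcal V_{ee}$ (with real multiples of the identity as products without factors). **Proposition.** The metric $g$ extends to a smooth section of $S^2({}^{ee}T^*\overline M)$: there is a smooth section $\gamma$ of $S^2({}^{ee}T^*\overline M)$ over $\overline M$ with $\gamma_p(X,Y)=g_p(X_p,Y_p)$ for all $p\in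 M$ and $X,Y\in\mathcal V_{ee}$. Furthermore $\Delta_g\in\mathrm{Diff}^2_{ee}(\overline M)$: there is $D\in\mathrm{Diff}^2_{ee}(\overline M)$ with $Du=\Delta_gu$ on $M$ for all $u\in C^\infty(M)$. -/

import Mathlib

open scoped Manifold ContDiff Topology

noncomputable section

namespace SL3

/-- Real three by three matrices. -/
abbrev Mat := Matrix (Fin 3) (Fin 3) ℝ

/-- The model corner `[0, ∞)² × ℝ³` of codimension two in `ℝ⁵`. -/
structure Quadrant where
  coords : Fin 5 → ℝ
  nonneg : 0 ≤ coords 0 ∧ 0 ≤ coords 1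

instance : TopologicalSpace Quadrant := TopologicalSpace.induced Quadrant.coords inferInstance

theorem Quadrant.coords_injective : Function.Injective Quadrant.coords := by
  rintro ⟨x, _⟩ ⟨y, _⟩ h
  cases h
  rfl

theorem Quadrant.continuous_coords : Continuous Quadrant.coords := continuous_induced_dom

theorem Quadrant.range_coords : Set.range Quadrant.coords = {y | 0 ≤ y 0 ∧ 0 ≤ y 1} := by
  ext y
  exact ⟨by rintro ⟨x, rfl⟩; exact x.nonneg, fun h => ⟨⟨y, h⟩, rfl⟩⟩

/-- The retraction of `ℝ⁵` onto the model corner, used as the (junk) inverse of the inclusion. -/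
def Quadrant.clip (x : Fin 5 → ℝ) : Quadrant :=
  ⟨![max (x 0) 0, max (x 1) 0, x 2, x 3, x 4], by simp⟩

theorem Quadrant.clip_val (x : Quadrant) : Quadrant.clip x.coords = x := by
  apply Quadrant.coords_injective
  funext i
  fin_cases i <;> simp [Quadrant.clip, x.nonneg.1, x.nonneg.2]

theorem Quadrant.val_clip {x : Fin 5 → ℝ} (hx : 0 ≤ x 0 ∧ 0 ≤ x 1) :
    (Quadrant.clip x).coords = x :=
  congrArg Quadrant.coords (Quadrant.clip_val ⟨x, hx⟩)

/-- The model with corners given by the inclusion of `[0, ∞)² × ℝ³` into `ℝ⁵`. -/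
def cornerModel : ModelWithCorners ℝ (Fin 5 → ℝ) Quadrant where
  toFun := Quadrant.coords
  invFun := Quadrant.clip
  source := Set.univ
  target := {y | 0 ≤ y 0 ∧ 0 ≤ y 1}
  map_source' x _ := x.nonneg
  map_target' _ _ := Set.mem_univ _
  left_inv' x _ := Quadrant.clip_val x
  right_inv' _ hx := Quadrant.val_clip hx
  source_eq := rfl
  convex_range' := by
    simp only [instIsRCLikeNormedField, ↓reduceDIte]
    apply Convex.convex_isRCLikeNormedField
    rw [Quadrant.range_coords]
    intro x hx y hy a b ha hb _
    have h1 := hx.1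
    have h2 := hx.2
    have h3 := hy.1
    have h4 := hy.2
    constructor <;> simp only [Pi.add_apply, Pi.smul_apply, smul_eq_mul] <;> positivity
  nonempty_interior' := by
    rw [Quadrant.range_coords]
    refine ⟨fun _ => 1, mem_interior.2 ⟨{y | 0 < y 0 ∧ 0 < y 1}, ?_, ?_, ?_⟩⟩
    · exact fun y hy => ⟨hy.1.le, hy.2.le⟩
    · exact (isOpen_lt continuous_const (continuous_apply 0)).inter
        (isOpen_lt continuous_const (continuous_apply 1))
    · simp
  continuous_toFun := Quadrant.continuous_coords
  continuous_invFun := by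
    refine continuous_induced_rng.2 (continuous_pi fun i => ?_)
    fin_cases i <;> simp [Quadrant.clip] <;> fun_prop

/-! ### The compactification

For `V` positive definite and symmetric of determinant one, with eigenvalues `λ₁ ≤ λ₂ ≤ λ₃`, the
eigenvalue ratios `μ = λ₁ / λ₂` and `ν = λ₂ / λ₃` together with the eigenspaces are recorded by the
pair `(V / tr V, V⁻¹ / tr V⁻¹)`. The closure of the set of these pairs is compact: it consists of
all pairs `(P, Q)` of positive semidefinite matrices of trace one with `P Q` scalar. If the scalar
is not zero, the pair comes from a unique `V`. If it is zero, then `P` has rank one, which means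
`ν = 0`, or `Q` has rank one, which means `μ = 0`, or both, which is the corner `μ = ν = 0`. -/

/-- The compactification of the symmetric space. A point of the symmetric space is represented by
the pair `(P, Q) = (V / tr V, V⁻¹ / tr V⁻¹)`. -/
@[ext]
structure Mbar where
  P : Mat
  Q : Mat
  pos_P : P.PosSemidef
  pos_Q : Q.PosSemidef
  trace_P : P.trace = 1
  trace_Q : Q.trace = 1
  scalar : ∃ c : ℝ, P * Q = c • (1 : Mat)

/-- The inclusion into pairs of matrices, which induces the topology. -/
def Mbar.pair (p : Mbar) : Mat × Mat := (p.P, p.Q)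

instance : TopologicalSpace Mbar := TopologicalSpace.induced Mbar.pair inferInstance

theorem Mbar.pair_injective : Function.Injective Mbar.pair := fun _ _ h =>
  Mbar.ext (congrArg Prod.fst h) (congrArg Prod.snd h)

theorem Mbar.continuous_pair : Continuous Mbar.pair := continuous_induced_dom

theorem Mbar.continuous_P : Continuous Mbar.P := continuous_fst.comp Mbar.continuous_pair

theorem Mbar.continuous_Q : Continuous Mbar.Q := continuous_snd.comp Mbar.continuous_pair

/-- The unipotent upper triangular matrix with entries `x 2`, `x 3`, `x 4`. -/
def unip (x : Fin 5 → ℝ) : Mat := !![1, x 2, x 3; 0, 1, x 4; 0, 0, 1]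

/-- The inverse of `unip x`. -/
def unipInv (x : Fin 5 → ℝ) : Mat := !![1, -x 2, x 2 * x 4 - x 3; 0, 1, -x 4; 0, 0, 1]

/-- The matrix `n diag(t₁ t₂, t₂, 1) nᵗ`, where `t₁ = x 0`, `t₂ = x 1` and `n = unip x`. -/
def rawP (x : Fin 5 → ℝ) : Mat :=
  unip x * Matrix.diagonal ![x 0 * x 1, x 1, 1] * (unip x).transpose

/-- The matrix `n⁻ᵗ diag(1, t₁, t₁ t₂) n⁻¹`, which is `t₁ t₂` times the inverse of `rawP x` when
`t₁ t₂` is not zero. -/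
def rawQ (x : Fin 5 → ℝ) : Mat :=
  (unipInv x).transpose * Matrix.diagonal ![1, x 0, x 0 * x 1] * unipInv x

theorem rawP_eq (x : Fin 5 → ℝ) : rawP x =
    !![x 0 * x 1 + x 2 ^ 2 * x 1 + x 3 ^ 2, x 2 * x 1 + x 3 * x 4, x 3;
       x 2 * x 1 + x 3 * x 4, x 1 + x 4 ^ 2, x 4;
       x 3, x 4, 1] := by
  ext i j
  fin_cases i <;> fin_cases j <;>
    simp [rawP, unip, Matrix.mul_apply, Fin.sum_univ_three, Matrix.vecMul, dotProduct] <;> ring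

theorem rawQ_eq (x : Fin 5 → ℝ) : rawQ x =
    !![1, -x 2, x 2 * x 4 - x 3;
       -x 2, x 2 ^ 2 + x 0, -x 2 * (x 2 * x 4 - x 3) - x 0 * x 4;
       x 2 * x 4 - x 3, -x 2 * (x 2 * x 4 - x 3) - x 0 * x 4,
         (x 2 * x 4 - x 3) ^ 2 + x 0 * x 4 ^ 2 + x 0 * x 1] := by
  ext i j
  fin_cases i <;> fin_cases j <;>
    simp [rawQ, unipInv, Matrix.mul_apply, Fin.sum_univ_three] <;> ring

theorem rawP_mul_rawQ (x : Fin 5 → ℝ) : rawP x * rawQ x = (x 0 * x 1) • (1 : Mat) := by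
  rw [rawP_eq, rawQ_eq]
  ext i j
  fin_cases i <;> fin_cases j <;>
    simp [Matrix.mul_apply, Fin.sum_univ_three] <;> ring

theorem rawP_posSemidef {x : Fin 5 → ℝ} (hx : 0 ≤ x 0 ∧ 0 ≤ x 1) : (rawP x).PosSemidef := by
  have h : (Matrix.diagonal ![x 0 * x 1, x 1, 1] : Mat).PosSemidef := by
    refine Matrix.PosSemidef.diagonal fun i => ?_
    fin_cases i <;> simp [hx.1, hx.2, mul_nonneg]
  simpa [rawP] using h.mul_mul_conjTranspose_same (unip x)

theorem rawQ_posSemidef {x : Fin 5 → ℝ} (hx : 0 ≤ x 0 ∧ 0 ≤ x 1) : (rawQ x).PosSemidef := by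
  have h : (Matrix.diagonal ![1, x 0, x 0 * x 1] : Mat).PosSemidef := by
    refine Matrix.PosSemidef.diagonal fun i => ?_
    fin_cases i <;> simp [hx.1, hx.2, mul_nonneg]
  simpa [rawQ] using h.conjTranspose_mul_mul_same (unipInv x)

theorem rawP_trace_pos {x : Fin 5 → ℝ} (hx : 0 ≤ x 0 ∧ 0 ≤ x 1) : 0 < (rawP x).trace := by
  have h1 := hx.1
  have h2 := hx.2
  simp only [rawP_eq, Matrix.trace_fin_three, Matrix.of_apply, Matrix.cons_val]
  positivity

theorem rawQ_trace_pos {x : Fin 5 → ℝ} (hx : 0 ≤ x 0 ∧ 0 ≤ x 1) : 0 < (rawQ x).trace := by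
  have h1 := hx.1
  have h2 := hx.2
  simp only [rawQ_eq, Matrix.trace_fin_three, Matrix.of_apply, Matrix.cons_val]
  positivity

theorem contDiff_rawP (i j : Fin 3) : ContDiff ℝ ∞ fun x => rawP x i j := by
  simp only [rawP_eq]
  fin_cases i <;> fin_cases j <;> simp <;> fun_prop

theorem contDiff_rawQ (i j : Fin 3) : ContDiff ℝ ∞ fun x => rawQ x i j := by
  simp only [rawQ_eq]
  fin_cases i <;> fin_cases j <;> simp <;> fun_prop

/-- Normalisation to trace one. -/
def normalise (A : Mat) : Mat := A.trace⁻¹ • A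

/-- The point of the compactification given by a pair of positive semidefinite matrices with positive
traces and scalar product. -/
def Mbar.ofPair (A B : Mat) (hA : A.PosSemidef) (hB : B.PosSemidef) (hA' : 0 < A.trace)
    (hB' : 0 < B.trace) (h : ∃ c : ℝ, A * B = c • (1 : Mat)) : Mbar where
  P := normalise A
  Q := normalise B
  pos_P := hA.smul (inv_nonneg.2 hA'.le)
  pos_Q := hB.smul (inv_nonneg.2 hB'.le)
  trace_P := by simp [normalise, hA'.ne']
  trace_Q := by simp [normalise, hB'.ne']
  scalar := by
    obtain ⟨c, hc⟩ := h
    refine ⟨A.trace⁻¹ * B.trace⁻¹ * c, ?_⟩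
    simp only [normalise, Matrix.smul_mul, Matrix.mul_smul, hc, smul_smul]
    congr 1
    ring

/-- The point with given coordinates in the standard chart. The boundary is `t₁ t₂ = 0`; here `t₁`
and `t₂` are, near the boundary, smooth positive multiples of `μ` and `ν`, respectively, where
these are small. -/
def ofCoords (x : Quadrant) : Mbar :=
  Mbar.ofPair (rawP x.coords) (rawQ x.coords) (rawP_posSemidef x.nonneg)
    (rawQ_posSemidef x.nonneg) (rawP_trace_pos x.nonneg) (rawQ_trace_pos x.nonneg)
    ⟨_, rawP_mul_rawQ x.coords⟩

/-- The coordinates of a pair of matrices in the standard chart, as rational functions of the entries. -/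
def coordFun (p : Mat × Mat) : Fin 5 → ℝ :=
  ![p.2 1 1 / p.2 0 0 - (p.2 0 1 / p.2 0 0) ^ 2,
    p.1 1 1 / p.1 2 2 - (p.1 1 2 / p.1 2 2) ^ 2,
    -(p.2 0 1 / p.2 0 0), p.1 0 2 / p.1 2 2, p.1 1 2 / p.1 2 2]

theorem minor_nonneg {A : Mat} (hA : A.PosSemidef) (i j : Fin 3) (h : A i i ≠ 0) :
    0 ≤ A j j / A i i - (A i j / A i i) ^ 2 := by
  have hpos : 0 < A i i := lt_of_le_of_ne (hA.diag_nonneg) h.symm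
  have hs : A j i = A i j := by simpa using hA.1.apply i j
  have h2 := hA.dotProduct_mulVec_nonneg (A i i • Pi.single j 1 - A i j • Pi.single i 1)
  have h3 : (0:ℝ) ≤ A i i * (A i i * A j j - A i j ^ 2) := by
    refine h2.trans_eq ?_
    simp [Matrix.mulVec_sub, Matrix.mulVec_smul, sub_dotProduct, dotProduct_sub, hs]
    ring
  have h4 : 0 ≤ A i i * A j j - A i j ^ 2 := nonneg_of_mul_nonneg_right h3 hpos
  have : A j j / A i i - (A i j / A i i) ^ 2 = (A i i * A j j - A i j ^ 2) / A i i ^ 2 := by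
    field_simp
  rw [this]
  positivity

/-- The coordinates of a point in the standard chart. -/
def toCoords (p : Mbar) : Quadrant := Quadrant.clip (coordFun (p.P, p.Q))

theorem coordFun_nonneg (p : Mbar) (h0 : p.Q 0 0 ≠ 0) (h2 : p.P 2 2 ≠ 0) :
    0 ≤ coordFun (p.P, p.Q) 0 ∧ 0 ≤ coordFun (p.P, p.Q) 1 := by
  refine ⟨by simpa [coordFun] using minor_nonneg p.pos_Q 0 1 h0, ?_⟩
  have hs : p.P 2 1 = p.P 1 2 := by simpa using p.pos_P.1.apply 1 2
  simpa [coordFun, hs] using minor_nonneg p.pos_P 2 1 h2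

theorem toCoords_val (p : Mbar) (h0 : p.Q 0 0 ≠ 0) (h2 : p.P 2 2 ≠ 0) :
    (toCoords p).coords = coordFun (p.P, p.Q) :=
  Quadrant.val_clip (coordFun_nonneg p h0 h2)

theorem coordFun_ofCoords (x : Quadrant) : coordFun ((ofCoords x).P, (ofCoords x).Q) = x.coords := by
  have hP := (rawP_trace_pos x.nonneg).ne'
  have hQ := (rawQ_trace_pos x.nonneg).ne'
  funext i
  simp only [ofCoords, Mbar.ofPair, normalise, coordFun, Matrix.smul_apply, smul_eq_mul]
  have e : ∀ a b c : ℝ, a ≠ 0 → (a⁻¹ * b) / (a⁻¹ * c) = b / c := by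
    intro a b c ha
    rw [mul_div_mul_left _ _ (inv_ne_zero ha)]
  simp only [e _ _ _ hP, e _ _ _ hQ]
  fin_cases i <;> simp [rawP_eq, rawQ_eq]

theorem raw_coordFun {P Q : Mat} (hP : P.IsSymm) (hQ : Q.IsSymm) {c : ℝ}
    (hc : P * Q = c • (1 : Mat)) (h0 : Q 0 0 ≠ 0) (h2 : P 2 2 ≠ 0) :
    rawP (coordFun (P, Q)) = (P 2 2)⁻¹ • P ∧ rawQ (coordFun (P, Q)) = (Q 0 0)⁻¹ • Q := by
  have sP : ∀ i j, P j i = P i j := fun i j => hP.apply i j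
  have sQ : ∀ i j, Q j i = Q i j := fun i j => hQ.apply i j
  have e : ∀ i j, P i 0 * Q 0 j + P i 1 * Q 1 j + P i 2 * Q 2 j = c * (1 : Mat) i j := by
    intro i j
    have := congrFun (congrFun hc i) j
    simpa [Matrix.mul_apply, Fin.sum_univ_three] using this
  have e00 := e 0 0
  have e10 := e 1 0
  have e20 := e 2 0
  have e11 := e 1 1
  have e21 := e 2 1
  have e22 := e 2 2
  simp only [Matrix.one_apply, Fin.isValue] at e00 e10 e20 e11 e21 e22
  simp at e00 e10 e20 e11 e21 e22
  rw [sQ 0 1, sQ 0 2] at e00 e10 e20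
  rw [sP 0 1] at e10 e11
  rw [sP 0 2, sP 1 2] at e20 e21 e22
  rw [sQ 1 2] at e11 e21
  have f02 : Q 0 2 = -(P 0 2 * Q 0 0 + P 1 2 * Q 0 1) / P 2 2 := by
    field_simp; linarith
  have f12 : Q 1 2 = -(P 0 2 * Q 0 1 + P 1 2 * Q 1 1) / P 2 2 := by
    field_simp; linarith
  have g01 : P 0 1 = -(P 1 1 * Q 0 1 + P 1 2 * Q 0 2) / Q 0 0 := by
    field_simp; linarith
  have g00 : P 0 0 = (c - P 0 1 * Q 0 1 - P 0 2 * Q 0 2) / Q 0 0 := by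
    field_simp; linarith
  have g22 : Q 2 2 = (c - P 0 2 * Q 0 2 - P 1 2 * Q 1 2) / P 2 2 := by
    field_simp; linarith
  have gc : c = P 0 1 * Q 0 1 + P 1 1 * Q 1 1 + P 1 2 * Q 1 2 := e11.symm
  constructor
  · rw [rawP_eq]
    ext i j
    fin_cases i <;> fin_cases j <;>
      simp [coordFun, sP 0 1, sP 0 2, sP 1 2, g00, gc, g01, f02, f12, h2] <;> field_simp <;> ring
  · rw [rawQ_eq]
    ext i j
    fin_cases i <;> fin_cases j <;>
      simp [coordFun, sQ 0 1, sQ 0 2, sQ 1 2, g22, gc, g01, f02, f12, h0] <;> field_simp <;> ring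

theorem normalise_smul {A : Mat} {a : ℝ} (ha : a ≠ 0) (h : A.trace = 1) :
    normalise (a • A) = A := by
  simp [normalise, h, smul_smul, ha]

theorem ofCoords_toCoords (p : Mbar) (h0 : p.Q 0 0 ≠ 0) (h2 : p.P 2 2 ≠ 0) :
    ofCoords (toCoords p) = p := by
  obtain ⟨c, hc⟩ := p.scalar
  obtain ⟨hP, hQ⟩ := raw_coordFun p.pos_P.1 p.pos_Q.1 hc h0 h2
  refine Mbar.ext ?_ ?_
  · simp only [ofCoords, Mbar.ofPair, toCoords_val p h0 h2]
    exact (congrArg normalise hP).trans (normalise_smul (inv_ne_zero h2) p.trace_P)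
  · simp only [ofCoords, Mbar.ofPair, toCoords_val p h0 h2]
    exact (congrArg normalise hQ).trans (normalise_smul (inv_ne_zero h0) p.trace_Q)

/-- The standard chart. Its domain is open, dense, and contains the symmetric space. -/
def chartStd : OpenPartialHomeomorph Mbar Quadrant where
  toFun := toCoords
  invFun := ofCoords
  source := {p | p.Q 0 0 ≠ 0 ∧ p.P 2 2 ≠ 0}
  target := Set.univ
  map_source' _ _ := Set.mem_univ _
  map_target' x _ := by
    have hP := (rawP_trace_pos x.nonneg).ne'
    have hQ := (rawQ_trace_pos x.nonneg).ne'
    have h0 : rawQ x.coords 0 0 = 1 := by simp [rawQ_eq]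
    have h2 : rawP x.coords 2 2 = 1 := by simp [rawP_eq]
    constructor <;> simp [ofCoords, Mbar.ofPair, normalise, hP, hQ, h0, h2]
  left_inv' p hp := ofCoords_toCoords p hp.1 hp.2
  right_inv' x _ := by
    change Quadrant.clip (coordFun ((ofCoords x).P, (ofCoords x).Q)) = x
    rw [coordFun_ofCoords, Quadrant.clip_val]
  open_source := by
    have h1 : Continuous fun p : Mbar => p.Q 0 0 :=
      Mbar.continuous_Q.matrix_elem 0 0
    have h2 : Continuous fun p : Mbar => p.P 2 2 :=
      Mbar.continuous_P.matrix_elem 2 2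
    exact (isOpen_ne_fun h1 continuous_const).inter (isOpen_ne_fun h2 continuous_const)
  open_target := isOpen_univ
  continuousOn_toFun := by
    refine cornerModel.continuous_symm.comp_continuousOn (continuousOn_pi.2 fun i => ?_)
    have hP : ∀ i j, Continuous fun p : Mbar => p.P i j := fun i j =>
      Mbar.continuous_P.matrix_elem i j
    have hQ : ∀ i j, Continuous fun p : Mbar => p.Q i j := fun i j =>
      Mbar.continuous_Q.matrix_elem i j
    have dP : ∀ i j, ContinuousOn (fun p : Mbar => p.P i j / p.P 2 2)
        {p | p.Q 0 0 ≠ 0 ∧ p.P 2 2 ≠ 0} := fun i j =>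
      (hP i j).continuousOn.div (hP 2 2).continuousOn fun p hp => hp.2
    have dQ : ∀ i j, ContinuousOn (fun p : Mbar => p.Q i j / p.Q 0 0)
        {p | p.Q 0 0 ≠ 0 ∧ p.P 2 2 ≠ 0} := fun i j =>
      (hQ i j).continuousOn.div (hQ 0 0).continuousOn fun p hp => hp.1
    fin_cases i
    · exact (dQ 1 1).sub ((dQ 0 1).pow 2)
    · exact (dP 1 1).sub ((dP 1 2).pow 2)
    · exact (dQ 0 1).neg
    · exact dP 0 2
    · exact dP 1 2
  continuousOn_invFun := by
    refine Continuous.continuousOn (continuous_induced_rng.2 ?_)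
    have hP : Continuous fun x : Quadrant => rawP x.coords :=
      continuous_matrix fun i j => (contDiff_rawP i j).continuous.comp Quadrant.continuous_coords
    have hQ : Continuous fun x : Quadrant => rawQ x.coords :=
      continuous_matrix fun i j => (contDiff_rawQ i j).continuous.comp Quadrant.continuous_coords
    refine Continuous.prodMk ?_ ?_
    · exact (hP.matrix_trace.inv₀ fun x => (rawP_trace_pos x.nonneg).ne').smul hP
    · exact (hQ.matrix_trace.inv₀ fun x => (rawQ_trace_pos x.nonneg).ne').smul hQ

/-- The permutation of the three coordinate axes of `ℝ³`, acting on the compactification. -/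
def permute (σ : Equiv.Perm (Fin 3)) (p : Mbar) : Mbar where
  P := p.P.submatrix σ σ
  Q := p.Q.submatrix σ σ
  pos_P := p.pos_P.submatrix σ
  pos_Q := p.pos_Q.submatrix σ
  trace_P := by simpa [Matrix.trace, Equiv.sum_comp σ fun i => p.P i i] using p.trace_P
  trace_Q := by simpa [Matrix.trace, Equiv.sum_comp σ fun i => p.Q i i] using p.trace_Q
  scalar := by
    obtain ⟨c, hc⟩ := p.scalar
    refine ⟨c, ?_⟩
    rw [Matrix.submatrix_mul_equiv, hc]
    ext i j
    simp [Matrix.one_apply]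

theorem continuous_permute (σ : Equiv.Perm (Fin 3)) : Continuous (permute σ) :=
  continuous_induced_rng.2 <| (Mbar.continuous_P.matrix_submatrix _ _).prodMk
    (Mbar.continuous_Q.matrix_submatrix _ _)

/-- `permute` as a homeomorphism. -/
def permuteHomeo (σ : Equiv.Perm (Fin 3)) : Mbar ≃ₜ Mbar where
  toFun := permute σ
  invFun := permute σ.symm
  left_inv p := by ext <;> simp [permute]
  right_inv p := by ext <;> simp [permute]
  continuous_toFun := continuous_permute σ
  continuous_invFun := continuous_permute σ.symm

/-- The six charts: the standard chart with the axes of `ℝ³` permuted. -/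
def chart (σ : Equiv.Perm (Fin 3)) : OpenPartialHomeomorph Mbar Quadrant :=
  (permuteHomeo σ).transOpenPartialHomeomorph chartStd

theorem mem_chart_source {σ : Equiv.Perm (Fin 3)} {p : Mbar} :
    p ∈ (chart σ).source ↔ p.Q (σ 0) (σ 0) ≠ 0 ∧ p.P (σ 2) (σ 2) ≠ 0 :=
  Iff.rfl

theorem eq_zero_of_diag {A : Mat} (hA : A.PosSemidef) (i j : Fin 3) (h : A i i = 0) :
    A i j = 0 := by
  have hs : A j i = A i j := by simpa using hA.1.apply i j
  have hj : 0 ≤ A j j := hA.diag_nonneg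
  by_contra hne
  have h6 := hA.dotProduct_mulVec_nonneg
    (Pi.single j 1 - ((A j j + 1) / A i j) • Pi.single i 1)
  have h7 : (0:ℝ) ≤ A j j - 2 * (A j j + 1) := by
    refine h6.trans_eq ?_
    simp [Matrix.mulVec_sub, Matrix.mulVec_smul, sub_dotProduct, dotProduct_sub, hs, h]
    field_simp
    ring
  linarith

theorem exists_perm_of_ne {i j : Fin 3} (h : i ≠ j) :
    ∃ σ : Equiv.Perm (Fin 3), σ 0 = i ∧ σ 2 = j := by
  revert i j
  decide

theorem exists_chart (p : Mbar) : ∃ σ, p ∈ (chart σ).source := by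
  have key : ∃ i j : Fin 3, i ≠ j ∧ p.Q i i ≠ 0 ∧ p.P j j ≠ 0 := by
    by_contra! hcon
    have hP : ∃ j, p.P j j ≠ 0 := by
      by_contra! h
      have := p.trace_P
      simp [Matrix.trace, h] at this
    have hQ : ∃ i, p.Q i i ≠ 0 := by
      by_contra! h
      have := p.trace_Q
      simp [Matrix.trace, h] at this
    obtain ⟨j, hj⟩ := hP
    obtain ⟨i, hi⟩ := hQ
    obtain rfl : i = j := by
      by_contra hne
      exact hj (hcon i j hne hi)
    obtain ⟨k, hk⟩ : ∃ k, k ≠ i := exists_ne i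
    have hPk : ∀ k, k ≠ i → p.P k k = 0 := fun k hk => hcon i k hk.symm hi
    have hPk' : ∀ k, k ≠ i → ∀ l, p.P k l = 0 := fun k hk l =>
      eq_zero_of_diag p.pos_P k l (hPk k hk)
    have hPi : ∀ k, k ≠ i → p.P i k = 0 := fun k hk => by
      have hs : p.P i k = p.P k i := by simpa using p.pos_P.1.apply k i
      rw [hs, hPk' k hk]
    obtain ⟨c, hc⟩ := p.scalar
    have h1 := congrFun (congrFun hc k) k
    have h2 := congrFun (congrFun hc i) i
    rw [Matrix.mul_apply, Finset.sum_eq_zero fun l _ => by rw [hPk' k hk, zero_mul]] at h1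
    rw [Matrix.mul_apply, Finset.sum_eq_single i (fun l _ hl => by rw [hPi l hl, zero_mul])
      (by simp)] at h2
    simp at h1 h2
    rw [← h1] at h2
    simp [hi, hj] at h2
  obtain ⟨i, j, hij, hi, hj⟩ := key
  obtain ⟨σ, rfl, rfl⟩ := exists_perm_of_ne hij
  exact ⟨σ, mem_chart_source.2 ⟨hi, hj⟩⟩

open Classical in
/-- A chart around each point; it is the standard one where that is possible. -/
def chartIndex (p : Mbar) : Equiv.Perm (Fin 3) :=
  if p ∈ (chart 1).source then 1 else (exists_chart p).choose

theorem mem_chartIndex (p : Mbar) : p ∈ (chart (chartIndex p)).source := by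
  unfold chartIndex
  split_ifs with h
  · exact h
  · exact (exists_chart p).choose_spec

/-- The atlas of the six charts. -/
instance : ChartedSpace Quadrant Mbar where
  atlas := Set.range chart
  chartAt p := chart (chartIndex p)
  mem_chart_source := mem_chartIndex
  chart_mem_atlas _ := ⟨_, rfl⟩

/-- The compactification is a smooth manifold with corners. -/
instance : IsManifold cornerModel ∞ Mbar := by
  apply isManifold_of_contDiffOn
  rintro _ _ ⟨σ, rfl⟩ ⟨τ, rfl⟩
  set S := cornerModel.symm ⁻¹' ((chart σ).symm ≫ₕ chart τ).source ∩ Set.range cornerModel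
  have hS : ∀ x ∈ S, 0 ≤ x 0 ∧ 0 ≤ x 1 := fun x hx => by
    have := hx.2
    rwa [show Set.range cornerModel = _ from Quadrant.range_coords] at this
  let ρ : Fin 3 → Fin 3 := fun i => σ.symm (τ i)
  let F : (Fin 5 → ℝ) → Mat × Mat := fun x =>
    ((normalise (rawP x)).submatrix ρ ρ, (normalise (rawQ x)).submatrix ρ ρ)
  have hF : ∀ x ∈ S, ((chart σ).symm (cornerModel.symm x)).P.submatrix τ τ = (F x).1 ∧
      ((chart σ).symm (cornerModel.symm x)).Q.submatrix τ τ = (F x).2 := fun x hx => by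
    have hx' : (Quadrant.clip x).coords = x := Quadrant.val_clip (hS x hx)
    constructor
    · change ((normalise (rawP (Quadrant.clip x).coords)).submatrix _ _).submatrix _ _ = _
      rw [hx']
      rfl
    · change ((normalise (rawQ (Quadrant.clip x).coords)).submatrix _ _).submatrix _ _ = _
      rw [hx']
      rfl
  have hF0 : ∀ x ∈ S, (F x).2 0 0 ≠ 0 ∧ (F x).1 2 2 ≠ 0 := fun x hx => by
    have h := hx.1
    rw [Set.mem_preimage, OpenPartialHomeomorph.trans_source] at h
    have h' := mem_chart_source.1 h.2
    rw [← (hF x hx).1, ← (hF x hx).2]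
    exact h'
  have dP : ∀ i j, ContDiffOn ℝ ∞ (fun x => (F x).1 i j) S := fun i j => by
    have : ContDiff ℝ ∞ fun x => (rawP x).trace := by
      simp only [Matrix.trace_fin_three]
      exact ((contDiff_rawP 0 0).add (contDiff_rawP 1 1)).add (contDiff_rawP 2 2)
    exact (this.contDiffOn.inv fun x hx => (rawP_trace_pos (hS x hx)).ne').mul
      (contDiff_rawP _ _).contDiffOn
  have dQ : ∀ i j, ContDiffOn ℝ ∞ (fun x => (F x).2 i j) S := fun i j => by
    have : ContDiff ℝ ∞ fun x => (rawQ x).trace := by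
      simp only [Matrix.trace_fin_three]
      exact ((contDiff_rawQ 0 0).add (contDiff_rawQ 1 1)).add (contDiff_rawQ 2 2)
    exact (this.contDiffOn.inv fun x hx => (rawQ_trace_pos (hS x hx)).ne').mul
      (contDiff_rawQ _ _).contDiffOn
  have eP : ∀ i j, ContDiffOn ℝ ∞ (fun x => (F x).1 i j / (F x).1 2 2) S := fun i j =>
    (dP i j).div (dP 2 2) fun x hx => (hF0 x hx).2
  have eQ : ∀ i j, ContDiffOn ℝ ∞ (fun x => (F x).2 i j / (F x).2 0 0) S := fun i j =>
    (dQ i j).div (dQ 0 0) fun x hx => (hF0 x hx).1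
  have hG : ContDiffOn ℝ ∞ (fun x => coordFun (F x)) S := by
    refine contDiffOn_pi.2 fun i => ?_
    fin_cases i
    · exact (eQ 1 1).sub ((eQ 0 1).pow 2)
    · exact (eP 1 1).sub ((eP 1 2).pow 2)
    · exact (eQ 0 1).neg
    · exact eP 0 2
    · exact eP 1 2
  refine hG.congr fun x hx => ?_
  have h0 := hF0 x hx
  have h1 : (permute τ ((chart σ).symm (cornerModel.symm x))).pair = F x :=
    Prod.ext (hF x hx).1 (hF x hx).2
  rw [← h1] at h0
  change (toCoords (permute τ ((chart σ).symm (cornerModel.symm x)))).coords = _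
  rw [toCoords_val _ h0.1 h0.2]
  exact congrArg coordFun h1

/-- The compactification is Hausdorff. -/
instance : T2Space Mbar :=
  T2Space.of_injective_continuous Mbar.pair_injective continuous_induced_dom

theorem isClosed_posSemidef : IsClosed {A : Mat | A.PosSemidef} := by
  have : {A : Mat | A.PosSemidef} =
      {A | A.transpose = A} ∩ ⋂ v : Fin 3 → ℝ, {A : Mat | 0 ≤ dotProduct v (A.mulVec v)} := by
    ext A
    simp [Matrix.posSemidef_iff_dotProduct_mulVec, Matrix.IsHermitian]
  rw [this]
  refine (isClosed_eq continuous_id.matrix_transpose continuous_id).inter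
    (isClosed_iInter fun v => isClosed_le continuous_const ?_)
  exact continuous_const.dotProduct (continuous_id.matrix_mulVec continuous_const)

theorem abs_le_one {A : Mat} (hA : A.PosSemidef) (h : A.trace = 1) (i j : Fin 3) :
    A i j ∈ Set.Icc (-1 : ℝ) 1 := by
  have hs : A j i = A i j := by simpa using hA.1.apply i j
  have hd : ∀ k, A k k ≤ 1 := fun k => by
    have h0 := hA.diag_nonneg (i := 0)
    have h1 := hA.diag_nonneg (i := 1)
    have h2 := hA.diag_nonneg (i := 2)
    rw [Matrix.trace_fin_three] at h
    fin_cases k <;> simp <;> linarith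
  have hp := hA.dotProduct_mulVec_nonneg (Pi.single i 1 + Pi.single j 1)
  have hm := hA.dotProduct_mulVec_nonneg (Pi.single i 1 - Pi.single j 1)
  simp [Matrix.mulVec_sub, Matrix.mulVec_add, sub_dotProduct, dotProduct_sub, add_dotProduct,
    dotProduct_add, hs] at hp hm
  have := hd i
  have := hd j
  constructor <;> linarith

/-- The compactification is compact. -/
instance : CompactSpace Mbar := by
  have hK : IsCompact {A : Mat | ∀ i j, A i j ∈ Set.Icc (-1 : ℝ) 1} := by
    have := isCompact_univ_pi fun _ : Fin 3 => isCompact_univ_pi fun _ : Fin 3 =>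
      (isCompact_Icc : IsCompact (Set.Icc (-1 : ℝ) 1))
    refine this.of_isClosed_subset ?_ fun A hA i _ j _ => hA i j
    simp only [Set.ofPred_forall]
    exact isClosed_iInter fun i => isClosed_iInter fun j =>
      isClosed_Icc.preimage (continuous_id.matrix_elem i j)
  have hrange : Set.range Mbar.pair = {p : Mat × Mat | p.1.PosSemidef ∧ p.2.PosSemidef ∧
      p.1.trace = 1 ∧ p.2.trace = 1 ∧ ∃ c : ℝ, p.1 * p.2 = c • (1 : Mat)} := by
    ext p
    constructor
    · rintro ⟨q, rfl⟩
      exact ⟨q.pos_P, q.pos_Q, q.trace_P, q.trace_Q, q.scalar⟩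
    · rintro ⟨h1, h2, h3, h4, h5⟩
      exact ⟨⟨p.1, p.2, h1, h2, h3, h4, h5⟩, rfl⟩
  have hind : Topology.IsInducing Mbar.pair := ⟨rfl⟩
  refine ⟨hind.isCompact_iff.2 ?_⟩
  rw [Set.image_univ, hrange]
  refine (hK.prod hK).of_isClosed_subset ?_ fun p hp =>
    ⟨abs_le_one hp.1 hp.2.2.1, abs_le_one hp.2.1 hp.2.2.2.1⟩
  have hc : {p : Mat × Mat | ∃ c : ℝ, p.1 * p.2 = c • (1 : Mat)} =
      {p | p.1 * p.2 = (p.1 * p.2) 0 0 • (1 : Mat)} := by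
    ext p
    constructor
    · rintro ⟨c, h⟩
      simp [h]
    · exact fun h => ⟨_, h⟩
  have hmul : Continuous fun p : Mat × Mat => p.1 * p.2 := continuous_fst.matrix_mul continuous_snd
  have hc' : IsClosed {p : Mat × Mat | ∃ c : ℝ, p.1 * p.2 = c • (1 : Mat)} := by
    rw [hc]
    exact isClosed_eq hmul ((hmul.matrix_elem 0 0).smul continuous_const)
  exact (isClosed_posSemidef.preimage continuous_fst).inter <|
    (isClosed_posSemidef.preimage continuous_snd).inter <|
    (isClosed_eq continuous_fst.matrix_trace continuous_const).inter <|
    (isClosed_eq continuous_snd.matrix_trace continuous_const).inter <|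
    hc'

/-! ### The symmetric space and its invariant metric -/

/-- The symmetric space `SL(3) / SO(3)`, as the set of positive definite symmetric matrices of
determinant one. The class of `A` corresponds to `V = (A Aᵗ)^(1/2)`, so that `B` in `SL(3)` acts by
`V ↦ (B V² Bᵗ)^(1/2)`. -/
structure SymSpace where
  mat : Mat
  posDef : mat.PosDef
  det_eq : mat.det = 1

/-- The inclusion of the symmetric space into the compactification. -/
def embed (V : SymSpace) : Mbar :=
  Mbar.ofPair V.mat V.mat⁻¹ V.posDef.posSemidef V.posDef.inv.posSemidef V.posDef.trace_pos
    V.posDef.inv.trace_pos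
    ⟨1, by rw [Matrix.mul_nonsing_inv _ (by simp [V.det_eq]), one_smul]⟩

/-- The symmetric space as a subset of the compactification. -/
def openPart : Set Mbar := Set.range embed

/-- On the symmetric space, the inverse of the inclusion: the matrix `V` with `P = V / tr V`. -/
def unembed (p : Mbar) : Mat := p.P.det ^ (-(1 / 3) : ℝ) • p.P

theorem unembed_embed (V : SymSpace) : unembed (embed V) = V.mat := by
  have ht : 0 < V.mat.trace := V.posDef.trace_pos
  simp only [unembed, embed, Mbar.ofPair, normalise, Matrix.det_smul, V.det_eq, Fintype.card_fin, mul_one,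
    smul_smul]
  rw [← Real.rpow_natCast, ← Real.rpow_mul (inv_nonneg.2 ht.le)]
  norm_num
  rw [Real.rpow_neg_one, inv_inv, mul_inv_cancel₀ ht.ne', one_smul]

/-- For a tangent vector `X` at `V`, the matrix `(V⁻¹ (V X + X V) V⁻¹) / 2`. The map
`φ_B : W ↦ (B W² Bᵗ)^(1/2)` with `B = V⁻¹` takes `V` to the identity, and this is the image of `X` under its
differential at `V`: the derivative of `W²` at `V` is `V X + X V`, and that of the square root at the
identity is division by two. -/
def toIdentity (V X : Mat) : Mat := (1 / 2 : ℝ) • (V⁻¹ * (V * X + X * V) * V⁻¹)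

/-- The invariant Riemannian metric at `V`: the metric `6 Tr (A Aᵗ)` on the tangent space at the
identity, transported to `V` by the action. -/
def killingMetric (V X Y : Mat) : ℝ :=
  6 * (toIdentity V X * (toIdentity V Y).transpose).trace

/-- At the identity the metric is the Killing form `6 Tr (A Aᵗ)`. -/
theorem killingMetric_one (X Y : Mat) : killingMetric 1 X Y = 6 * (X * Y.transpose).trace := by
  have h : ∀ Z : Mat, toIdentity 1 Z = Z := fun Z => by
    simp only [toIdentity, inv_one, one_mul, mul_one]
    rw [← two_smul ℝ, smul_smul]
    norm_num
  rw [killingMetric, h, h]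

/-- The metric is invariant under the action `W = (B V² Bᵗ)^(1/2)`; here `X'` and `Y'` are the images of
`X` and `Y` under the differential of the action, as determined by differentiating `W² = B V² Bᵗ`. -/
theorem killingMetric_invariant {B V W X Y X' Y' : Mat} (hB : B.det = 1) (hV : V.PosDef)
    (hW : W.PosDef) (h : W * W = B * (V * V) * B.transpose)
    (hX : W * X' + X' * W = B * (V * X + X * V) * B.transpose)
    (hY : W * Y' + Y' * W = B * (V * Y + Y * V) * B.transpose) :
    killingMetric W X' Y' = killingMetric V X Y := by
  have key : ∀ {U : Mat}, U.PosDef → ∀ S T : Mat,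
      (((1 / 2 : ℝ) • (U⁻¹ * S * U⁻¹)) * ((1 / 2 : ℝ) • (U⁻¹ * T * U⁻¹)).transpose).trace =
        (1 / 4 : ℝ) * ((U * U)⁻¹ * S * (U * U)⁻¹ * T.transpose).trace := by
    intro U hU S T
    have hs : U⁻¹.transpose = U⁻¹ := by simpa using hU.inv.1.eq
    rw [Matrix.transpose_smul, Matrix.smul_mul, Matrix.mul_smul, smul_smul, Matrix.trace_smul,
      Matrix.transpose_mul, Matrix.transpose_mul, hs, Matrix.mul_inv_rev, smul_eq_mul]
    congr 1
    · norm_num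
    · rw [show U⁻¹ * S * U⁻¹ * (U⁻¹ * (T.transpose * U⁻¹)) =
        U⁻¹ * S * U⁻¹ * U⁻¹ * T.transpose * U⁻¹ by simp only [Matrix.mul_assoc],
        Matrix.trace_mul_comm]
      simp only [Matrix.mul_assoc]
  have hBu : IsUnit B.det := by simp [hB]
  have hBt : IsUnit B.transpose.det := by simp [hB]
  simp only [killingMetric, toIdentity]
  rw [key hW, key hV, hX, hY, h, Matrix.mul_inv_rev, Matrix.mul_inv_rev]
  congr 2
  set S := V * X + X * V
  set T := V * Y + Y * V
  rw [Matrix.transpose_mul, Matrix.transpose_mul, Matrix.transpose_transpose]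
  have e : B.transpose⁻¹ * ((V * V)⁻¹ * B⁻¹) * (B * S * B.transpose) *
      (B.transpose⁻¹ * ((V * V)⁻¹ * B⁻¹)) * (B * (T.transpose * B.transpose)) =
      B.transpose⁻¹ * ((V * V)⁻¹ * (B⁻¹ * B) * S * (B.transpose * B.transpose⁻¹) * (V * V)⁻¹ *
        (B⁻¹ * B) * T.transpose) * B.transpose := by
    simp only [Matrix.mul_assoc]
  rw [e, Matrix.nonsing_inv_mul _ hBu, Matrix.mul_nonsing_inv _ hBt, Matrix.trace_mul_comm,
    ← Matrix.mul_assoc, Matrix.mul_nonsing_inv _ hBt]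
  simp only [mul_one, one_mul]

/-- For a point `p` of the symmetric space and a tangent vector `v` at `p`, the corresponding matrix:
the derivative of `V` along `v`. -/
def velocity (p : Mbar) (v : TangentSpace cornerModel p) : Mat :=
  Matrix.of fun i j => mfderiv cornerModel 𝓘(ℝ) (fun q : Mbar => unembed q i j) p v

/-- The invariant metric of the symmetric space, on the tangent spaces of the compactification.
It is meaningful at the points of `openPart`. -/
def invariantMetric (p : Mbar) (v w : TangentSpace cornerModel p) : ℝ :=
  killingMetric (unembed p) (velocity p v) (velocity p w)

/-- The matrix of a metric in the preferred chart around `p`, at the point with coordinates `x`. -/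
def coordMetric (g : ∀ p : Mbar, TangentSpace cornerModel p → TangentSpace cornerModel p → ℝ)
    (p : Mbar) (x : Fin 5 → ℝ) : Matrix (Fin 5) (Fin 5) ℝ :=
  Matrix.of fun i j => g ((extChartAt cornerModel p).symm x)
    (mfderivWithin 𝓘(ℝ, Fin 5 → ℝ) cornerModel (extChartAt cornerModel p).symm
      (Set.range cornerModel) x (Pi.single i (1 : ℝ) : Fin 5 → ℝ))
    (mfderivWithin 𝓘(ℝ, Fin 5 → ℝ) cornerModel (extChartAt cornerModel p).symm
      (Set.range cornerModel) x (Pi.single j (1 : ℝ) : Fin 5 → ℝ))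

/-- The (positive) Laplacian of a metric, `Δ_g u = -(det g)^(-1/2) ∂ᵢ ((det g)^(1/2) gⁱʲ ∂ⱼ u)`, computed in
the preferred chart around `p`. It is meaningful for `p` in the symmetric space. -/
def laplacian (g : ∀ p : Mbar, TangentSpace cornerModel p → TangentSpace cornerModel p → ℝ)
    (u : Mbar → ℝ) (p : Mbar) : ℝ :=
  -(√(coordMetric g p (extChartAt cornerModel p p)).det)⁻¹ *
    ∑ i, fderiv ℝ (fun x => √(coordMetric g p x).det *
        ∑ j, (coordMetric g p x)⁻¹ i j *
          fderiv ℝ (u ∘ (extChartAt cornerModel p).symm) x (Pi.single j 1))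
      (extChartAt cornerModel p p) (Pi.single i 1)

/-- The vector `v` at `p` is tangent to the submanifold `S`: it annihilates all smooth functions that
vanish on `S`. -/
def TangentTo (S : Set Mbar) (p : Mbar) (v : TangentSpace cornerModel p) : Prop :=
  ∀ f : Mbar → ℝ, ContMDiff cornerModel 𝓘(ℝ) ∞ f → (∀ q ∈ S, f q = 0) →
    mfderiv cornerModel 𝓘(ℝ) f p v = 0

/-- The boundary hypersurface on which the ratio `ν = λ₂ / λ₃` vanishes. -/
def lowerFace : Set Mbar := {p | p.P.rank = 1}

/-- The boundary hypersurface on which the ratio `μ = λ₁ / λ₂` vanishes. -/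
def upperFace : Set Mbar := {p | p.Q.rank = 1}

/-- The fibre through `p` of the fibration of the boundary hypersurface `ν = 0` over the real projective
plane, which sends a point to the eigenline `E₃` of the largest eigenvalue: this is the range of the
rank one matrix `P`. The fibre is a closed disc, the compactified hyperbolic plane of the conformal
classes of `V` on the orthogonal complement of `E₃`. -/
def lowerFibre (p : Mbar) : Set Mbar := {q | q ∈ lowerFace ∧ q.P = p.P}

/-- The fibre through `p` of the fibration of the boundary hypersurface `μ = 0` over the real projective
plane, which sends a point to the eigenline `E₁` of the smallest eigenvalue: this is the range of the
rank one matrix `Q`. -/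
def upperFibre (p : Mbar) : Set Mbar := {q | q ∈ upperFace ∧ q.Q = p.Q}

/-- Smooth vector fields on the compactification, smooth up to the boundary. -/
abbrev VectorField : Type :=
  Cₛ^∞⟮cornerModel; Fin 5 → ℝ, (TangentSpace cornerModel : Mbar → Type)⟯

/-- The edge-to-edge vector fields: smooth vector fields that are tangent to the fibres of the
fibration of each boundary hypersurface. In particular they are tangent to the boundary: the first
condition forces them to be tangent to `lowerFace` and the second to `upperFace`. -/
def eeFields : Submodule ℝ VectorField where
  carrier := {X | (∀ p ∈ lowerFace, TangentTo (lowerFibre p) p (X p)) ∧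
    ∀ p ∈ upperFace, TangentTo (upperFibre p) p (X p)}
  zero_mem' := ⟨fun p _ f _ _ => map_zero (mfderiv cornerModel 𝓘(ℝ) f p),
    fun p _ f _ _ => map_zero (mfderiv cornerModel 𝓘(ℝ) f p)⟩
  add_mem' {X Y} hX hY :=
    ⟨fun p hp f hf h => ((mfderiv cornerModel 𝓘(ℝ) f p).map_add (X p) (Y p)).trans (by
      rw [hX.1 p hp f hf h, hY.1 p hp f hf h, add_zero]),
     fun p hp f hf h => ((mfderiv cornerModel 𝓘(ℝ) f p).map_add (X p) (Y p)).trans (by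
      rw [hX.2 p hp f hf h, hY.2 p hp f hf h, add_zero])⟩
  smul_mem' c X hX :=
    ⟨fun p hp f hf h => ((mfderiv cornerModel 𝓘(ℝ) f p).map_smul c (X p)).trans (by
      rw [hX.1 p hp f hf h, smul_zero]),
     fun p hp f hf h => ((mfderiv cornerModel 𝓘(ℝ) f p).map_smul c (X p)).trans (by
      rw [hX.2 p hp f hf h, smul_zero])⟩

/-- The subspace `I_p V_ee` of finite sums of `f W` with `W` edge-to-edge and `f` smooth, `f p = 0`. -/
def eeVanishing (p : Mbar) : Submodule ℝ eeFields :=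
  Submodule.span ℝ {Z | ∃ (f : Mbar → ℝ) (W : eeFields), ContMDiff cornerModel 𝓘(ℝ) ∞ f ∧
    f p = 0 ∧ ∀ q, Z.1 q = f q • W.1 q}

/-- The fibre at `p` of the edge-to-edge tangent bundle, the bundle of which the edge-to-edge fields are
all the smooth sections: it is `V_ee / I_p V_ee`. -/
abbrev eeTangent (p : Mbar) : Type := eeFields ⧸ eeVanishing p

/-- The value at `p` of an edge-to-edge vector field as a section of the edge-to-edge tangent bundle. -/
def eeValue (X : eeFields) (p : Mbar) : eeTangent p := (eeVanishing p).mkQ X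

/-- A smooth section of the second symmetric power of the edge-to-edge cotangent bundle: a symmetric
bilinear form on each fibre of the edge-to-edge tangent bundle, which depends smoothly on the point,
that is, whose value on each pair of smooth sections is a smooth function on the compactification. -/
structure EESymmetricTensor where
  form : ∀ p : Mbar, LinearMap.BilinForm ℝ (eeTangent p)
  symm : ∀ p v w, form p v w = form p w v
  smooth : ∀ X Y : eeFields, ContMDiff cornerModel 𝓘(ℝ) ∞ fun p =>
    form p (eeValue X p) (eeValue Y p)

/-- The derivative of a function along an edge-to-edge vector field. -/
def fieldDeriv (X : eeFields) (u : Mbar → ℝ) (p : Mbar) : ℝ :=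
  mfderiv cornerModel 𝓘(ℝ) u p (X.1 p)

/-- The product `X₁ ⋯ X_k` of edge-to-edge vector fields, as a differential operator. -/
def eeProduct (L : List eeFields) (u : Mbar → ℝ) : Mbar → ℝ := L.foldr fieldDeriv u

/-- The edge-to-edge differential operators of order at most `m`: finite sums of products of at most
`m` edge-to-edge vector fields. -/
def eeDiffOps (m : ℕ) : Submodule ℝ ((Mbar → ℝ) → (Mbar → ℝ)) :=
  Submodule.span ℝ {D | ∃ L : List eeFields, L.length ≤ m ∧ D = eeProduct L}

/-! ### The smooth structure in polar coordinates

The remaining facts are not used by the definitions above. They show that the smooth structure of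
`Mbar` is the one given by the polar coordinates of `V`: the spectral coordinates
`(λ₁ / λ₂, λ₂ / λ₃, O)` near the corner, and `(s, C, O)` near the interior of the two boundary
hypersurfaces, are local diffeomorphisms of manifolds with corners. -/

theorem isLocalDiffeomorphAt_of_coords {f : Quadrant → Mbar} {x : Quadrant}
    (σ : Equiv.Perm (Fin 3)) {F : (Fin 5 → ℝ) → Fin 5 → ℝ}
    (hF : ∀ᶠ y in 𝓝 x.coords, ContDiffAt ℝ ∞ F y)
    (hinj : ∀ v, fderiv ℝ F x.coords v = 0 → v = 0)
    (hsign : ∀ᶠ y in 𝓝 x.coords, (0 ≤ F y 0 ↔ 0 ≤ y 0) ∧ (0 ≤ F y 1 ↔ 0 ≤ y 1))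
    (hf : ∀ᶠ y in 𝓝 x.coords, ∀ hy : 0 ≤ y 0 ∧ 0 ≤ y 1,
      f ⟨y, hy⟩ ∈ (chart σ).source ∧ (chart σ (f ⟨y, hy⟩)).coords = F y) :
    IsLocalDiffeomorphAt cornerModel cornerModel ∞ f x := by
  have hx0 := hF.self_of_nhds
  let L : (Fin 5 → ℝ) ≃L[ℝ] (Fin 5 → ℝ) :=
    (LinearEquiv.ofInjectiveEndo (fderiv ℝ F x.coords : (Fin 5 → ℝ) →ₗ[ℝ] (Fin 5 → ℝ))
      ((injective_iff_map_eq_zero _).2 hinj)).toContinuousLinearEquiv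
  have hL : (L : (Fin 5 → ℝ) →L[ℝ] (Fin 5 → ℝ)) = fderiv ℝ F x.coords := by
    ext v
    rfl
  have hd : HasFDerivAt F (L : (Fin 5 → ℝ) →L[ℝ] (Fin 5 → ℝ)) x.coords := by
    rw [hL]
    exact (hx0.differentiableAt (by simp)).hasFDerivAt
  let Φ := hx0.toOpenPartialHomeomorph F hd (by simp)
  have hxΦ : x.coords ∈ Φ.source := hx0.mem_toOpenPartialHomeomorph_source hd (by simp)
  have hinv : ∀ᶠ y in 𝓝 x.coords, fderiv ℝ F y ∈
      Set.range ((↑) : ((Fin 5 → ℝ) ≃L[ℝ] (Fin 5 → ℝ)) → ((Fin 5 → ℝ) →L[ℝ] (Fin 5 → ℝ))) := by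
    have hc : ContinuousAt (fderiv ℝ F) x.coords :=
      (hx0.fderiv_right (m := 0) (by simp)).continuousAt
    exact hc (hL ▸ ContinuousLinearEquiv.nhds L)
  obtain ⟨U, hU, hUo, hxU⟩ := eventually_nhds_iff.1
    (hF.and (hsign.and (hf.and (hinv.and (Φ.open_source.mem_nhds hxΦ)))))
  have hUS : U ⊆ Φ.source := fun y hy => (hU y hy).2.2.2.2
  have hFU : IsOpen (F '' U) := Φ.isOpen_image_of_subset_source hUo hUS
  have hleft : ∀ y ∈ U, Φ.symm (F y) = y := fun y hy => Φ.left_inv (hUS hy)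
  have hsmooth : ContDiffOn ℝ ∞ Φ.symm (F '' U) := by
    rintro _ ⟨y, hy, rfl⟩
    obtain ⟨e, he⟩ := (hU y hy).2.2.2.1
    refine (Φ.contDiffAt_symm (f₀' := e) (Φ.map_source (hUS hy)) ?_ ?_).contDiffWithinAt
    · rw [show Φ.symm (Φ y) = y from hleft y hy, he]
      exact ((hU y hy).1.differentiableAt (by simp)).hasFDerivAt
    · rw [show Φ.symm (Φ y) = y from hleft y hy]
      exact (hU y hy).1
  have hrange : Set.range cornerModel = {y | 0 ≤ y 0 ∧ 0 ≤ y 1} := Quadrant.range_coords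
  have hmax : chart σ ∈ IsManifold.maximalAtlas cornerModel ∞ Mbar :=
    IsManifold.subset_maximalAtlas ⟨σ, rfl⟩
  have hpos : ∀ y ∈ U, 0 ≤ F y 0 ∧ 0 ≤ F y 1 ↔ 0 ≤ y 0 ∧ 0 ≤ y 1 := fun y hy =>
    and_congr (hU y hy).2.1.1 (hU y hy).2.1.2
  have htarget : ∀ p ∈ (chart σ).source, (chart σ p).coords ∈ F '' U →
      ∃ y, ∃ hy : y ∈ U, ∃ hy' : 0 ≤ y 0 ∧ 0 ≤ y 1, Φ.symm (chart σ p).coords = y ∧ f ⟨y, hy'⟩ = p := by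
    rintro p hp ⟨y, hy, hyp⟩
    have hy' : 0 ≤ y 0 ∧ 0 ≤ y 1 := by
      rw [← hpos y hy, hyp]
      exact (chart σ p).nonneg
    refine ⟨y, hy, hy', by rw [← hyp, hleft y hy], ?_⟩
    obtain ⟨h1, h2⟩ := (hU y hy).2.2.1 hy'
    exact (chart σ).injOn h1 hp (Quadrant.coords_injective (h2.trans hyp))
  let Ψ : PartialDiffeomorph cornerModel cornerModel Quadrant Mbar ∞ :=
    { toFun := f
      invFun := fun p => Quadrant.clip (Φ.symm (chart σ p).coords)
      source := {z | z.coords ∈ U}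
      target := {p | p ∈ (chart σ).source ∧ (chart σ p).coords ∈ F '' U}
      map_source' := fun z hz => by
        obtain ⟨h1, h2⟩ := (hU z.coords hz).2.2.1 z.nonneg
        exact ⟨h1, z.coords, hz, h2.symm⟩
      map_target' := fun p hp => by
        obtain ⟨y, hy, hy', h1, h2⟩ := htarget p hp.1 hp.2
        change (Quadrant.clip _).coords ∈ U
        rw [h1, Quadrant.val_clip hy']
        exact hy
      left_inv' := fun z hz => by
        obtain ⟨h1, h2⟩ := (hU z.coords hz).2.2.1 z.nonneg
        change Quadrant.clip (Φ.symm (chart σ (f ⟨z.coords, z.nonneg⟩)).coords) = z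
        rw [h2, hleft z.coords hz, Quadrant.clip_val]
      right_inv' := fun p hp => by
        obtain ⟨y, hy, hy', h1, h2⟩ := htarget p hp.1 hp.2
        rw [h1, show Quadrant.clip y = ⟨y, hy'⟩ from Quadrant.coords_injective (Quadrant.val_clip hy'), h2]
      open_source := hUo.preimage Quadrant.continuous_coords
      open_target := (chart σ).isOpen_inter_preimage (hFU.preimage Quadrant.continuous_coords)
      contMDiffOn_toFun := by
        have hFs : ContMDiffOn 𝓘(ℝ, Fin 5 → ℝ) 𝓘(ℝ, Fin 5 → ℝ) ∞ F U :=
          ContDiffOn.contMDiffOn fun y hy => (hU y hy).1.contDiffWithinAt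
        have h1 : ContMDiffOn cornerModel cornerModel ∞
            (fun z : Quadrant => cornerModel.symm (F (cornerModel z))) {z | z.coords ∈ U} := by
          have h0 : ContMDiffOn cornerModel 𝓘(ℝ, Fin 5 → ℝ) ∞ cornerModel
              {z : Quadrant | z.coords ∈ U} := cornerModel.contMDiff.contMDiffOn
          refine cornerModel.contMDiffOn_symm.comp (hFs.comp h0 fun z hz => hz) fun z hz => ?_
          rw [hrange]
          exact (hpos z.coords hz).2 z.nonneg
        refine ((contMDiffOn_symm_of_mem_maximalAtlas hmax).comp h1 fun z _ => ?_).congr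
          fun z hz => ?_
        · trivial
        · obtain ⟨h2, h3⟩ := (hU z.coords hz).2.2.1 z.nonneg
          change f z = (chart σ).symm (Quadrant.clip (F z.coords))
          rw [← h3, Quadrant.clip_val]
          exact ((chart σ).left_inv h2).symm
      contMDiffOn_invFun := by
        have hFs : ContMDiffOn 𝓘(ℝ, Fin 5 → ℝ) 𝓘(ℝ, Fin 5 → ℝ) ∞ Φ.symm (F '' U) :=
          hsmooth.contMDiffOn
        refine cornerModel.contMDiffOn_symm.comp (hFs.comp (cornerModel.contMDiff.comp_contMDiffOn
          ((contMDiffOn_of_mem_maximalAtlas hmax).mono fun p hp => hp.1)) fun p hp => hp.2)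
          fun p hp => ?_
        obtain ⟨y, hy, hy', h1, h2⟩ := htarget p hp.1 hp.2
        change Φ.symm (chart σ p).coords ∈ Set.range cornerModel
        rw [hrange, h1]
        exact hy' }
  exact ⟨Ψ, hxU, fun _ _ => rfl⟩

theorem coordFun_smul {A B : Mat} {a b : ℝ} (ha : a ≠ 0) (hb : b ≠ 0) :
    coordFun (a • A, b • B) = coordFun (A, B) := by
  funext i
  fin_cases i <;> simp [coordFun, mul_div_mul_left _ _ ha, mul_div_mul_left _ _ hb]

theorem isLocalDiffeomorphAt_of_family {f : Quadrant → Mbar} {x : Quadrant}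
    {A B : (Fin 5 → ℝ) → Mat} {κ α β : (Fin 5 → ℝ) → ℝ}
    (hA : ∀ i j, ContDiff ℝ ∞ fun y => A y i j) (hB : ∀ i j, ContDiff ℝ ∞ fun y => B y i j)
    (hAs : ∀ y, (A y).IsSymm) (hBs : ∀ y, (B y).IsSymm)
    (hAB : ∀ y, ∃ c : ℝ, A y * B y = c • (1 : Mat))
    (hadjA : ∀ y, (A y).adjugate = (κ y * β y) • B y)
    (hadjB : ∀ y, (B y).adjugate = (κ y * α y) • A y) (hκ : ∀ y, 0 < κ y)
    (hsign : ∀ᶠ y in 𝓝 x.coords, (0 ≤ α y ↔ 0 ≤ y 0) ∧ (0 ≤ β y ↔ 0 ≤ y 1))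
    (hAt : ∀ y : Quadrant, 0 < (A y.coords).trace) (hBt : ∀ y : Quadrant, 0 < (B y.coords).trace)
    (hfP : ∀ y, (f y).P = normalise (A y.coords)) (hfQ : ∀ y, (f y).Q = normalise (B y.coords))
    (hinj : ∀ v (s t : ℝ), (∀ i j, fderiv ℝ (fun y => A y i j) x.coords v = s * A x.coords i j) →
      (∀ i j, fderiv ℝ (fun y => B y i j) x.coords v = t * B x.coords i j) → v = 0) :
    IsLocalDiffeomorphAt cornerModel cornerModel ∞ f x := by
  obtain ⟨σ, hσ⟩ := exists_chart (f x)
  have hσ' := mem_chart_source.1 hσ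
  have hA2 : 0 < A x.coords (σ 2) (σ 2) := by
    have h1 : 0 ≤ (f x).P (σ 2) (σ 2) := (f x).pos_P.diag_nonneg
    have h2 := lt_of_le_of_ne h1 hσ'.2.symm
    rw [hfP] at h2
    exact pos_of_mul_pos_right h2 (inv_nonneg.2 (hAt x).le)
  have hB0 : 0 < B x.coords (σ 0) (σ 0) := by
    have h1 : 0 ≤ (f x).Q (σ 0) (σ 0) := (f x).pos_Q.diag_nonneg
    have h2 := lt_of_le_of_ne h1 hσ'.1.symm
    rw [hfQ] at h2
    exact pos_of_mul_pos_right h2 (inv_nonneg.2 (hBt x).le)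
  have eA : ∀ᶠ y in 𝓝 x.coords, 0 < A y (σ 2) (σ 2) :=
    (hA (σ 2) (σ 2)).continuous.continuousAt.eventually (lt_mem_nhds hA2)
  have eB : ∀ᶠ y in 𝓝 x.coords, 0 < B y (σ 0) (σ 0) :=
    (hB (σ 0) (σ 0)).continuous.continuousAt.eventually (lt_mem_nhds hB0)
  let F : (Fin 5 → ℝ) → Fin 5 → ℝ := fun y =>
    coordFun ((A y).submatrix σ σ, (B y).submatrix σ σ)
  have hF : ∀ᶠ y in 𝓝 x.coords, ContDiffAt ℝ ∞ F y := by
    filter_upwards [eA, eB] with y hy1 hy2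
    have dA : ∀ i j, ContDiffAt ℝ ∞ (fun y => A y (σ i) (σ j) / A y (σ 2) (σ 2)) y := fun i j =>
      (hA _ _).contDiffAt.div (hA _ _).contDiffAt hy1.ne'
    have dB : ∀ i j, ContDiffAt ℝ ∞ (fun y => B y (σ i) (σ j) / B y (σ 0) (σ 0)) y := fun i j =>
      (hB _ _).contDiffAt.div (hB _ _).contDiffAt hy2.ne'
    refine contDiffAt_pi.2 fun i => ?_
    fin_cases i
    · exact (dB 1 1).sub ((dB 0 1).pow 2)
    · exact (dA 1 1).sub ((dA 1 2).pow 2)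
    · exact (dB 0 1).neg
    · exact dA 0 2
    · exact dA 1 2
  have hraw : ∀ᶠ y in 𝓝 x.coords, ∀ i j,
      A y (σ i) (σ j) = A y (σ 2) (σ 2) * rawP (F y) i j ∧
      B y (σ i) (σ j) = B y (σ 0) (σ 0) * rawQ (F y) i j := by
    filter_upwards [eA, eB] with y hy1 hy2 i j
    obtain ⟨c, hc⟩ := hAB y
    have hc' : (A y).submatrix σ σ * (B y).submatrix σ σ = c • (1 : Mat) := by
      rw [Matrix.submatrix_mul_equiv, hc]
      ext i j
      simp [Matrix.one_apply]
    obtain ⟨h1, h2⟩ := raw_coordFun ((hAs y).submatrix σ) ((hBs y).submatrix σ) hc'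
      hy2.ne' hy1.ne'
    have h1' := congrFun (congrFun h1 i) j
    have h2' := congrFun (congrFun h2 i) j
    simp only [Matrix.smul_apply, Matrix.submatrix_apply, smul_eq_mul] at h1' h2'
    refine ⟨?_, ?_⟩
    · change _ = _ * rawP (coordFun _) i j
      rw [h1']
      field_simp
    · change _ = _ * rawQ (coordFun _) i j
      rw [h2']
      field_simp
  refine isLocalDiffeomorphAt_of_coords σ hF ?_ ?_ ?_
  · intro v hv
    have hFd : HasFDerivAt F (fderiv ℝ F x.coords) x.coords :=
      (hF.self_of_nhds.differentiableAt (by simp)).hasFDerivAt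
    refine hinj v (fderiv ℝ (fun y => A y (σ 2) (σ 2)) x.coords v / A x.coords (σ 2) (σ 2))
      (fderiv ℝ (fun y => B y (σ 0) (σ 0)) x.coords v / B x.coords (σ 0) (σ 0)) ?_ ?_
    · intro i j
      obtain ⟨i, rfl⟩ := σ.surjective i
      obtain ⟨j, rfl⟩ := σ.surjective j
      have h1 : (fun y => A y (σ i) (σ j)) =ᶠ[𝓝 x.coords]
          fun y => A y (σ 2) (σ 2) * rawP (F y) i j := hraw.mono fun y hy => (hy i j).1
      have h2 : HasFDerivAt (fun y => rawP (F y) i j)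
          ((fderiv ℝ (fun z => rawP z i j) (F x.coords)).comp (fderiv ℝ F x.coords)) x.coords :=
        ((contDiff_rawP i j).differentiable (by simp) _).hasFDerivAt.comp x.coords hFd
      have h3 := (((hA (σ 2) (σ 2)).differentiable (by simp) x.coords).hasFDerivAt.fun_mul h2)
      rw [h1.fderiv_eq, h3.fderiv, (hraw.self_of_nhds i j).1]
      simp [hv]
      field_simp
    · intro i j
      obtain ⟨i, rfl⟩ := σ.surjective i
      obtain ⟨j, rfl⟩ := σ.surjective j
      have h1 : (fun y => B y (σ i) (σ j)) =ᶠ[𝓝 x.coords]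
          fun y => B y (σ 0) (σ 0) * rawQ (F y) i j := hraw.mono fun y hy => (hy i j).2
      have h2 : HasFDerivAt (fun y => rawQ (F y) i j)
          ((fderiv ℝ (fun z => rawQ z i j) (F x.coords)).comp (fderiv ℝ F x.coords)) x.coords :=
        ((contDiff_rawQ i j).differentiable (by simp) _).hasFDerivAt.comp x.coords hFd
      have h3 := (((hB (σ 0) (σ 0)).differentiable (by simp) x.coords).hasFDerivAt.fun_mul h2)
      rw [h1.fderiv_eq, h3.fderiv, (hraw.self_of_nhds i j).2]
      simp [hv]
      field_simp
  · filter_upwards [eA, eB, hsign] with y hy1 hy2 hy3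
    have k1 : F y 0 = κ y * A y (σ 2) (σ 2) / B y (σ 0) (σ 0) ^ 2 * α y := by
      have h := congrArg (fun M : Mat => M.submatrix σ σ) (hadjB y)
      simp only [← Matrix.adjugate_submatrix_equiv_self] at h
      have h' := congrFun (congrFun h 2) 2
      rw [Matrix.adjugate_fin_three] at h'
      simp at h'
      have hs := (hBs y).apply (σ 0) (σ 1)
      simp only [F, coordFun, Matrix.cons_val_zero, Matrix.submatrix_apply]
      field_simp
      rw [hs] at h'
      linarith
    have k2 : F y 1 = κ y * B y (σ 0) (σ 0) / A y (σ 2) (σ 2) ^ 2 * β y := by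
      have h := congrArg (fun M : Mat => M.submatrix σ σ) (hadjA y)
      simp only [← Matrix.adjugate_submatrix_equiv_self] at h
      have h' := congrFun (congrFun h 0) 0
      rw [Matrix.adjugate_fin_three] at h'
      simp at h'
      have hs := (hAs y).apply (σ 1) (σ 2)
      simp only [F, coordFun, Matrix.cons_val_zero, Matrix.cons_val_one, Matrix.submatrix_apply]
      field_simp
      rw [hs] at h'
      linarith
    have hk := hκ y
    rw [k1, k2, mul_nonneg_iff_of_pos_left (by positivity),
      mul_nonneg_iff_of_pos_left (by positivity)]
    exact hy3
  · filter_upwards [eA, eB] with y hy1 hy2 hy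
    have hA' : (normalise (A y)) (σ 2) (σ 2) ≠ 0 :=
      mul_ne_zero (inv_ne_zero (hAt ⟨y, hy⟩).ne') hy1.ne'
    have hB' : (normalise (B y)) (σ 0) (σ 0) ≠ 0 :=
      mul_ne_zero (inv_ne_zero (hBt ⟨y, hy⟩).ne') hy2.ne'
    have hs : f ⟨y, hy⟩ ∈ (chart σ).source := by
      rw [mem_chart_source, hfP, hfQ]
      exact ⟨hB', hA'⟩
    refine ⟨hs, ?_⟩
    change (toCoords (permute σ (f ⟨y, hy⟩))).coords = _
    refine (toCoords_val (permute σ (f ⟨y, hy⟩)) hs.1 hs.2).trans ?_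
    change coordFun ((f ⟨y, hy⟩).P.submatrix σ σ, (f ⟨y, hy⟩).Q.submatrix σ σ) = _
    rw [hfP, hfQ]
    exact coordFun_smul (inv_ne_zero (hAt ⟨y, hy⟩).ne') (inv_ne_zero (hBt ⟨y, hy⟩).ne')

/-- Coordinates on skew-symmetric matrices. -/
def skew (a b c : ℝ) : Mat := !![0, a, b; -a, 0, c; -b, -c, 0]

/-- The Cayley transform `(1 - A)⁻¹ (1 + A)` of `A = skew a b c`, multiplied by `1 + a² + b² + c²`. The
scalar factor does not matter after normalisation of traces, and the Cayley transform provides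
coordinates on `SO(3)` around the identity. -/
def rot (a b c : ℝ) : Mat :=
  (1 + a ^ 2 + b ^ 2 + c ^ 2) • (1 : Mat) + (2 : ℝ) • (skew a b c + skew a b c * skew a b c)

theorem rot_eq (a b c : ℝ) : rot a b c =
    !![1 + c ^ 2 - a ^ 2 - b ^ 2, 2 * (a - b * c), 2 * (b + a * c);
       2 * (-a - b * c), 1 + b ^ 2 - a ^ 2 - c ^ 2, 2 * (c - a * b);
       2 * (-b + a * c), 2 * (-c - a * b), 1 + a ^ 2 - b ^ 2 - c ^ 2] := by
  ext i j
  fin_cases i <;> fin_cases j <;>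
    simp [rot, skew, Matrix.mul_apply, Fin.sum_univ_three] <;> ring

theorem skew_cayley (a b c : ℝ) :
    (1 - skew a b c) * rot a b c = (1 + a ^ 2 + b ^ 2 + c ^ 2) • (1 + skew a b c) := by
  rw [rot_eq]
  ext i j
  fin_cases i <;> fin_cases j <;>
    simp [skew, Matrix.mul_apply, Fin.sum_univ_three] <;> ring

theorem rot_transpose_mul (a b c : ℝ) :
    (rot a b c).transpose * rot a b c = (1 + a ^ 2 + b ^ 2 + c ^ 2) ^ 2 • (1 : Mat) := by
  rw [rot_eq]
  ext i j
  fin_cases i <;> fin_cases j <;>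
    simp [Matrix.mul_apply, Fin.sum_univ_three] <;> ring

theorem rot_adjugate (a b c : ℝ) :
    (rot a b c).adjugate = (1 + a ^ 2 + b ^ 2 + c ^ 2) • (rot a b c).transpose := by
  rw [rot_eq, Matrix.adjugate_fin_three]
  ext i j
  fin_cases i <;> fin_cases j <;> simp <;> ring

theorem rot_zero : rot 0 0 0 = 1 := by
  rw [rot_eq]
  ext i j
  fin_cases i <;> fin_cases j <;> simp

theorem hasDerivAt_rot (a b c : ℝ) (i j : Fin 3) :
    HasDerivAt (fun t : ℝ => rot (t * a) (t * b) (t * c) i j)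
      (((2 : ℝ) • skew a b c) i j) 0 := by
  have key : ∀ t : ℝ, rot (t * a) (t * b) (t * c) i j =
      (1 : Mat) i j + t * ((2 : ℝ) • skew a b c) i j + t ^ 2 * (rot a b c - 1 -
        (2 : ℝ) • skew a b c) i j := by
    intro t
    rw [rot_eq, rot_eq]
    fin_cases i <;> fin_cases j <;> simp [skew] <;> ring
  simp only [key]
  have h1 := ((hasDerivAt_id (0 : ℝ)).mul_const (((2 : ℝ) • skew a b c) i j)).const_add
    ((1 : Mat) i j)
  have h2 := ((hasDerivAt_id (0 : ℝ)).pow 2).mul_const ((rot a b c - 1 -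
        (2 : ℝ) • skew a b c) i j)
  simpa using h1.fun_add h2

theorem hasDerivAt_conj {R D : ℝ → Mat} {R' D' : Mat} (h0 : R 0 = 1)
    (hR : ∀ i j, HasDerivAt (fun t => R t i j) (R' i j) 0)
    (hD : ∀ i j, HasDerivAt (fun t => D t i j) (D' i j) 0) (i j : Fin 3) :
    HasDerivAt (fun t => (R t * D t * (R t).transpose) i j)
      ((R' * D 0 + D' + D 0 * R'.transpose) i j) 0 := by
  have h : HasDerivAt (fun t => ∑ k, (∑ l, R t i l * D t l k) * R t j k)
      (∑ k, ((∑ l, (R' i l * D 0 l k + R 0 i l * D' l k)) * R 0 j k +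
        (∑ l, R 0 i l * D 0 l k) * R' j k)) 0 :=
    HasDerivAt.fun_sum fun k _ =>
      (HasDerivAt.fun_sum fun l _ => (hR i l).fun_mul (hD l k)).fun_mul (hR j k)
  have e : (R' * D 0 + D' + D 0 * R'.transpose) i j =
      ∑ k, ((∑ l, (R' i l * D 0 l k + R 0 i l * D' l k)) * R 0 j k +
        (∑ l, R 0 i l * D 0 l k) * R' j k) := by
    have e1 : R' * D 0 + D' + D 0 * R'.transpose =
        (R' * D 0 + R 0 * D') * (R 0).transpose + R 0 * D 0 * R'.transpose := by simp [h0]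
    rw [e1]
    simp only [Matrix.add_apply, Matrix.mul_apply, Matrix.transpose_apply,
      Finset.sum_add_distrib]
  rw [e]
  exact h

theorem hasDerivAt_const_conj {X : ℝ → Mat} {X' : Mat} (O : Mat)
    (hX : ∀ i j, HasDerivAt (fun t => X t i j) (X' i j) 0) (i j : Fin 3) :
    HasDerivAt (fun t => (O * X t * O.transpose) i j) ((O * X' * O.transpose) i j) 0 := by
  have h : HasDerivAt (fun t => ∑ k, (∑ l, O i l * X t l k) * O j k)
      (∑ k, (∑ l, O i l * X' l k) * O j k) 0 :=
    HasDerivAt.fun_sum fun k _ =>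
      (HasDerivAt.fun_sum fun l _ => (hX l k).const_mul _).mul_const _
  exact h

theorem deriv_rotated {O : Mat} (hO : O.transpose * O = 1) {a b c : (Fin 5 → ℝ) →L[ℝ] ℝ}
    {D : (Fin 5 → ℝ) → Mat} (hD : ∀ i j, ContDiff ℝ ∞ fun y => D y i j) {x : Fin 5 → ℝ}
    (ha : a x = 0) (hb : b x = 0) (hc : c x = 0) {v : Fin 5 → ℝ} {s : ℝ}
    (hA : ∀ i j, ContDiff ℝ ∞ fun y => (O * rot (a y) (b y) (c y) * D y *
      (O * rot (a y) (b y) (c y)).transpose) i j)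
    (h : ∀ i j, fderiv ℝ (fun y => (O * rot (a y) (b y) (c y) * D y *
      (O * rot (a y) (b y) (c y)).transpose) i j) x v =
      s * (O * rot (a x) (b x) (c x) * D x * (O * rot (a x) (b x) (c x)).transpose) i j)
    (i j : Fin 3) :
    ((2 : ℝ) • skew (a v) (b v) (c v) * D x - (2 : ℝ) • (D x * skew (a v) (b v) (c v))) i j +
      fderiv ℝ (fun y => D y i j) x v = s * D x i j := by
  have hDl : ∀ i j, HasDerivAt (fun t : ℝ => D (x + t • v) i j)
      (fderiv ℝ (fun y => D y i j) x v) 0 := fun i j =>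
    ((hD i j).differentiable (by simp) x).hasFDerivAt.hasLineDerivAt v
  have hAl : ∀ i j, HasDerivAt (fun t : ℝ => (fun y => (O * rot (a y) (b y) (c y) * D y *
      (O * rot (a y) (b y) (c y)).transpose) i j) (x + t • v)) _ 0 := fun i j =>
    ((hA i j).differentiable (by simp) x).hasFDerivAt.hasLineDerivAt v
  have hX := hasDerivAt_conj (R := fun t => rot (t * a v) (t * b v) (t * c v))
    (D := fun t => D (x + t • v)) (D' := Matrix.of fun i j => fderiv ℝ (fun y => D y i j) x v)
    (by simp [rot_zero]) (hasDerivAt_rot (a v) (b v) (c v)) hDl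
  have hX' := hasDerivAt_const_conj O hX
  have hs : (skew (a v) (b v) (c v)).transpose = -skew (a v) (b v) (c v) := by
    ext i j
    fin_cases i <;> fin_cases j <;> simp [skew]
  have heq : O * ((2 : ℝ) • skew (a v) (b v) (c v) * D x +
      Matrix.of (fun i j => fderiv ℝ (fun y => D y i j) x v) +
      D x * ((2 : ℝ) • skew (a v) (b v) (c v)).transpose) * O.transpose =
      O * (s • D x) * O.transpose := by
    ext i j
    have h1 := hX' i j
    have h2 := hAl i j
    have h3 : (fun t : ℝ => (fun y => (O * rot (a y) (b y) (c y) * D y *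
        (O * rot (a y) (b y) (c y)).transpose) i j) (x + t • v)) =
        fun t : ℝ => (O * (rot (t * a v) (t * b v) (t * c v) * D (x + t • v) *
          (rot (t * a v) (t * b v) (t * c v)).transpose) * O.transpose) i j := by
      funext t
      simp [ha, hb, hc, Matrix.transpose_mul, Matrix.mul_assoc]
    rw [h3] at h2
    have h4 := h1.unique h2
    rw [h i j] at h4
    simp only [zero_smul, add_zero] at h4
    rw [h4]
    simp [ha, hb, hc, rot_zero, Matrix.mul_assoc]
  have heq2 := congrArg (fun M => O.transpose * M * O) heq
  have hcancel : ∀ M : Mat, O.transpose * (O * M * O.transpose) * O = M := fun M => by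
    calc O.transpose * (O * M * O.transpose) * O
        = (O.transpose * O) * M * (O.transpose * O) := by simp only [Matrix.mul_assoc]
      _ = M := by rw [hO, one_mul, mul_one]
  simp only [hcancel] at heq2
  have heq3 := congrFun (congrFun heq2 i) j
  rw [Matrix.transpose_smul, hs, Matrix.smul_mul, Matrix.mul_smul] at heq3
  simp only [Matrix.add_apply, Matrix.smul_apply, Matrix.sub_apply, Matrix.of_apply,
    Matrix.mul_neg, Matrix.neg_apply, smul_eq_mul, Matrix.smul_mul] at heq3 ⊢
  linarith

theorem isLocalDiffeomorphAt_of_rotated {f : Quadrant → Mbar} {x : Quadrant} {O : Mat}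
    (hO : O.transpose * O = 1) (hdet : O.det = 1) {a b c : (Fin 5 → ℝ) →L[ℝ] ℝ}
    {D E : (Fin 5 → ℝ) → Mat} {α β : (Fin 5 → ℝ) → ℝ}
    (ha : a x.coords = 0) (hb : b x.coords = 0) (hc : c x.coords = 0)
    (hD : ∀ i j, ContDiff ℝ ∞ fun y => D y i j) (hE : ∀ i j, ContDiff ℝ ∞ fun y => E y i j)
    (hDs : ∀ y, (D y).IsSymm) (hEs : ∀ y, (E y).IsSymm)
    (hDE : ∀ y, ∃ d : ℝ, D y * E y = d • (1 : Mat))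
    (hadjD : ∀ y, (D y).adjugate = β y • E y) (hadjE : ∀ y, (E y).adjugate = α y • D y)
    (hsign : ∀ᶠ y in 𝓝 x.coords, (0 ≤ α y ↔ 0 ≤ y 0) ∧ (0 ≤ β y ↔ 0 ≤ y 1))
    (hDt : ∀ y : Quadrant, 0 < (D y.coords).trace) (hEt : ∀ y : Quadrant, 0 < (E y.coords).trace)
    (hfP : ∀ y : Quadrant, (f y).P = normalise (O * rot (a y.coords) (b y.coords) (c y.coords) *
      D y.coords * (O * rot (a y.coords) (b y.coords) (c y.coords)).transpose))
    (hfQ : ∀ y : Quadrant, (f y).Q = normalise (O * rot (a y.coords) (b y.coords) (c y.coords) *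
      E y.coords * (O * rot (a y.coords) (b y.coords) (c y.coords)).transpose))
    (hinj : ∀ v (s t : ℝ),
      (∀ i j, ((2 : ℝ) • skew (a v) (b v) (c v) * D x.coords -
        (2 : ℝ) • (D x.coords * skew (a v) (b v) (c v))) i j +
        fderiv ℝ (fun y => D y i j) x.coords v = s * D x.coords i j) →
      (∀ i j, ((2 : ℝ) • skew (a v) (b v) (c v) * E x.coords -
        (2 : ℝ) • (E x.coords * skew (a v) (b v) (c v))) i j +
        fderiv ℝ (fun y => E y i j) x.coords v = t * E x.coords i j) → v = 0) :
    IsLocalDiffeomorphAt cornerModel cornerModel ∞ f x := by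
  have hN : ∀ y, 0 < 1 + a y ^ 2 + b y ^ 2 + c y ^ 2 := fun y => by positivity
  have hS : ∀ y, (O * rot (a y) (b y) (c y)).transpose * (O * rot (a y) (b y) (c y)) =
      (1 + a y ^ 2 + b y ^ 2 + c y ^ 2) ^ 2 • (1 : Mat) := fun y => by
    rw [Matrix.transpose_mul, ← rot_transpose_mul]
    calc _ = (rot (a y) (b y) (c y)).transpose * (O.transpose * O) * rot (a y) (b y) (c y) := by
          simp only [Matrix.mul_assoc]
      _ = _ := by rw [hO, mul_one]
  have hO' : O * O.transpose = 1 := mul_eq_one_comm.1 hO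
  have hadjO : O.adjugate = O.transpose := by
    have h1 := Matrix.adjugate_mul O
    rw [hdet, one_smul] at h1
    calc O.adjugate = O.adjugate * (O * O.transpose) := by rw [hO', mul_one]
      _ = O.transpose := by rw [← Matrix.mul_assoc, h1, one_mul]
  have hadjS : ∀ y, (O * rot (a y) (b y) (c y)).adjugate =
      (1 + a y ^ 2 + b y ^ 2 + c y ^ 2) • (O * rot (a y) (b y) (c y)).transpose := fun y => by
    rw [Matrix.adjugate_mul_distrib, rot_adjugate, hadjO, Matrix.transpose_mul, Matrix.smul_mul]
  have hSadj : ∀ y, (O * rot (a y) (b y) (c y)).transpose.adjugate =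
      (1 + a y ^ 2 + b y ^ 2 + c y ^ 2) • (O * rot (a y) (b y) (c y)) := fun y => by
    rw [← Matrix.adjugate_transpose, hadjS, Matrix.transpose_smul, Matrix.transpose_transpose]
  have smoothS : ∀ i j, ContDiff ℝ ∞ fun y => (O * rot (a y) (b y) (c y)) i j := fun i j => by
    have hr : ∀ i j, ContDiff ℝ ∞ fun y => rot (a y) (b y) (c y) i j := fun i j => by
      simp only [rot_eq]
      fin_cases i <;> fin_cases j <;> simp <;> fun_prop
    simp only [Matrix.mul_apply]
    exact ContDiff.sum fun k _ => contDiff_const.mul (hr k j)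
  have smoothConj : ∀ {X : (Fin 5 → ℝ) → Mat}, (∀ i j, ContDiff ℝ ∞ fun y => X y i j) →
      ∀ i j, ContDiff ℝ ∞ fun y => (O * rot (a y) (b y) (c y) * X y *
        (O * rot (a y) (b y) (c y)).transpose) i j := fun {X} hX i j => by
    have : ∀ y, (O * rot (a y) (b y) (c y) * X y * (O * rot (a y) (b y) (c y)).transpose) i j =
        ∑ k, (∑ l, (O * rot (a y) (b y) (c y)) i l * X y l k) *
          (O * rot (a y) (b y) (c y)) j k := fun y => rfl
    simp only [this]
    exact ContDiff.sum fun k _ => (ContDiff.sum fun l _ => (smoothS i l).mul (hX l k)).mul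
      (smoothS j k)
  have symmConj : ∀ {X : Mat} (S : Mat), X.IsSymm → (S * X * S.transpose).IsSymm :=
    fun {X} S hX => by
      simp [Matrix.IsSymm, Matrix.transpose_mul, hX.eq, Matrix.mul_assoc]
  have traceConj : ∀ (y) (X : Mat), (O * rot (a y) (b y) (c y) * X *
      (O * rot (a y) (b y) (c y)).transpose).trace =
      (1 + a y ^ 2 + b y ^ 2 + c y ^ 2) ^ 2 * X.trace := fun y X => by
    rw [Matrix.trace_mul_comm, ← Matrix.mul_assoc, hS, Matrix.smul_mul, one_mul,
      Matrix.trace_smul, smul_eq_mul]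
  have adjConj : ∀ (y) (X : Mat), (O * rot (a y) (b y) (c y) * X *
      (O * rot (a y) (b y) (c y)).transpose).adjugate =
      (1 + a y ^ 2 + b y ^ 2 + c y ^ 2) ^ 2 • (O * rot (a y) (b y) (c y) * X.adjugate *
      (O * rot (a y) (b y) (c y)).transpose) := fun y X => by
    rw [Matrix.adjugate_mul_distrib, Matrix.adjugate_mul_distrib, hadjS, hSadj]
    simp only [Matrix.smul_mul, Matrix.mul_smul, smul_smul, Matrix.mul_assoc]
    congr 1
    ring
  refine isLocalDiffeomorphAt_of_family (κ := fun y => (1 + a y ^ 2 + b y ^ 2 + c y ^ 2) ^ 2)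
    (α := α) (β := β) (smoothConj hD) (smoothConj hE)
    (fun y => symmConj _ (hDs y)) (fun y => symmConj _ (hEs y)) ?_ ?_ ?_
    (fun y => pow_pos (hN y) 2) hsign ?_ ?_ hfP hfQ ?_
  · intro y
    obtain ⟨d, hd⟩ := hDE y
    set S := O * rot (a y) (b y) (c y)
    have hS' : S * S.transpose = (1 + a y ^ 2 + b y ^ 2 + c y ^ 2) ^ 2 • (1 : Mat) := by
      have h1 : ((1 + a y ^ 2 + b y ^ 2 + c y ^ 2) ^ 2)⁻¹ • S.transpose * S = 1 := by
        rw [Matrix.smul_mul, hS y, smul_smul, inv_mul_cancel₀ (pow_pos (hN y) 2).ne', one_smul]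
      have h2 := mul_eq_one_comm.1 h1
      rw [Matrix.mul_smul] at h2
      rw [← h2, smul_smul, mul_inv_cancel₀ (pow_pos (hN y) 2).ne', one_smul]
    refine ⟨(1 + a y ^ 2 + b y ^ 2 + c y ^ 2) ^ 2 * (d * (1 + a y ^ 2 + b y ^ 2 + c y ^ 2) ^ 2),
      ?_⟩
    calc S * D y * S.transpose * (S * E y * S.transpose)
        = S * D y * (S.transpose * S) * E y * S.transpose := by simp only [Matrix.mul_assoc]
      _ = (1 + a y ^ 2 + b y ^ 2 + c y ^ 2) ^ 2 • (S * (D y * E y) * S.transpose) := by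
          rw [hS y]
          simp only [Matrix.mul_smul, Matrix.smul_mul, mul_one, Matrix.mul_assoc]
      _ = _ := by
          rw [hd, Matrix.mul_smul, Matrix.smul_mul, mul_one, hS', smul_smul, smul_smul, mul_assoc]
  · intro y
    rw [adjConj, hadjD, Matrix.mul_smul, Matrix.smul_mul, smul_smul]
  · intro y
    rw [adjConj, hadjE, Matrix.mul_smul, Matrix.smul_mul, smul_smul]
  · intro y
    rw [traceConj]
    exact mul_pos (pow_pos (hN _) 2) (hDt y)
  · intro y
    rw [traceConj]
    exact mul_pos (pow_pos (hN _) 2) (hEt y)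
  · intro v s t h1 h2
    exact hinj v s t (deriv_rotated hO hD ha hb hc (smoothConj hD) h1)
      (deriv_rotated hO hE ha hb hc (smoothConj hE) h2)

/-- The point given by `R D Rᵗ` and `R E Rᵗ`, where the rotation `R` is the product of `O` and the
Cayley transform of `skew a b c`. -/
def rotate (O : Mat) (hO : O.transpose * O = 1) (a b c : ℝ) (D E : Mat) (hD : D.PosSemidef)
    (hE : E.PosSemidef) (tD : 0 < D.trace) (tE : 0 < E.trace)
    (h : ∃ d : ℝ, D * E = d • (1 : Mat)) : Mbar :=
  have hS : (O * rot a b c).transpose * (O * rot a b c) =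
      (1 + a ^ 2 + b ^ 2 + c ^ 2) ^ 2 • (1 : Mat) := by
    rw [Matrix.transpose_mul, ← rot_transpose_mul]
    calc _ = (rot a b c).transpose * (O.transpose * O) * rot a b c := by
          simp only [Matrix.mul_assoc]
      _ = _ := by rw [hO, mul_one]
  have tr : ∀ X : Mat, 0 < X.trace → 0 < (O * rot a b c * X * (O * rot a b c).transpose).trace :=
    fun X hX => by
      rw [Matrix.trace_mul_comm, ← Matrix.mul_assoc, hS, Matrix.smul_mul, one_mul,
        Matrix.trace_smul, smul_eq_mul]
      positivity
  Mbar.ofPair (O * rot a b c * D * (O * rot a b c).transpose)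
    (O * rot a b c * E * (O * rot a b c).transpose)
    (by simpa using hD.mul_mul_conjTranspose_same (O * rot a b c))
    (by simpa using hE.mul_mul_conjTranspose_same (O * rot a b c))
    (tr D tD) (tr E tE) (by
      obtain ⟨d, hd⟩ := h
      set S := O * rot a b c
      have hN : (0 : ℝ) < (1 + a ^ 2 + b ^ 2 + c ^ 2) ^ 2 := by positivity
      have hS' : S * S.transpose = (1 + a ^ 2 + b ^ 2 + c ^ 2) ^ 2 • (1 : Mat) := by
        have h1 : ((1 + a ^ 2 + b ^ 2 + c ^ 2) ^ 2)⁻¹ • S.transpose * S = 1 := by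
          rw [Matrix.smul_mul, hS, smul_smul, inv_mul_cancel₀ hN.ne', one_smul]
        have h2 := mul_eq_one_comm.1 h1
        rw [Matrix.mul_smul] at h2
        rw [← h2, smul_smul, mul_inv_cancel₀ hN.ne', one_smul]
      refine ⟨(1 + a ^ 2 + b ^ 2 + c ^ 2) ^ 2 * (d * (1 + a ^ 2 + b ^ 2 + c ^ 2) ^ 2), ?_⟩
      calc S * D * S.transpose * (S * E * S.transpose)
          = S * D * (S.transpose * S) * E * S.transpose := by simp only [Matrix.mul_assoc]
        _ = (1 + a ^ 2 + b ^ 2 + c ^ 2) ^ 2 • (S * (D * E) * S.transpose) := by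
            rw [hS]
            simp only [Matrix.mul_smul, Matrix.smul_mul, mul_one, Matrix.mul_assoc]
        _ = _ := by
            rw [hd, Matrix.mul_smul, Matrix.smul_mul, mul_one, hS', smul_smul, smul_smul,
              mul_assoc])

def cornerD (x : Fin 5 → ℝ) : Mat := Matrix.diagonal ![x 0 * x 1, x 1, 1]

def cornerE (x : Fin 5 → ℝ) : Mat := Matrix.diagonal ![1, x 0, x 0 * x 1]

theorem cornerD_eq (x : Fin 5 → ℝ) : cornerD x = !![x 0 * x 1, 0, 0; 0, x 1, 0; 0, 0, 1] := by
  ext i j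
  fin_cases i <;> fin_cases j <;> simp [cornerD]

theorem cornerE_eq (x : Fin 5 → ℝ) : cornerE x = !![1, 0, 0; 0, x 0, 0; 0, 0, x 0 * x 1] := by
  ext i j
  fin_cases i <;> fin_cases j <;> simp [cornerE]

theorem cornerD_mul (x : Fin 5 → ℝ) : cornerD x * cornerE x = (x 0 * x 1) • (1 : Mat) := by
  rw [cornerD_eq, cornerE_eq]
  ext i j
  fin_cases i <;> fin_cases j <;> simp [Matrix.mul_apply, Fin.sum_univ_three, mul_comm]

theorem cornerD_trace (x : Quadrant) : 0 < (cornerD x.coords).trace := by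
  have h0 := x.nonneg.1
  have h1 := x.nonneg.2
  simp only [cornerD_eq, Matrix.trace_fin_three, Matrix.of_apply, Matrix.cons_val]
  positivity

theorem cornerE_trace (x : Quadrant) : 0 < (cornerE x.coords).trace := by
  have h0 := x.nonneg.1
  have h1 := x.nonneg.2
  simp only [cornerE_eq, Matrix.trace_fin_three, Matrix.of_apply, Matrix.cons_val]
  positivity

/-- Polar coordinates near the corner: `V` is a multiple of `R diag(μ ν, ν, 1) Rᵗ`, where `R` is
`O` times the Cayley transform of a small skew-symmetric matrix. -/
def polarCorner (O : Mat) (hO : O.transpose * O = 1) (x : Quadrant) : Mbar :=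
  rotate O hO (x.coords 2) (x.coords 3) (x.coords 4) (cornerD x.coords) (cornerE x.coords)
    (Matrix.PosSemidef.diagonal fun i => by
      fin_cases i <;> simp [x.nonneg.1, x.nonneg.2, mul_nonneg])
    (Matrix.PosSemidef.diagonal fun i => by
      fin_cases i <;> simp [x.nonneg.1, x.nonneg.2, mul_nonneg])
    (cornerD_trace x) (cornerE_trace x) ⟨_, cornerD_mul x.coords⟩

theorem fderiv_coord (k : Fin 5) (x v : Fin 5 → ℝ) :
    fderiv ℝ (fun y : Fin 5 → ℝ => y k) x v = v k := by
  have : (fun y : Fin 5 → ℝ => y k) = (ContinuousLinearMap.proj k : (Fin 5 → ℝ) →L[ℝ] ℝ) := rfl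
  rw [this, ContinuousLinearMap.fderiv]
  rfl

theorem polarCorner_isLocalDiffeomorphAt {O : Mat} (hO : O.transpose * O = 1) (hdet : O.det = 1)
    (x : Quadrant) (h0 : x.coords 0 < 1) (h1 : x.coords 1 < 1)
    (h2 : x.coords 2 = 0) (h3 : x.coords 3 = 0) (h4 : x.coords 4 = 0) :
    IsLocalDiffeomorphAt cornerModel cornerModel ∞ (polarCorner O hO) x := by
  refine isLocalDiffeomorphAt_of_rotated hO hdet
    (a := ContinuousLinearMap.proj 2) (b := ContinuousLinearMap.proj 3)
    (c := ContinuousLinearMap.proj 4) (D := cornerD) (E := cornerE)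
    (α := fun y => y 0) (β := fun y => y 1) h2 h3 h4 ?_ ?_ ?_ ?_
    (fun y => ⟨_, cornerD_mul y⟩) ?_ ?_ (Filter.Eventually.of_forall fun y => by simp)
    cornerD_trace cornerE_trace (fun _ => rfl) (fun _ => rfl) ?_
  · intro i j
    simp only [cornerD_eq]
    fin_cases i <;> fin_cases j <;> simp <;> fun_prop
  · intro i j
    simp only [cornerE_eq]
    fin_cases i <;> fin_cases j <;> simp <;> fun_prop
  · exact fun y => Matrix.isSymm_diagonal _
  · exact fun y => Matrix.isSymm_diagonal _
  · intro y
    rw [cornerD_eq, cornerE_eq, Matrix.adjugate_fin_three]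
    ext i j
    fin_cases i <;> fin_cases j <;> simp <;> ring
  · intro y
    rw [cornerD_eq, cornerE_eq, Matrix.adjugate_fin_three]
    ext i j
    fin_cases i <;> fin_cases j <;> simp <;> ring
  · intro v s t hD hE
    have n0 := x.nonneg.1
    have n1 := x.nonneg.2
    have D22 := hD 2 2
    have D11 := hD 1 1
    have D02 := hD 0 2
    have D12 := hD 1 2
    have E00 := hE 0 0
    have E11 := hE 1 1
    have E01 := hE 0 1
    simp only [cornerD_eq, cornerE_eq] at D22 D11 D02 D12 E00 E11 E01
    simp [skew, Matrix.mul_apply, Fin.sum_univ_three, fderiv_coord] at D22 D11 D02 D12 E00 E11 E01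
    funext i
    have hμν : x.coords 0 * x.coords 1 < 1 := by nlinarith
    have v0 : v 0 = 0 := by rw [← E00] at E11; simpa using E11
    have v1 : v 1 = 0 := by rw [← D22] at D11; simpa using D11
    have v2 : v 2 = 0 := by
      have : v 2 * (x.coords 0 - 1) = 0 := by linarith
      exact (mul_eq_zero.1 this).resolve_right (by linarith)
    have v3 : v 3 = 0 := by
      have : v 3 * (1 - x.coords 0 * x.coords 1) = 0 := by linarith
      exact (mul_eq_zero.1 this).resolve_right (by linarith)
    have v4 : v 4 = 0 := by
      have : v 4 * (1 - x.coords 1) = 0 := by linarith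
      exact (mul_eq_zero.1 this).resolve_right (by linarith)
    fin_cases i <;> assumption

/-- The matrix with diagonal blocks `s C` and `1`, where `C` is a general positive definite two by two
matrix of determinant one, and `s = x 1`. The coordinates on the set of these `C` are `r = x 0 - t` and `x 2`. -/
def lowerD (t : ℝ) (x : Fin 5 → ℝ) : Mat :=
  !![x 1 * Real.exp (x 0 - t), x 1 * x 2, 0;
     x 1 * x 2, x 1 * ((1 + x 2 ^ 2) * Real.exp (t - x 0)), 0;
     0, 0, 1]

/-- The matrix with diagonal blocks `C⁻¹` and `s`. -/
def lowerE (t : ℝ) (x : Fin 5 → ℝ) : Mat :=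
  !![(1 + x 2 ^ 2) * Real.exp (t - x 0), -x 2, 0;
     -x 2, Real.exp (x 0 - t), 0;
     0, 0, x 1]

/-- The matrix with diagonal blocks `s` and `C`, where `s = x 0`. -/
def upperD (t : ℝ) (x : Fin 5 → ℝ) : Mat :=
  !![x 0, 0, 0;
     0, Real.exp (x 1 - t), x 4;
     0, x 4, (1 + x 4 ^ 2) * Real.exp (t - x 1)]

/-- The matrix with diagonal blocks `1` and `s C⁻¹`. -/
def upperE (t : ℝ) (x : Fin 5 → ℝ) : Mat :=
  !![1, 0, 0;
     0, x 0 * ((1 + x 4 ^ 2) * Real.exp (t - x 1)), x 0 * -x 4;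
     0, x 0 * -x 4, x 0 * Real.exp (x 1 - t)]

theorem exp_sub_mul (r t : ℝ) : Real.exp (r - t) * Real.exp (t - r) = 1 := by
  rw [← Real.exp_add]
  simp

theorem posSemidef_block {p b q s u : ℝ} (hp : 0 < p) (h : p * q = 1 + b ^ 2) (hs : 0 ≤ s)
    (hu : 0 ≤ u) : (!![s * p, s * b, 0; s * b, s * q, 0; 0, 0, u] : Mat).PosSemidef := by
  refine Matrix.PosSemidef.of_dotProduct_mulVec_nonneg ?_ fun x => ?_
  · ext i j
    fin_cases i <;> fin_cases j <;> simp
  · have h1 : 0 ≤ p * x 0 ^ 2 + 2 * b * x 0 * x 1 + q * x 1 ^ 2 := by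
      refine nonneg_of_mul_nonneg_right (a := p) ?_ hp
      have : p * (p * x 0 ^ 2 + 2 * b * x 0 * x 1 + q * x 1 ^ 2) =
          (p * x 0 + b * x 1) ^ 2 + x 1 ^ 2 := by
        linear_combination x 1 ^ 2 * h
      rw [this]
      positivity
    have h2 : 0 ≤ s * (p * x 0 ^ 2 + 2 * b * x 0 * x 1 + q * x 1 ^ 2) + u * x 2 ^ 2 := by
      positivity
    refine h2.trans_eq ?_
    simp [dotProduct, Matrix.mulVec, Fin.sum_univ_three]
    ring

theorem posSemidef_block' {p b q s u : ℝ} (hp : 0 < p) (h : p * q = 1 + b ^ 2) (hs : 0 ≤ s)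
    (hu : 0 ≤ u) : (!![u, 0, 0; 0, s * p, s * b; 0, s * b, s * q] : Mat).PosSemidef := by
  convert (posSemidef_block hp h hs hu).submatrix ![2, 0, 1] using 1
  ext i j
  fin_cases i <;> fin_cases j <;> rfl

theorem lowerD_mul (t : ℝ) (x : Fin 5 → ℝ) : lowerD t x * lowerE t x = x 1 • (1 : Mat) := by
  have h := exp_sub_mul (x 0) t
  rw [lowerD, lowerE]
  ext i j
  fin_cases i <;> fin_cases j <;> simp [Matrix.mul_apply, Fin.sum_univ_three] <;>
    first | ring1 | linear_combination x 1 * (1 + x 2 ^ 2) * h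

theorem upperD_mul (t : ℝ) (x : Fin 5 → ℝ) : upperD t x * upperE t x = x 0 • (1 : Mat) := by
  have h := exp_sub_mul (x 1) t
  rw [upperD, upperE]
  ext i j
  fin_cases i <;> fin_cases j <;> simp [Matrix.mul_apply, Fin.sum_univ_three] <;>
    first | ring1 | linear_combination x 0 * (1 + x 4 ^ 2) * h

theorem lowerD_trace (t : ℝ) (x : Quadrant) : 0 < (lowerD t x.coords).trace := by
  have h1 := x.nonneg.2
  simp only [lowerD, Matrix.trace_fin_three, Matrix.of_apply, Matrix.cons_val]
  positivity

theorem lowerE_trace (t : ℝ) (x : Quadrant) : 0 < (lowerE t x.coords).trace := by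
  have h1 := x.nonneg.2
  simp only [lowerE, Matrix.trace_fin_three, Matrix.of_apply, Matrix.cons_val]
  positivity

theorem upperD_trace (t : ℝ) (x : Quadrant) : 0 < (upperD t x.coords).trace := by
  have h1 := x.nonneg.1
  simp only [upperD, Matrix.trace_fin_three, Matrix.of_apply, Matrix.cons_val]
  positivity

theorem upperE_trace (t : ℝ) (x : Quadrant) : 0 < (upperE t x.coords).trace := by
  have h1 := x.nonneg.1
  simp only [upperE, Matrix.trace_fin_three, Matrix.of_apply, Matrix.cons_val]
  positivity

theorem lowerD_posSemidef (t : ℝ) (x : Quadrant) : (lowerD t x.coords).PosSemidef :=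
  posSemidef_block (Real.exp_pos _)
    (by linear_combination (1 + x.coords 2 ^ 2) * exp_sub_mul (x.coords 0) t) x.nonneg.2
    zero_le_one

theorem lowerE_posSemidef (t : ℝ) (x : Quadrant) : (lowerE t x.coords).PosSemidef := by
  simpa [lowerE] using posSemidef_block (p := (1 + x.coords 2 ^ 2) * Real.exp (t - x.coords 0))
    (b := -x.coords 2) (q := Real.exp (x.coords 0 - t)) (s := 1) (u := x.coords 1) (by positivity)
    (by linear_combination (1 + x.coords 2 ^ 2) * exp_sub_mul (x.coords 0) t) zero_le_one
    x.nonneg.2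

theorem upperD_posSemidef (t : ℝ) (x : Quadrant) : (upperD t x.coords).PosSemidef := by
  simpa [upperD] using posSemidef_block' (q := (1 + x.coords 4 ^ 2) * Real.exp (t - x.coords 1))
    (b := x.coords 4) (p := Real.exp (x.coords 1 - t)) (s := 1) (u := x.coords 0) (by positivity)
    (by linear_combination (1 + x.coords 4 ^ 2) * exp_sub_mul (x.coords 1) t) zero_le_one
    x.nonneg.1

theorem upperE_posSemidef (t : ℝ) (x : Quadrant) : (upperE t x.coords).PosSemidef :=
  posSemidef_block' (by positivity)
    (by linear_combination (1 + x.coords 4 ^ 2) * exp_sub_mul (x.coords 1) t) x.nonneg.1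
    zero_le_one

/-- Polar coordinates near an interior point of `lowerFace`: `V` is a multiple of `R diag(s C, 1) Rᵗ`,
so that `s = λ₃^(-3/2)` for `V` of determinant one. -/
def polarLower (t : ℝ) (O : Mat) (hO : O.transpose * O = 1) (x : Quadrant) : Mbar :=
  rotate O hO 0 (x.coords 3) (x.coords 4) (lowerD t x.coords) (lowerE t x.coords)
    (lowerD_posSemidef t x) (lowerE_posSemidef t x) (lowerD_trace t x) (lowerE_trace t x)
    ⟨_, lowerD_mul t x.coords⟩

/-- Polar coordinates near an interior point of `upperFace`: `V` is a multiple of `R diag(s, C) Rᵗ`. -/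
def polarUpper (t : ℝ) (O : Mat) (hO : O.transpose * O = 1) (x : Quadrant) : Mbar :=
  rotate O hO (x.coords 2) (x.coords 3) 0 (upperD t x.coords) (upperE t x.coords)
    (upperD_posSemidef t x) (upperE_posSemidef t x) (upperD_trace t x) (upperE_trace t x)
    ⟨_, upperD_mul t x.coords⟩

theorem polarLower_isLocalDiffeomorphAt (t : ℝ) {O : Mat} (hO : O.transpose * O = 1)
    (hdet : O.det = 1) (x : Quadrant) (h0 : 0 < x.coords 0) (h1 : x.coords 1 = 0)
    (h3 : x.coords 3 = 0) (h4 : x.coords 4 = 0) :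
    IsLocalDiffeomorphAt cornerModel cornerModel ∞ (polarLower t O hO) x := by
  refine isLocalDiffeomorphAt_of_rotated hO hdet
    (a := 0) (b := ContinuousLinearMap.proj 3)
    (c := ContinuousLinearMap.proj 4) (D := lowerD t) (E := lowerE t)
    (α := fun _ => 1) (β := fun y => y 1) rfl h3 h4 ?_ ?_ ?_ ?_
    (fun y => ⟨_, lowerD_mul t y⟩) ?_ ?_ ?_
    (lowerD_trace t) (lowerE_trace t) (fun _ => rfl) (fun _ => rfl) ?_
  · intro i j
    simp only [lowerD]
    fin_cases i <;> fin_cases j <;> simp <;> fun_prop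
  · intro i j
    simp only [lowerE]
    fin_cases i <;> fin_cases j <;> simp <;> fun_prop
  · intro y
    ext i j
    fin_cases i <;> fin_cases j <;> simp [lowerD]
  · intro y
    ext i j
    fin_cases i <;> fin_cases j <;> simp [lowerE]
  · intro y
    have h := exp_sub_mul (y 0) t
    rw [lowerD, lowerE, Matrix.adjugate_fin_three]
    ext i j
    fin_cases i <;> fin_cases j <;> simp <;>
      first | ring1 | linear_combination y 1 ^ 2 * (1 + y 2 ^ 2) * h
  · intro y
    have h := exp_sub_mul (y 0) t
    rw [lowerD, lowerE, Matrix.adjugate_fin_three]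
    ext i j
    fin_cases i <;> fin_cases j <;> simp <;>
      first | ring1 | linear_combination (1 + y 2 ^ 2) * h
  · filter_upwards [(continuous_apply (0 : Fin 5)).continuousAt.eventually (lt_mem_nhds h0)] with y hy
    exact ⟨by simp [hy.le], Iff.rfl⟩
  · intro v s τ hD hE
    have D02 := hD 0 2
    have D12 := hD 1 2
    have E00 := hE 0 0
    have E01 := hE 0 1
    have E11 := hE 1 1
    have E22 := hE 2 2
    have d0 : ∀ y : Fin 5 → ℝ, DifferentiableAt ℝ (fun y : Fin 5 → ℝ => y 0) y := fun y => by
      fun_prop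
    have e1 : fderiv ℝ (fun y : Fin 5 → ℝ => Real.exp (y 0 - t)) x.coords v =
        Real.exp (x.coords 0 - t) * v 0 := by
      have := ((d0 x.coords).hasFDerivAt.sub_const t).exp
      rw [this.fderiv]
      simp [fderiv_coord]
    have e2 : fderiv ℝ (fun y : Fin 5 → ℝ => (1 + y 2 ^ 2) * Real.exp (t - y 0)) x.coords v =
        (1 + x.coords 2 ^ 2) * (Real.exp (t - x.coords 0) * -v 0) +
          Real.exp (t - x.coords 0) * (2 * x.coords 2 * v 2) := by
      have d2 : DifferentiableAt ℝ (fun y : Fin 5 → ℝ => y 2) x.coords := by fun_prop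
      have := ((d2.hasFDerivAt.pow 2).const_add 1).mul ((d0 x.coords).hasFDerivAt.const_sub t).exp
      have h := this.fderiv
      simp only [Pi.mul_def] at h
      rw [h]
      simp [fderiv_coord]
    simp only [lowerD, lowerE] at D02 D12 E00 E01 E11 E22
    simp [skew, fderiv_coord, e1, e2, h1] at D02 D12 E00 E01 E11 E22
    have pe := Real.exp_pos (x.coords 0 - t)
    have pe' := Real.exp_pos (t - x.coords 0)
    have v0 : v 0 = τ := by
      have : Real.exp (x.coords 0 - t) * (v 0 - τ) = 0 := by linarith
      exact sub_eq_zero.1 ((mul_eq_zero.1 this).resolve_left pe.ne')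
    have v2 : v 2 = τ * x.coords 2 := by linarith
    have hτ : τ = 0 := by
      rw [v0, v2] at E00
      have : Real.exp (t - x.coords 0) * τ = 0 := by linarith
      exact (mul_eq_zero.1 this).resolve_left pe'.ne'
    rw [hτ] at v0 v2
    rw [zero_mul] at v2
    funext i
    fin_cases i <;> assumption

theorem polarUpper_isLocalDiffeomorphAt (t : ℝ) {O : Mat} (hO : O.transpose * O = 1)
    (hdet : O.det = 1) (x : Quadrant) (h0 : x.coords 0 = 0) (h1 : 0 < x.coords 1)
    (h2 : x.coords 2 = 0) (h3 : x.coords 3 = 0) :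
    IsLocalDiffeomorphAt cornerModel cornerModel ∞ (polarUpper t O hO) x := by
  refine isLocalDiffeomorphAt_of_rotated hO hdet
    (a := ContinuousLinearMap.proj 2) (b := ContinuousLinearMap.proj 3)
    (c := 0) (D := upperD t) (E := upperE t)
    (α := fun y => y 0) (β := fun _ => 1) h2 h3 rfl ?_ ?_ ?_ ?_
    (fun y => ⟨_, upperD_mul t y⟩) ?_ ?_ ?_
    (upperD_trace t) (upperE_trace t) (fun _ => rfl) (fun _ => rfl) ?_
  · intro i j
    simp only [upperD]
    fin_cases i <;> fin_cases j <;> simp <;> fun_prop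
  · intro i j
    simp only [upperE]
    fin_cases i <;> fin_cases j <;> simp <;> fun_prop
  · intro y
    ext i j
    fin_cases i <;> fin_cases j <;> simp [upperD]
  · intro y
    ext i j
    fin_cases i <;> fin_cases j <;> simp [upperE]
  · intro y
    have h := exp_sub_mul (y 1) t
    rw [upperD, upperE, Matrix.adjugate_fin_three]
    ext i j
    fin_cases i <;> fin_cases j <;> simp <;>
      first | ring1 | linear_combination (1 + y 4 ^ 2) * h
  · intro y
    have h := exp_sub_mul (y 1) t
    rw [upperD, upperE, Matrix.adjugate_fin_three]
    ext i j
    fin_cases i <;> fin_cases j <;> simp <;>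
      first | ring1 | linear_combination y 0 ^ 2 * (1 + y 4 ^ 2) * h
  · filter_upwards [(continuous_apply (1 : Fin 5)).continuousAt.eventually (lt_mem_nhds h1)] with y hy
    exact ⟨Iff.rfl, by simp [hy.le]⟩
  · intro v s τ hD hE
    have E01 := hE 0 1
    have E02 := hE 0 2
    have D00 := hD 0 0
    have D11 := hD 1 1
    have D12 := hD 1 2
    have D22 := hD 2 2
    have d1 : ∀ y : Fin 5 → ℝ, DifferentiableAt ℝ (fun y : Fin 5 → ℝ => y 1) y := fun y => by
      fun_prop
    have e1 : fderiv ℝ (fun y : Fin 5 → ℝ => Real.exp (y 1 - t)) x.coords v =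
        Real.exp (x.coords 1 - t) * v 1 := by
      have := ((d1 x.coords).hasFDerivAt.sub_const t).exp
      rw [this.fderiv]
      simp [fderiv_coord]
    have e2 : fderiv ℝ (fun y : Fin 5 → ℝ => (1 + y 4 ^ 2) * Real.exp (t - y 1)) x.coords v =
        (1 + x.coords 4 ^ 2) * (Real.exp (t - x.coords 1) * -v 1) +
          Real.exp (t - x.coords 1) * (2 * x.coords 4 * v 4) := by
      have d4 : DifferentiableAt ℝ (fun y : Fin 5 → ℝ => y 4) x.coords := by fun_prop
      have := ((d4.hasFDerivAt.pow 2).const_add 1).mul ((d1 x.coords).hasFDerivAt.const_sub t).exp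
      have h := this.fderiv
      simp only [Pi.mul_def] at h
      rw [h]
      simp [fderiv_coord]
    simp only [upperD, upperE] at E01 E02 D00 D11 D12 D22
    simp [skew, fderiv_coord, e1, e2, h0] at E01 E02 D00 D11 D12 D22
    have pe := Real.exp_pos (x.coords 1 - t)
    have pe' := Real.exp_pos (t - x.coords 1)
    have v1 : v 1 = s := by
      have : Real.exp (x.coords 1 - t) * (v 1 - s) = 0 := by linarith
      exact sub_eq_zero.1 ((mul_eq_zero.1 this).resolve_left pe.ne')
    have v4 : v 4 = s * x.coords 4 := by linarith
    have hs : s = 0 := by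
      rw [v1, v4] at D22
      have : Real.exp (t - x.coords 1) * s = 0 := by linarith
      exact (mul_eq_zero.1 this).resolve_left pe'.ne'
    rw [hs] at v1 v4
    rw [zero_mul] at v4
    funext i
    fin_cases i <;> assumption

end SL3

end

/-!
A tangent vector `X` of the symmetric space at `V` corresponds to the symmetric part of the logarithmic
derivative `K = X(V) V⁻¹` in the tangent space at the identity (`toIdentity_velocity`), so everything is
expressed through `K`.

In a chart, where `V` is a multiple of `n diag(t₁ t₂, t₂, 1) nᵗ` with `n` unipotent, Hadamard's lemma
(`exists_eq_mul_of_eq_zero`) shows that the edge-to-edge fields are the combinations with smooth coefficients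
of `t₁ ∂₁, t₂ ∂₂, t₁ N₁₂, t₁ t₂ N₁₃, t₂ N₂₃`, where the `N` are left-invariant fields on the unipotent group
(`exists_comps_eq_frameVec`). For these fields `K` is polynomial in the coordinates (`frameK`). The local
formulas agree on the dense interior, hence `K` extends smoothly to the compactification
(`exists_logDeriv_extension`), and with it the metric `6 Tr (A Bᵗ)` of two edge-to-edge fields (`eeMetric`).

The extended metric does not degenerate at the boundary (`det_frameMatrix_ne_zero`): if `K` is
skew-symmetric, then it annihilates `P` and `Q`, which forces `K = 0`. Therefore taking the symmetric part of
`K` trivialises the edge-to-edge tangent bundle, and a partition of unity gives global edge-to-edge fields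
`Z` that correspond to the members of an orthogonal basis of the symmetric trace-free matrices
(`exists_field`, `eeFrame`). In this frame `Δ u = - ∑ ‖Z‖⁻² (Z Z u + (div Z) Z u)`
(`laplacian_eq_sum_frame`), and as the squared norms are constant, `div Z` is the trace of the brackets with
the frame fields. By the structure equations (`matDeriv_bracket`) the brackets are given by the matrices `K`
and their derivatives along edge-to-edge fields. Thus `div Z` is smooth up to the boundary
(`contMDiff_frameDiv`), and the right-hand side is an edge-to-edge operator.
-/

noncomputable section

namespace SL3

/-! ### Division of smooth functions by boundary coordinates -/

theorem continuousOn_integral_unitInterval {X G : Type*} [TopologicalSpace X] [FirstCountableTopology X]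
    [NormedAddCommGroup G] [NormedSpace ℝ G] {S : Set X} {F : X × ℝ → G}
    (hF : ContinuousOn F (S ×ˢ Set.Icc 0 1)) :
    ContinuousOn (fun x => ∫ s in (0 : ℝ)..1, F (x, s)) S := by
  rw [continuousOn_iff_continuous_domRestrict]
  have h01 : (0 : ℝ) ≤ 1 := zero_le_one
  -- extend the integrand to all real `s`, constantly outside the unit interval
  have hc : Continuous fun q : S × ℝ => F (q.1, (Set.projIcc 0 1 h01 q.2 : ℝ)) := by
    refine hF.comp_continuous (f := fun q : S × ℝ => ((q.1 : X), (Set.projIcc 0 1 h01 q.2 : ℝ)))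
      ?_ fun q => ⟨q.1.2, (Set.projIcc 0 1 h01 q.2).2⟩
    exact (continuous_subtype_val.comp continuous_fst).prodMk
      (continuous_subtype_val.comp (continuous_projIcc.comp continuous_snd))
  have := intervalIntegral.continuous_parametric_intervalIntegral_of_continuous'
    (μ := MeasureTheory.volume) (f := fun (x : S) s => F (x, (Set.projIcc 0 1 h01 s : ℝ))) hc 0 1
  refine this.congr fun x => ?_
  refine intervalIntegral.integral_congr fun s hs => ?_
  rw [Set.uIcc_of_le h01] at hs
  simp only [Set.projIcc_of_mem h01 hs]

theorem intervalIntegrable_slice {X H : Type*} [TopologicalSpace X] [NormedAddCommGroup H]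
    {S : Set X} {Φ : X × ℝ → H} (hΦ : ContinuousOn Φ (S ×ˢ Set.Icc 0 1)) {y : X} (hy : y ∈ S) :
    IntervalIntegrable (fun s => Φ (y, s)) MeasureTheory.volume 0 1 := by
  refine ContinuousOn.intervalIntegrable ?_
  rw [Set.uIcc_of_le zero_le_one]
  exact hΦ.comp (Continuous.continuousOn (by fun_prop)) fun s hs => ⟨hy, hs⟩

/-- Differentiation under the integral sign on a convex set, up to its boundary. The difference quotients
converge uniformly in the parameter of integration, because that parameter runs through a compact set. -/
theorem hasFDerivWithinAt_integral_unitInterval {E G : Type*} [NormedAddCommGroup E]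
    [NormedSpace ℝ E] [NormedAddCommGroup G] [NormedSpace ℝ G] [CompleteSpace G] {S : Set E}
    (hS : Convex ℝ S) {F : E × ℝ → G} {F' : E × ℝ → E →L[ℝ] G}
    (hF : ContinuousOn F (S ×ˢ Set.Icc 0 1)) (hF' : ContinuousOn F' (S ×ˢ Set.Icc 0 1))
    (hd : ∀ x ∈ S, ∀ s ∈ Set.Icc (0 : ℝ) 1, HasFDerivWithinAt (fun y => F (y, s)) (F' (x, s)) S x)
    {x : E} (hx : x ∈ S) :
    HasFDerivWithinAt (fun y => ∫ s in (0 : ℝ)..1, F (y, s)) (∫ s in (0 : ℝ)..1, F' (x, s)) S x := by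
  rw [hasFDerivWithinAt_iff_isLittleO, Asymptotics.isLittleO_iff]
  intro ε hε
  obtain ⟨v, hv, hvε⟩ := (isCompact_Icc (a := (0 : ℝ)) (b := 1)).mem_uniformity_of_prod
    (f := fun y s => F' (y, s)) hF' hx (Metric.dist_mem_uniformity hε)
  obtain ⟨δ, hδ, hball⟩ := Metric.mem_nhdsWithin_iff.1 hv
  filter_upwards [inter_mem_nhdsWithin S (Metric.ball_mem_nhds x hδ)] with y hy
  have hconv : Convex ℝ (S ∩ Metric.ball x δ) := hS.inter (convex_ball x δ)
  have hmv : ∀ s ∈ Set.Icc (0 : ℝ) 1, ‖F (y, s) - F (x, s) - F' (x, s) (y - x)‖ ≤ ε * ‖y - x‖ := by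
    intro s hs
    refine hconv.norm_image_sub_le_of_norm_hasFDerivWithin_le' (f := fun y => F (y, s))
      (f' := fun z => F' (z, s)) (fun z hz => (hd z hz.1 s hs).mono Set.inter_subset_left)
      (fun z hz => ?_) ⟨hx, Metric.mem_ball_self hδ⟩ hy
    have := hvε z (hball ⟨hz.2, hz.1⟩) s hs
    rw [← dist_eq_norm]
    exact (le_of_lt this)
  have e1 : (∫ s in (0 : ℝ)..1, F' (x, s)) (y - x) = ∫ s in (0 : ℝ)..1, F' (x, s) (y - x) :=
    ContinuousLinearMap.intervalIntegral_apply (intervalIntegrable_slice hF' hx) (y - x)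
  have hint : IntervalIntegrable (fun s => F' (x, s) (y - x)) MeasureTheory.volume 0 1 :=
    intervalIntegrable_slice (Φ := fun z => F' z (y - x)) (hF'.clm_apply continuousOn_const) hx
  rw [e1, ← intervalIntegral.integral_sub (intervalIntegrable_slice hF hy.1) (intervalIntegrable_slice hF hx),
    ← intervalIntegral.integral_sub ((intervalIntegrable_slice hF hy.1).sub (intervalIntegrable_slice hF hx)) hint]
  refine (intervalIntegral.norm_integral_le_of_norm_le_const fun s hs => hmv s ?_).trans_eq ?_
  · rw [Set.uIoc_of_le zero_le_one] at hs
    exact ⟨hs.1.le, hs.2⟩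
  · simp

/-- Smooth dependence of an integral over `[0, 1]` on parameters in a convex set, up to its boundary. The
target space is generalised over in the induction, since the derivative has values in another space. -/
theorem contDiffOn_nat_integral_unitInterval {E : Type} [NormedAddCommGroup E]
    [NormedSpace ℝ E] {S : Set E} (hS : Convex ℝ S) (hSi : (interior S).Nonempty) (n : ℕ) :
    ∀ {G : Type} [NormedAddCommGroup G] [NormedSpace ℝ G] [CompleteSpace G] {F : E × ℝ → G},
      ContDiffOn ℝ n F (S ×ˢ Set.Icc 0 1) →
      ContDiffOn ℝ n (fun x => ∫ s in (0 : ℝ)..1, F (x, s)) S := by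
  have hu : UniqueDiffOn ℝ S := uniqueDiffOn_convex hS hSi
  have hu' : UniqueDiffOn ℝ (S ×ˢ Set.Icc (0 : ℝ) 1) := hu.prod (uniqueDiffOn_Icc zero_lt_one)
  induction n with
  | zero =>
    intro G _ _ _ F hF
    exact contDiffOn_zero.2 (continuousOn_integral_unitInterval hF.continuousOn)
  | succ n ih =>
    intro G _ _ _ F hF
    push_cast at hF ⊢
    set F' : E × ℝ → E →L[ℝ] G := fun z =>
      (fderivWithin ℝ F (S ×ˢ Set.Icc 0 1) z).comp (ContinuousLinearMap.inl ℝ E ℝ)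
    have h1 : ContDiffOn ℝ n F' (S ×ˢ Set.Icc 0 1) :=
      (hF.fderivWithin hu' le_rfl).clm_comp contDiffOn_const
    have hd : ∀ x ∈ S, ∀ s ∈ Set.Icc (0 : ℝ) 1,
        HasFDerivWithinAt (fun y => F (y, s)) (F' (x, s)) S x := fun x hx s hs => by
      have hdF := (hF.differentiableOn (by simp) (x, s) ⟨hx, hs⟩).hasFDerivWithinAt
      exact hdF.comp (f := fun y => (y, s)) x (hasFDerivAt_prodMk_left x s).hasFDerivWithinAt
        fun y hy => ⟨hy, hs⟩
    rw [contDiffOn_succ_iff_hasFDerivWithinAt_of_uniqueDiffOn hu]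
    refine ⟨by simp, _, ih h1, fun x hx => ?_⟩
    exact hasFDerivWithinAt_integral_unitInterval hS hF.continuousOn h1.continuousOn hd hx

/-- The model corner, as a subset of `ℝ⁵`. -/
def quad : Set (Fin 5 → ℝ) := {y | 0 ≤ y 0 ∧ 0 ≤ y 1}

/-- The interior of the model corner. -/
def quadInt : Set (Fin 5 → ℝ) := {y | 0 < y 0 ∧ 0 < y 1}

theorem isOpen_quadInt : IsOpen quadInt :=
  (isOpen_lt continuous_const (continuous_apply 0)).inter
    (isOpen_lt continuous_const (continuous_apply 1))

theorem quadInt_subset : quadInt ⊆ quad := fun _ hx => ⟨hx.1.le, hx.2.le⟩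

theorem quad_mem_nhds {x : Fin 5 → ℝ} (hx : x ∈ quadInt) : quad ∈ 𝓝 x :=
  Filter.mem_of_superset (isOpen_quadInt.mem_nhds hx) quadInt_subset

theorem convex_quad : Convex ℝ quad := by
  intro x hx y hy a b ha hb _
  have h1 := hx.1
  have h2 := hx.2
  have h3 := hy.1
  have h4 := hy.2
  constructor <;> simp only [Pi.add_apply, Pi.smul_apply, smul_eq_mul] <;> positivity

theorem interior_quad_nonempty : (interior quad).Nonempty :=
  ⟨fun _ => 1, mem_interior.2 ⟨quadInt, quadInt_subset, isOpen_quadInt, by simp [quadInt]⟩⟩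

theorem uniqueDiffOn_quad : UniqueDiffOn ℝ quad :=
  uniqueDiffOn_convex convex_quad interior_quad_nonempty

theorem range_cornerModel : Set.range cornerModel = quad := Quadrant.range_coords

/-- Hadamard's lemma on the model corner: a smooth function that vanishes where the coordinate `x i`
does is divisible by it, with a smooth quotient. The quotient is the integral of the partial derivative
over the segment that joins `x` to its projection to the hyperplane. -/
theorem exists_eq_mul_of_eq_zero {f : (Fin 5 → ℝ) → ℝ} (hf : ContDiffOn ℝ ∞ f quad) (i : Fin 5)
    (h0 : ∀ x ∈ quad, x i = 0 → f x = 0) :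
    ∃ h : (Fin 5 → ℝ) → ℝ, ContDiffOn ℝ ∞ h quad ∧ ∀ x ∈ quad, f x = x i * h x := by
  let c : (Fin 5 → ℝ) × ℝ → (Fin 5 → ℝ) := fun z => Function.update z.1 i (z.2 * z.1 i)
  have hc : ContDiff ℝ ∞ c := by
    refine contDiff_pi.2 fun j => ?_
    by_cases hj : j = i
    · subst hj
      simp only [c, Function.update_self]
      fun_prop
    · simp only [c, Function.update_of_ne hj]
      fun_prop
  have hcq : ∀ z ∈ quad ×ˢ Set.Icc (0 : ℝ) 1, c z ∈ quad := by
    rintro ⟨x, s⟩ ⟨hx, hs⟩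
    have key : ∀ j, 0 ≤ x j → 0 ≤ c (x, s) j := fun j hj => by
      by_cases h : j = i
      · subst h
        simpa [c] using mul_nonneg hs.1 hj
      · simpa [c, Function.update_of_ne h] using hj
    exact ⟨key 0 hx.1, key 1 hx.2⟩
  let F : (Fin 5 → ℝ) × ℝ → ℝ := fun z => fderivWithin ℝ f quad (c z) (Pi.single i 1)
  have hF : ContDiffOn ℝ ∞ F (quad ×ˢ Set.Icc 0 1) :=
    ((hf.fderivWithin uniqueDiffOn_quad (m := ∞) (by simp)).comp hc.contDiffOn hcq).clm_apply
      contDiffOn_const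
  refine ⟨fun x => ∫ s in (0 : ℝ)..1, F (x, s), ?_, fun x hx => ?_⟩
  · rw [contDiffOn_infty]
    exact fun n => contDiffOn_nat_integral_unitInterval convex_quad interior_quad_nonempty n
      (contDiffOn_infty.1 hF n)
  · have hline : ∀ s : ℝ, HasDerivAt (fun s => c (x, s)) (x i • (Pi.single i 1 : Fin 5 → ℝ)) s := by
      intro s
      refine hasDerivAt_pi.2 fun j => ?_
      by_cases hj : j = i
      · subst hj
        simpa [c] using (hasDerivAt_id s).mul_const (x j)
      · simpa [c, Function.update_of_ne hj, hj] using hasDerivAt_const s (x j)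
    have hcont : ContinuousOn (fun s => f (c (x, s))) (Set.Icc 0 1) :=
      hf.continuousOn.comp (hc.continuous.comp (by fun_prop)).continuousOn fun s hs =>
        hcq (x, s) ⟨hx, hs⟩
    have hder : ∀ s ∈ Set.Ioo (0 : ℝ) 1, HasDerivAt (fun s => f (c (x, s))) (x i * F (x, s)) s := by
      intro s hs
      have h1 := (hf.differentiableOn (by simp) _
        (hcq (x, s) ⟨hx, Set.Ioo_subset_Icc_self hs⟩)).hasFDerivWithinAt
      have h2 := h1.comp_hasDerivWithinAt (t := quad) (s := Set.Icc 0 1) (f := fun s => c (x, s)) s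
        (hline s).hasDerivWithinAt fun r hr => hcq (x, r) ⟨hx, hr⟩
      rw [map_smul, smul_eq_mul] at h2
      exact h2.hasDerivAt (Icc_mem_nhds hs.1 hs.2)
    have hint : IntervalIntegrable (fun s => x i * F (x, s)) MeasureTheory.volume 0 1 := by
      exact (intervalIntegrable_slice hF.continuousOn hx).const_mul (x i)
    have := intervalIntegral.integral_eq_sub_of_hasDerivAt_of_le zero_le_one hcont hder hint
    rw [intervalIntegral.integral_const_mul] at this
    have e0 : f (c (x, 0)) = 0 := h0 _ (hcq (x, 0) ⟨hx, by simp⟩) (by simp [c])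
    have e1 : c (x, 1) = x := by simp [c]
    rw [e0, e1, sub_zero] at this
    exact this.symm

/-! ### Calculus in the six charts -/

/-- The coordinates of a point in the chart `σ`, as a vector of `ℝ⁵`. -/
def coord (σ : Equiv.Perm (Fin 3)) (p : Mbar) : Fin 5 → ℝ := (chart σ p).coords

/-- The point with given coordinates in the chart `σ`; it is meaningful on `quad`. -/
def point (σ : Equiv.Perm (Fin 3)) (x : Fin 5 → ℝ) : Mbar := (chart σ).symm (Quadrant.clip x)

theorem coord_mem_quad (σ : Equiv.Perm (Fin 3)) (p : Mbar) : coord σ p ∈ quad := (chart σ p).nonneg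

theorem point_coord {σ : Equiv.Perm (Fin 3)} {p : Mbar} (hp : p ∈ (chart σ).source) :
    point σ (coord σ p) = p := by
  rw [point, coord, Quadrant.clip_val]
  exact (chart σ).left_inv hp

theorem point_mem_source (σ : Equiv.Perm (Fin 3)) (x : Fin 5 → ℝ) :
    point σ x ∈ (chart σ).source :=
  (chart σ).map_target trivial

theorem coord_point (σ : Equiv.Perm (Fin 3)) {x : Fin 5 → ℝ} (hx : x ∈ quad) :
    coord σ (point σ x) = x := by
  rw [point, coord, (chart σ).right_inv trivial]
  exact Quadrant.val_clip hx

theorem chart_mem_maximalAtlas (σ : Equiv.Perm (Fin 3)) :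
    chart σ ∈ IsManifold.maximalAtlas cornerModel ∞ Mbar :=
  IsManifold.subset_maximalAtlas ⟨σ, rfl⟩

theorem contMDiffOn_coord (σ : Equiv.Perm (Fin 3)) :
    ContMDiffOn cornerModel 𝓘(ℝ, Fin 5 → ℝ) ∞ (coord σ) (chart σ).source :=
  OpenPartialHomeomorph.contMDiffOn_extend (chart_mem_maximalAtlas σ)

theorem contMDiffOn_point (σ : Equiv.Perm (Fin 3)) :
    ContMDiffOn 𝓘(ℝ, Fin 5 → ℝ) cornerModel ∞ (point σ) quad := by
  have h := contMDiffOn_extend_symm (chart_mem_maximalAtlas σ)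
  rw [show (chart σ).target = Set.univ from rfl, Set.image_univ,
    range_cornerModel] at h
  exact h

theorem contMDiffAt_coord {σ : Equiv.Perm (Fin 3)} {p : Mbar} (hp : p ∈ (chart σ).source) :
    ContMDiffAt cornerModel 𝓘(ℝ, Fin 5 → ℝ) ∞ (coord σ) p :=
  (contMDiffOn_coord σ).contMDiffAt ((chart σ).open_source.mem_nhds hp)

theorem mdifferentiableAt_coord {σ : Equiv.Perm (Fin 3)} {p : Mbar} (hp : p ∈ (chart σ).source) :
    MDifferentiableAt cornerModel 𝓘(ℝ, Fin 5 → ℝ) (coord σ) p :=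
  (contMDiffAt_coord hp).mdifferentiableAt (by simp)

theorem mdifferentiableWithinAt_point (σ : Equiv.Perm (Fin 3)) {x : Fin 5 → ℝ} (hx : x ∈ quad) :
    MDifferentiableWithinAt 𝓘(ℝ, Fin 5 → ℝ) cornerModel (point σ) quad x :=
  (contMDiffOn_point σ x hx).mdifferentiableWithinAt (by simp)

/-- The components of a tangent vector in the chart `σ`. -/
def vecCoord (σ : Equiv.Perm (Fin 3)) (p : Mbar) (v : TangentSpace cornerModel p) : Fin 5 → ℝ :=
  mfderiv cornerModel 𝓘(ℝ, Fin 5 → ℝ) (coord σ) p v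

/-- The tangent vector at `point σ x` with given components in the chart `σ`. -/
def vecPoint (σ : Equiv.Perm (Fin 3)) (x w : Fin 5 → ℝ) : TangentSpace cornerModel (point σ x) :=
  mfderivWithin 𝓘(ℝ, Fin 5 → ℝ) cornerModel (point σ) quad x w

/-- The derivative of a function at a point, computed from an expression in the coordinates that is
differentiable on a full neighbourhood. -/
theorem mfderiv_eq_of_coord {E : Type*} [NormedAddCommGroup E] [NormedSpace ℝ E]
    {σ : Equiv.Perm (Fin 3)} {p : Mbar} (hp : p ∈ (chart σ).source) {f : Mbar → E}
    {F : (Fin 5 → ℝ) → E} (hF : DifferentiableAt ℝ F (coord σ p))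
    (hf : f =ᶠ[𝓝 p] fun q => F (coord σ q)) (v : TangentSpace cornerModel p) :
    mfderiv cornerModel 𝓘(ℝ, E) f p v = fderiv ℝ F (coord σ p) (vecCoord σ p v) := by
  have h1 : HasMFDerivAt 𝓘(ℝ, Fin 5 → ℝ) 𝓘(ℝ, E) F (coord σ p) (fderiv ℝ F (coord σ p)) :=
    hF.hasFDerivAt.hasMFDerivAt
  have h2 := (h1.comp p (mdifferentiableAt_coord hp).hasMFDerivAt).congr_of_eventuallyEq hf
  rw [h2.mfderiv]
  rfl

/-- The derivative of a function at a point, possibly on the boundary, computed in a chart. -/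
theorem mfderiv_eq_fderivWithin {E : Type*} [NormedAddCommGroup E] [NormedSpace ℝ E]
    {σ : Equiv.Perm (Fin 3)} {p : Mbar} (hp : p ∈ (chart σ).source) {f : Mbar → E}
    (hf : MDifferentiableAt cornerModel 𝓘(ℝ, E) f p) (v : TangentSpace cornerModel p) :
    mfderiv cornerModel 𝓘(ℝ, E) f p v =
      fderivWithin ℝ (fun x => f (point σ x)) quad (coord σ p) (vecCoord σ p v) := by
  have hq := coord_mem_quad σ p
  have hd : DifferentiableWithinAt ℝ (fun x => f (point σ x)) quad (coord σ p) := by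
    refine MDifferentiableWithinAt.differentiableWithinAt ?_
    rw [← point_coord hp] at hf
    exact hf.comp_mdifferentiableWithinAt _ (mdifferentiableWithinAt_point σ hq)
  have h1 : HasMFDerivWithinAt 𝓘(ℝ, Fin 5 → ℝ) 𝓘(ℝ, E) (fun x => f (point σ x)) quad (coord σ p)
      (fderivWithin ℝ (fun x => f (point σ x)) quad (coord σ p)) :=
    hd.hasFDerivWithinAt.hasMFDerivWithinAt
  have h2 := h1.comp p (mdifferentiableAt_coord hp).hasMFDerivAt.hasMFDerivWithinAt
    (s := Set.univ) fun q _ => coord_mem_quad σ q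
  rw [hasMFDerivWithinAt_univ] at h2
  have h3 := h2.congr_of_eventuallyEq (f₁ := f) <|
    Filter.eventually_of_mem ((chart σ).open_source.mem_nhds hp) fun q hq => by
      simp [point_coord hq]
  rw [h3.mfderiv]
  rfl

theorem vecCoord_vecPoint (σ : Equiv.Perm (Fin 3)) {x : Fin 5 → ℝ} (hx : x ∈ quad)
    (w : Fin 5 → ℝ) : vecCoord σ (point σ x) (vecPoint σ x w) = w := by
  have h1 := (mdifferentiableAt_coord (point_mem_source σ x)).hasMFDerivAt
  have h2 := h1.comp_hasMFDerivWithinAt x (mdifferentiableWithinAt_point σ hx).hasMFDerivWithinAt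
  have h3 : HasMFDerivWithinAt 𝓘(ℝ, Fin 5 → ℝ) 𝓘(ℝ, Fin 5 → ℝ) (coord σ ∘ point σ) quad x
      (ContinuousLinearMap.id ℝ (Fin 5 → ℝ)) :=
    ((hasFDerivWithinAt_id x quad).congr (fun y hy => coord_point σ hy)
      (coord_point σ hx)).hasMFDerivWithinAt
  have h4 := (uniqueDiffOn_quad x hx).uniqueMDiffWithinAt.eq h2 h3
  exact congrArg (fun T : (Fin 5 → ℝ) →L[ℝ] (Fin 5 → ℝ) => T w) h4

theorem contDiffOn_comp_point {E : Type*} [NormedAddCommGroup E] [NormedSpace ℝ E]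
    {σ : Equiv.Perm (Fin 3)} {f : Mbar → E}
    (hf : ContMDiffOn cornerModel 𝓘(ℝ, E) ∞ f (chart σ).source) :
    ContDiffOn ℝ ∞ (fun x => f (point σ x)) quad :=
  (hf.comp (contMDiffOn_point σ) fun x _ => point_mem_source σ x).contDiffOn

theorem contMDiffOn_comp_coord {E : Type*} [NormedAddCommGroup E] [NormedSpace ℝ E]
    {σ : Equiv.Perm (Fin 3)} {F : (Fin 5 → ℝ) → E} (hF : ContDiffOn ℝ ∞ F quad) :
    ContMDiffOn cornerModel 𝓘(ℝ, E) ∞ (fun p => F (coord σ p)) (chart σ).source :=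
  hF.contMDiffOn.comp (contMDiffOn_coord σ) fun p _ => coord_mem_quad σ p

/-- The derivative of a smooth function along a smooth vector field is smooth. -/
theorem contMDiffOn_mfderiv_apply {E : Type*} [NormedAddCommGroup E] [NormedSpace ℝ E]
    (X : VectorField) {f : Mbar → E} {U : Set Mbar} (hU : IsOpen U)
    (hf : ContMDiffOn cornerModel 𝓘(ℝ, E) ∞ f U) :
    ContMDiffOn cornerModel 𝓘(ℝ, E) ∞ (fun p => (mfderiv cornerModel 𝓘(ℝ, E) f p (X p) : E)) U := by
  have h1 := hf.contMDiffOn_tangentMapWithin (m := ∞) (by simp) hU.uniqueMDiffOn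
  have h2 := h1.comp (X.contMDiff.contMDiffOn (s := U)) fun p hp => hp
  have h3 := (contMDiff_snd_tangentBundle_modelSpace E 𝓘(ℝ, E) (n := ∞)).comp_contMDiffOn h2
  refine h3.congr fun p hp => ?_
  simp only [Function.comp, tangentMapWithin]
  rw [mfderivWithin_of_isOpen hU hp]

/-- The components of a vector field in the chart `σ`, as functions of the coordinates. -/
def comps (σ : Equiv.Perm (Fin 3)) (X : VectorField) (x : Fin 5 → ℝ) : Fin 5 → ℝ :=
  vecCoord σ (point σ x) (X (point σ x))

theorem contDiffOn_comps (σ : Equiv.Perm (Fin 3)) (X : VectorField) :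
    ContDiffOn ℝ ∞ (comps σ X) quad :=
  contDiffOn_comp_point (contMDiffOn_mfderiv_apply X (chart σ).open_source (contMDiffOn_coord σ))

theorem comps_coord {σ : Equiv.Perm (Fin 3)} {p : Mbar} (hp : p ∈ (chart σ).source)
    (X : VectorField) : comps σ X (coord σ p) = vecCoord σ p (X p) := by
  rw [comps, point_coord hp]

/-- The vector field with given components in the chart `σ`; it is meaningful on the domain of the
chart. All tangent spaces are copies of `ℝ⁵`, which lets a vector at `point σ (coord σ p)` be regarded
as one at `p`; on the domain of the chart the two points agree. -/
def localField (σ : Equiv.Perm (Fin 3)) (ξ : (Fin 5 → ℝ) → (Fin 5 → ℝ)) (p : Mbar) :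
    TangentSpace cornerModel p :=
  (vecPoint σ (coord σ p) (ξ (coord σ p)) : Fin 5 → ℝ)

theorem vecCoord_localField {σ : Equiv.Perm (Fin 3)} {p : Mbar} (hp : p ∈ (chart σ).source)
    (ξ : (Fin 5 → ℝ) → (Fin 5 → ℝ)) : vecCoord σ p (localField σ ξ p) = ξ (coord σ p) := by
  have h := vecCoord_vecPoint σ (coord_mem_quad σ p) (ξ (coord σ p))
  rw [point_coord hp] at h
  exact h

theorem contMDiffOn_localField (σ : Equiv.Perm (Fin 3)) {ξ : (Fin 5 → ℝ) → (Fin 5 → ℝ)}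
    (hξ : ContDiffOn ℝ ∞ ξ quad) :
    ContMDiffOn cornerModel cornerModel.tangent ∞
      (fun p => (⟨p, localField σ ξ p⟩ : TangentBundle cornerModel Mbar)) (chart σ).source := by
  have h1 := (contMDiffOn_point σ).contMDiffOn_tangentMapWithin (m := ∞) (by simp)
    uniqueDiffOn_quad.uniqueMDiffOn
  have h2 : ContMDiffOn 𝓘(ℝ, Fin 5 → ℝ) 𝓘(ℝ, Fin 5 → ℝ).tangent ∞
      (fun x => (⟨x, ξ x⟩ : TangentBundle 𝓘(ℝ, Fin 5 → ℝ) (Fin 5 → ℝ))) quad :=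
    contMDiffOn_vectorSpace_iff_contDiffOn.2 hξ
  have h3 := (h1.comp h2 fun x hx => hx).comp (contMDiffOn_coord σ) fun p _ => coord_mem_quad σ p
  refine h3.congr fun p hp => ?_
  have key : ∀ (q : Mbar) (v : Fin 5 → ℝ), q = p →
      (⟨p, v⟩ : TangentBundle cornerModel Mbar) = ⟨q, v⟩ := by
    rintro q v rfl
    rfl
  exact key _ _ (point_coord hp)

/-! ### The logarithmic derivative of `V` along edge-to-edge directions -/

/-- The vector with coefficients `f` in the local frame
`t₁ ∂₁, t₂ ∂₂, t₁ N₁₂, t₁ t₂ N₁₃, t₂ N₂₃` of the edge-to-edge fields, where the `N` are the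
left-invariant fields on the unipotent group. -/
def frameVec (x f : Fin 5 → ℝ) : Fin 5 → ℝ :=
  ![x 0 * f 0, x 1 * f 1, x 0 * f 2, x 0 * x 1 * f 3 + x 2 * (x 1 * f 4), x 1 * f 4]

/-- The matrix `n⁻¹ (X(V) V⁻¹) n` for the representative `V = rawP x = n a nᵗ` and `X = frameVec x f`.
Its entries below the diagonal are those of `a (n⁻¹ X(n))ᵗ a⁻¹`. -/
def frameB (x f : Fin 5 → ℝ) : Mat :=
  !![f 0 + f 1, x 0 * f 2, x 0 * x 1 * f 3;
     f 2, f 1, x 1 * f 4;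
     f 3, f 4, 0]

/-- The trace-free part of `frameB x f`. -/
def frameB₀ (x f : Fin 5 → ℝ) : Mat := frameB x f - ((f 0 + 2 * f 1) / 3) • (1 : Mat)

/-- The logarithmic derivative `X(V) V⁻¹` along `X = frameVec x f`, for `V` of determinant one. It is
polynomial in `x`, and therefore smooth up to the boundary. -/
def frameK (x f : Fin 5 → ℝ) : Mat := unip x * frameB₀ x f * unipInv x

theorem unip_mul_unipInv (x : Fin 5 → ℝ) : unip x * unipInv x = 1 := by
  ext i j
  fin_cases i <;> fin_cases j <;>
    simp [unip, unipInv, Matrix.mul_apply, Fin.sum_univ_three]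
  ring

theorem unipInv_mul_unip (x : Fin 5 → ℝ) : unipInv x * unip x = 1 :=
  mul_eq_one_comm.1 (unip_mul_unipInv x)

theorem frameB₀_mul (x f : Fin 5 → ℝ) :
    frameB₀ x f * Matrix.diagonal ![x 0 * x 1, x 1, 1] =
      Matrix.diagonal ![x 0 * x 1, x 1, 1] * (frameB₀ x f).transpose := by
  ext i j
  fin_cases i <;> fin_cases j <;>
    simp [frameB₀, frameB] <;> ring

theorem mul_frameB₀ (x f : Fin 5 → ℝ) :
    Matrix.diagonal ![1, x 0, x 0 * x 1] * frameB₀ x f =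
      (frameB₀ x f).transpose * Matrix.diagonal ![1, x 0, x 0 * x 1] := by
  ext i j
  fin_cases i <;> fin_cases j <;>
    simp [frameB₀, frameB] <;> ring

/-- `K V` is symmetric, since it is the derivative of `V`. In this polynomial form the identity holds on
the boundary as well. -/
theorem frameK_mul_rawP (x f : Fin 5 → ℝ) :
    frameK x f * rawP x = rawP x * (frameK x f).transpose := by
  have e : (unip x).transpose * (unipInv x).transpose = 1 := by
    rw [← Matrix.transpose_mul, unipInv_mul_unip, Matrix.transpose_one]
  rw [frameK, rawP]
  set a : Mat := Matrix.diagonal ![x 0 * x 1, x 1, 1]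
  calc unip x * frameB₀ x f * unipInv x * (unip x * a * (unip x).transpose)
      = unip x * frameB₀ x f * (unipInv x * unip x) * a * (unip x).transpose := by
        simp only [Matrix.mul_assoc]
    _ = unip x * (frameB₀ x f * a) * (unip x).transpose := by
        rw [unipInv_mul_unip, mul_one, Matrix.mul_assoc (unip x)]
    _ = unip x * a * ((unip x).transpose * (unipInv x).transpose) * (frameB₀ x f).transpose *
          (unip x).transpose := by
        rw [frameB₀_mul, e, mul_one]
        simp only [a, Matrix.mul_assoc]
    _ = _ := by simp only [Matrix.transpose_mul, Matrix.mul_assoc]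

theorem rawQ_mul_frameK (x f : Fin 5 → ℝ) :
    rawQ x * frameK x f = (frameK x f).transpose * rawQ x := by
  have e : (unip x).transpose * (unipInv x).transpose = 1 := by
    rw [← Matrix.transpose_mul, unipInv_mul_unip, Matrix.transpose_one]
  rw [frameK, rawQ]
  set a : Mat := Matrix.diagonal ![1, x 0, x 0 * x 1]
  calc (unipInv x).transpose * a * unipInv x * (unip x * frameB₀ x f * unipInv x)
      = (unipInv x).transpose * a * (unipInv x * unip x) * frameB₀ x f * unipInv x := by
        simp only [Matrix.mul_assoc]
    _ = (unipInv x).transpose * (a * frameB₀ x f) * unipInv x := by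
        rw [unipInv_mul_unip, mul_one, Matrix.mul_assoc (unipInv x).transpose]
    _ = (unipInv x).transpose * (frameB₀ x f).transpose * ((unip x).transpose *
          (unipInv x).transpose) * a * unipInv x := by
        rw [mul_frameB₀, e, mul_one]
        simp only [a, Matrix.mul_assoc]
    _ = _ := by simp only [Matrix.transpose_mul, Matrix.mul_assoc]

theorem trace_frameB₀ (x f : Fin 5 → ℝ) : (frameB₀ x f).trace = 0 := by
  simp [frameB₀, frameB, Matrix.trace_fin_three]
  ring

theorem trace_frameK (x f : Fin 5 → ℝ) : (frameK x f).trace = 0 := by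
  rw [frameK, Matrix.mul_assoc, Matrix.trace_mul_comm, Matrix.mul_assoc, unipInv_mul_unip, mul_one,
    trace_frameB₀]

/-- If `K` is skew-symmetric and `K V` is symmetric for a positive semidefinite `V`, then `K V = 0`:
indeed `|K V|² = -Tr (V K V Kᵗ)`, which is not positive. -/
theorem mul_eq_zero_of_skew {K V : Mat} (hV : V.PosSemidef) (hK : K.transpose = -K)
    (h : K * V = V * K.transpose) : K * V = 0 := by
  have hVt : V.transpose = V := by simpa using hV.1.eq
  have h1 : 0 ≤ (V * (K * V * K.transpose)).trace := by
    obtain ⟨L, hL⟩ : ∃ L : Mat, V = L.transpose * L := by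
      open scoped MatrixOrder in
      obtain ⟨L, hL⟩ := CStarAlgebra.nonneg_iff_eq_star_mul_self.1 hV.nonneg
      exact ⟨L, by simpa [Matrix.star_eq_conjTranspose] using hL⟩
    have h2 : (K * V * K.transpose).PosSemidef := by
      simpa using hV.mul_mul_conjTranspose_same K
    have h3 := (h2.mul_mul_conjTranspose_same L).trace_nonneg
    rw [Matrix.trace_mul_comm] at h3
    rw [hL, Matrix.mul_assoc, Matrix.trace_mul_comm]
    rw [← hL, Matrix.trace_mul_comm]
    simpa [Matrix.mul_assoc] using h3
  have h4 : ((K * V).transpose * (K * V)).trace = -(V * (K * V * K.transpose)).trace := by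
    rw [Matrix.transpose_mul, hVt, hK]
    rw [hK] at h
    simp only [Matrix.mul_neg, Matrix.neg_mul, Matrix.trace_neg, neg_neg] at h ⊢
    have h5 : K * V * K = -(K * (K * V)) := by
      rw [Matrix.mul_assoc, show V * K = -(K * V) by rw [h, neg_neg], Matrix.mul_neg]
    rw [h5, Matrix.mul_neg, Matrix.trace_neg, Matrix.mul_assoc]
  have h6 : ((K * V).conjTranspose * (K * V)).trace = 0 := by
    refine le_antisymm ?_ (Matrix.posSemidef_conjTranspose_mul_self (K * V)).trace_nonneg
    rw [Matrix.conjTranspose_eq_transpose_of_trivial, h4]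
    linarith
  exact Matrix.trace_conjTranspose_mul_self_eq_zero_iff.1 h6

/-- The logarithmic derivative along an edge-to-edge vector vanishes as soon as it is skew-symmetric. In the
interior this says that the metric is definite; on the boundary the matrix annihilates the images of both
`P` and `Q`, which contain two independent vectors. -/
theorem frameK_eq_zero {x f : Fin 5 → ℝ} (hx : x ∈ quad)
    (h : (frameK x f).transpose = -frameK x f) : frameK x f = 0 := by
  have hP := mul_eq_zero_of_skew (rawP_posSemidef hx) h (frameK_mul_rawP x f)
  have hQ : frameK x f * rawQ x = 0 := by
    refine mul_eq_zero_of_skew (rawQ_posSemidef hx) h ?_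
    have := rawQ_mul_frameK x f
    rw [h] at this ⊢
    rw [Matrix.mul_neg, this, Matrix.neg_mul, neg_neg]
  set K := frameK x f
  have s : ∀ i j, K j i = -K i j := fun i j => congrFun (congrFun h i) j
  have s00 : K 0 0 = 0 := by linarith [s 0 0]
  have s11 : K 1 1 = 0 := by linarith [s 1 1]
  have s22 : K 2 2 = 0 := by linarith [s 2 2]
  -- the third column of `rawP x` and the first column of `rawQ x` are orthogonal nonzero vectors; a
  -- skew-symmetric three by three matrix that annihilates both is zero
  have p : ∀ i, K i 0 * x 3 + K i 1 * x 4 + K i 2 = 0 := fun i => by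
    have := congrFun (congrFun hP i) 2
    simpa [Matrix.mul_apply, Fin.sum_univ_three, rawP_eq] using this
  have q : ∀ i, K i 0 + K i 1 * -x 2 + K i 2 * (x 2 * x 4 - x 3) = 0 := fun i => by
    have := congrFun (congrFun hQ i) 0
    simpa [Matrix.mul_apply, Fin.sum_univ_three, rawQ_eq] using this
  have p0 := p 0
  have p1 := p 1
  have q0 := q 0
  have q1 := q 1
  have q2 := q 2
  rw [s00] at p0 q0
  rw [s11, s 0 1] at p1 q1
  rw [s22, s 0 2, s 1 2] at q2
  have e02 : K 0 2 = -(K 0 1 * x 4) := by linarith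
  have e12 : K 1 2 = K 0 1 * x 3 := by linarith
  rw [e02] at q0 q2
  rw [e12] at q1 q2
  have e01 : K 0 1 = 0 := by
    have h4 : K 0 1 * (x 4 + x 2 * x 3) = 0 := by linarith
    rcases mul_eq_zero.1 h4 with h4 | h4
    · exact h4
    · have h5 : K 0 1 * (1 + x 3 ^ 2 + x 2 ^ 2 * x 3 ^ 2) = 0 := by
        have : x 4 = -(x 2 * x 3) := by linarith
        rw [this] at q1
        linarith
      exact (mul_eq_zero.1 h5).resolve_right (by positivity)
  rw [e01] at e02 e12
  simp only [zero_mul, neg_zero] at e02 e12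
  ext i j
  fin_cases i <;> fin_cases j <;> simp [s00, s11, s22, e01, e02, e12, s 0 1, s 0 2, s 1 2]

/-- The coefficients in the local frame can be read off from the logarithmic derivative, because those of
the nilpotent directions occur below the diagonal of `frameB` without a boundary factor. -/
theorem eq_zero_of_frameK {x f : Fin 5 → ℝ} (h : frameK x f = 0) : f = 0 := by
  have h0 : frameB₀ x f = 0 := by
    calc frameB₀ x f = (unipInv x * unip x) * frameB₀ x f * (unipInv x * unip x) := by
          rw [unipInv_mul_unip, one_mul, mul_one]
      _ = unipInv x * frameK x f * unip x := by simp only [frameK, Matrix.mul_assoc]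
      _ = 0 := by rw [h, Matrix.mul_zero, Matrix.zero_mul]
  have e : ∀ i j, frameB₀ x f i j = 0 := fun i j => by rw [h0]; rfl
  have e00 := e 0 0
  have e11 := e 1 1
  have e10 := e 1 0
  have e20 := e 2 0
  have e21 := e 2 1
  simp [frameB₀, frameB] at e00 e11 e10 e20 e21
  funext i
  fin_cases i <;> simp <;> linarith

/-- An orthogonal basis of the symmetric matrices of trace zero, the tangent space at the identity. -/
def symBasis : Fin 5 → Mat :=
  ![!![1, 0, 0; 0, -1, 0; 0, 0, 0], !![1, 0, 0; 0, 1, 0; 0, 0, -2], !![0, 1, 0; 1, 0, 0; 0, 0, 0],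
    !![0, 0, 1; 0, 0, 0; 1, 0, 0], !![0, 0, 0; 0, 0, 1; 0, 1, 0]]

/-- The squared norms of the matrices in `symBasis` for `6 Tr (A Aᵗ)`. -/
def symNorm : Fin 5 → ℝ := ![12, 36, 12, 12, 12]

theorem symNorm_pos (a : Fin 5) : 0 < symNorm a := by
  fin_cases a <;> simp [symNorm]

theorem symBasis_transpose (a : Fin 5) : (symBasis a).transpose = symBasis a := by
  ext i j
  fin_cases a <;> fin_cases i <;> fin_cases j <;> simp [symBasis]

theorem symBasis_trace (a : Fin 5) : (symBasis a).trace = 0 := by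
  fin_cases a <;> simp [symBasis, Matrix.trace_fin_three]
  norm_num

/-- The coefficients of the symmetric trace-free part of a matrix in the basis `symBasis`. -/
def symCoef (a : Fin 5) (M : Mat) : ℝ := (symNorm a)⁻¹ * (6 * (symBasis a * M).trace)

theorem symCoef_add (a : Fin 5) (M N : Mat) : symCoef a (M + N) = symCoef a M + symCoef a N := by
  simp only [symCoef, Matrix.mul_add, Matrix.trace_add]
  ring

theorem symCoef_smul (a : Fin 5) (c : ℝ) (M : Mat) : symCoef a (c • M) = c * symCoef a M := by
  simp only [symCoef, Matrix.mul_smul, Matrix.trace_smul, smul_eq_mul]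
  ring

theorem symCoef_transpose (a : Fin 5) (M : Mat) : symCoef a M.transpose = symCoef a M := by
  rw [symCoef, symCoef, ← Matrix.trace_transpose, Matrix.transpose_mul, Matrix.transpose_transpose,
    symBasis_transpose, Matrix.trace_mul_comm]

theorem symCoef_symBasis (a b : Fin 5) : symCoef a (symBasis b) = if a = b then 1 else 0 := by
  fin_cases a <;> fin_cases b <;>
    simp [symCoef, symBasis, symNorm, Matrix.trace_fin_three] <;> norm_num

theorem sum_symCoef {M : Mat} (hM : M.transpose = M) (ht : M.trace = 0) :
    ∑ a, symCoef a M • symBasis a = M := by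
  have s : ∀ i j, M j i = M i j := fun i j => congrFun (congrFun hM i) j
  rw [Matrix.trace_fin_three] at ht
  ext i j
  simp only [Fin.sum_univ_five]
  fin_cases i <;> fin_cases j <;>
    simp [symCoef, symBasis, symNorm, Matrix.trace_fin_three, Matrix.vecMul, dotProduct,
      Fin.sum_univ_three] <;> linarith [s 0 1, s 0 2, s 1 2]

theorem frameK_smul_add (x : Fin 5 → ℝ) (f g : Fin 5 → ℝ) (c : ℝ) :
    frameK x (c • f + g) = c • frameK x f + frameK x g := by
  have h : frameB₀ x (c • f + g) = c • frameB₀ x f + frameB₀ x g := by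
    ext i j
    fin_cases i <;> fin_cases j <;> simp [frameB₀, frameB] <;> ring
  rw [frameK, h, Matrix.mul_add, Matrix.add_mul, Matrix.mul_smul, Matrix.smul_mul]
  rfl

/-- `frameK` as a linear map of the coefficients. -/
def frameKₗ (x : Fin 5 → ℝ) : (Fin 5 → ℝ) →ₗ[ℝ] Mat where
  toFun := frameK x
  map_add' f g := by simpa using frameK_smul_add x f g 1
  map_smul' c f := by
    have h0 : frameK x 0 = 0 := by
      have := frameK_smul_add x 0 0 1
      simpa using this
    simpa [h0] using frameK_smul_add x f 0 c

/-- The matrix of the map that takes the coefficients of an edge-to-edge vector in the local frame to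
the coefficients of the symmetric part of the logarithmic derivative of `V` along it. -/
def frameMatrix (x : Fin 5 → ℝ) : Matrix (Fin 5) (Fin 5) ℝ :=
  Matrix.of fun a b => symCoef a (frameK x (Pi.single b 1))

theorem frameMatrix_mulVec (x f : Fin 5 → ℝ) (a : Fin 5) :
    (frameMatrix x).mulVec f a = symCoef a (frameK x f) := by
  let T : (Fin 5 → ℝ) →ₗ[ℝ] ℝ :=
    { toFun := fun f => symCoef a (frameKₗ x f)
      map_add' := fun f g => by rw [map_add, symCoef_add]
      map_smul' := fun c f => by rw [map_smul, symCoef_smul]; rfl }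
  have h : T f = ∑ b, T (Pi.single b 1) * f b := by
    conv_lhs => rw [pi_eq_sum_univ' f]
    rw [map_sum]
    refine Finset.sum_congr rfl fun b _ => ?_
    rw [map_smul, smul_eq_mul, mul_comm]
  exact h.symm

theorem add_transpose_frameK (x f : Fin 5 → ℝ) :
    (1 / 2 : ℝ) • (frameK x f + (frameK x f).transpose) =
      ∑ a, symCoef a (frameK x f) • symBasis a := by
  rw [← sum_symCoef (M := (1 / 2 : ℝ) • (frameK x f + (frameK x f).transpose))]
  · refine Finset.sum_congr rfl fun a _ => ?_
    rw [symCoef_smul, symCoef_add, symCoef_transpose]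
    congr 1
    ring
  · rw [Matrix.transpose_smul, Matrix.transpose_add, Matrix.transpose_transpose, add_comm]
  · rw [Matrix.trace_smul, Matrix.trace_add, Matrix.trace_transpose, trace_frameK]
    simp

/-- The metric does not degenerate on the edge-to-edge tangent bundle, up to the boundary. -/
theorem det_frameMatrix_ne_zero {x : Fin 5 → ℝ} (hx : x ∈ quad) : (frameMatrix x).det ≠ 0 := by
  intro h
  obtain ⟨f, hf, h0⟩ := Matrix.exists_mulVec_eq_zero_iff.2 h
  refine hf (eq_zero_of_frameK (x := x) (frameK_eq_zero hx ?_))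
  have h1 := add_transpose_frameK x f
  rw [Finset.sum_eq_zero fun a _ => by rw [← frameMatrix_mulVec, h0, Pi.zero_apply, zero_smul]] at h1
  have h2 := (smul_eq_zero.1 h1).resolve_left (by norm_num)
  exact (neg_eq_of_add_eq_zero_right h2).symm

/-- The frame coefficients of the vector along which the logarithmic derivative of `V` has symmetric
part `M`. -/
def frameSol (M : Mat) (x : Fin 5 → ℝ) : Fin 5 → ℝ :=
  (frameMatrix x)⁻¹.mulVec fun a => symCoef a M

theorem frameK_frameSol {M : Mat} (hM : M.transpose = M) (ht : M.trace = 0) {x : Fin 5 → ℝ}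
    (hx : x ∈ quad) :
    (1 / 2 : ℝ) • (frameK x (frameSol M x) + (frameK x (frameSol M x)).transpose) = M := by
  rw [add_transpose_frameK]
  conv_rhs => rw [← sum_symCoef hM ht]
  refine Finset.sum_congr rfl fun a _ => ?_
  rw [← frameMatrix_mulVec, frameSol, Matrix.mulVec_mulVec, Matrix.mul_nonsing_inv _
    (det_frameMatrix_ne_zero hx).isUnit, Matrix.one_mulVec]

theorem ContDiffOn.matrix_det {E : Type*} [NormedAddCommGroup E] [NormedSpace ℝ E] {n : ℕ}
    {S : Set E} {A : E → Matrix (Fin n) (Fin n) ℝ} (hA : ∀ i j, ContDiffOn ℝ ∞ (fun x => A x i j) S) :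
    ContDiffOn ℝ ∞ (fun x => (A x).det) S := by
  simp only [Matrix.det_apply']
  exact ContDiffOn.sum fun τ _ => contDiffOn_const.mul (contDiffOn_prod fun i _ => hA _ _)

theorem ContDiffOn.matrix_inv {E : Type*} [NormedAddCommGroup E] [NormedSpace ℝ E] {n : ℕ}
    {S : Set E} {A : E → Matrix (Fin n) (Fin n) ℝ} (hA : ∀ i j, ContDiffOn ℝ ∞ (fun x => A x i j) S)
    (h : ∀ x ∈ S, (A x).det ≠ 0) (i j : Fin n) : ContDiffOn ℝ ∞ (fun x => (A x)⁻¹ i j) S := by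
  simp only [Matrix.inv_def, Matrix.smul_apply, Ring.inverse_eq_inv', smul_eq_mul,
    Matrix.adjugate_apply]
  refine ((ContDiffOn.matrix_det hA).inv h).mul (ContDiffOn.matrix_det fun k l => ?_)
  by_cases hk : k = j
  · subst hk
    simp only [Matrix.updateRow_self]
    exact contDiffOn_const
  · simp only [Matrix.updateRow_ne hk]
    exact hA k l

theorem ContDiffOn.matrix_mul {E : Type*} [NormedAddCommGroup E] [NormedSpace ℝ E] {n : ℕ}
    {S : Set E} {A B : E → Matrix (Fin n) (Fin n) ℝ} (hA : ∀ i j, ContDiffOn ℝ ∞ (fun x => A x i j) S)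
    (hB : ∀ i j, ContDiffOn ℝ ∞ (fun x => B x i j) S) (i j : Fin n) :
    ContDiffOn ℝ ∞ (fun x => (A x * B x) i j) S := by
  simp only [Matrix.mul_apply]
  exact ContDiffOn.sum fun k _ => (hA i k).mul (hB k j)

theorem contDiffOn_frameK {S : Set (Fin 5 → ℝ)} {f : (Fin 5 → ℝ) → (Fin 5 → ℝ)}
    (hf : ContDiffOn ℝ ∞ f S) (i j : Fin 3) : ContDiffOn ℝ ∞ (fun x => frameK x (f x) i j) S := by
  have hf' : ∀ k, ContDiffOn ℝ ∞ (fun x => f x k) S := contDiffOn_pi.1 hf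
  have hx : ∀ k, ContDiffOn ℝ ∞ (fun x : Fin 5 → ℝ => x k) S := fun k =>
    (contDiff_apply ℝ ℝ k).contDiffOn
  refine ContDiffOn.matrix_mul (ContDiffOn.matrix_mul ?_ ?_) ?_ i j
  · intro i j
    fin_cases i <;> fin_cases j <;> simp [unip] <;> fun_prop
  · intro i j
    have := hf' 0
    have := hf' 1
    have := hf' 2
    have := hf' 3
    have := hf' 4
    fin_cases i <;> fin_cases j <;> simp [frameB₀, frameB] <;> fun_prop
  · intro i j
    fin_cases i <;> fin_cases j <;> simp [unipInv] <;> fun_prop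

theorem contDiffOn_frameSol (M : Mat) : ContDiffOn ℝ ∞ (frameSol M) quad := by
  refine contDiffOn_pi.2 fun a => ?_
  have h : ∀ i j, ContDiffOn ℝ ∞ (fun x => frameMatrix x i j) quad := fun i j => by
    have hK := fun k l => contDiffOn_frameK (S := quad)
      (contDiffOn_const (c := (Pi.single j 1 : Fin 5 → ℝ))) k l
    simp only [frameMatrix, Matrix.of_apply, symCoef, Matrix.trace_fin_three, Matrix.mul_apply,
      Fin.sum_univ_three]
    fun_prop
  simp only [frameSol, Matrix.mulVec, dotProduct]
  exact ContDiffOn.sum fun b _ =>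
    (ContDiffOn.matrix_inv h (fun x hx => det_frameMatrix_ne_zero hx) a b).mul contDiffOn_const

/-! ### The symmetric space in the charts -/

theorem P_point (σ : Equiv.Perm (Fin 3)) {x : Fin 5 → ℝ} (hx : x ∈ quad) :
    (point σ x).P.submatrix σ σ = normalise (rawP x) := by
  change ((normalise (rawP (Quadrant.clip x).coords)).submatrix σ.symm σ.symm).submatrix σ σ = _
  rw [Quadrant.val_clip hx]
  ext i j
  simp

theorem Q_point (σ : Equiv.Perm (Fin 3)) {x : Fin 5 → ℝ} (hx : x ∈ quad) :
    (point σ x).Q.submatrix σ σ = normalise (rawQ x) := by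
  change ((normalise (rawQ (Quadrant.clip x).coords)).submatrix σ.symm σ.symm).submatrix σ σ = _
  rw [Quadrant.val_clip hx]
  ext i j
  simp

theorem P_coord {σ : Equiv.Perm (Fin 3)} {p : Mbar} (hp : p ∈ (chart σ).source) :
    p.P.submatrix σ σ = normalise (rawP (coord σ p)) := by
  rw [← P_point σ (coord_mem_quad σ p), point_coord hp]

theorem Q_coord {σ : Equiv.Perm (Fin 3)} {p : Mbar} (hp : p ∈ (chart σ).source) :
    p.Q.submatrix σ σ = normalise (rawQ (coord σ p)) := by
  rw [← Q_point σ (coord_mem_quad σ p), point_coord hp]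

theorem det_unip (x : Fin 5 → ℝ) : (unip x).det = 1 := by
  simp [unip, Matrix.det_fin_three]

theorem det_unipInv (x : Fin 5 → ℝ) : (unipInv x).det = 1 := by
  simp [unipInv, Matrix.det_fin_three]

theorem det_rawP (x : Fin 5 → ℝ) : (rawP x).det = x 0 * x 1 ^ 2 := by
  simp [rawP, det_unip, Matrix.det_diagonal, Fin.prod_univ_three]
  ring

theorem rank_rawP_eq_one (x : Fin 5 → ℝ) : (rawP x).rank = 1 ↔ x 1 = 0 := by
  rw [rawP, Matrix.rank_mul_eq_left_of_isUnit_det _ _ (by simp [det_unip]),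
    Matrix.rank_mul_eq_right_of_isUnit_det _ _ (by simp [det_unip]), Matrix.rank_diagonal,
    Fintype.card_subtype, Finset.card_filter, Fin.sum_univ_three]
  by_cases h1 : x 1 = 0
  · simp [h1]
  · by_cases h0 : x 0 = 0 <;> simp [h1, h0]

theorem rank_rawQ_eq_one (x : Fin 5 → ℝ) : (rawQ x).rank = 1 ↔ x 0 = 0 := by
  rw [rawQ, Matrix.rank_mul_eq_left_of_isUnit_det _ _ (by simp [det_unipInv]),
    Matrix.rank_mul_eq_right_of_isUnit_det _ _ (by simp [det_unipInv]), Matrix.rank_diagonal,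
    Fintype.card_subtype, Finset.card_filter, Fin.sum_univ_three]
  by_cases h0 : x 0 = 0
  · simp [h0]
  · by_cases h1 : x 1 = 0 <;> simp [h1, h0]

theorem rank_normalise {A : Mat} (h : A.trace ≠ 0) : (normalise A).rank = A.rank :=
  Matrix.rank_smul_of_mem_nonZeroDivisors A (mem_nonZeroDivisors_of_ne_zero (inv_ne_zero h))

theorem mem_lowerFace_iff {σ : Equiv.Perm (Fin 3)} {p : Mbar} (hp : p ∈ (chart σ).source) :
    p ∈ lowerFace ↔ coord σ p 1 = 0 := by
  change p.P.rank = 1 ↔ _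
  rw [← Matrix.rank_submatrix p.P σ σ, P_coord hp,
    rank_normalise (rawP_trace_pos (coord_mem_quad σ p)).ne', rank_rawP_eq_one]

theorem mem_upperFace_iff {σ : Equiv.Perm (Fin 3)} {p : Mbar} (hp : p ∈ (chart σ).source) :
    p ∈ upperFace ↔ coord σ p 0 = 0 := by
  change p.Q.rank = 1 ↔ _
  rw [← Matrix.rank_submatrix p.Q σ σ, Q_coord hp,
    rank_normalise (rawQ_trace_pos (coord_mem_quad σ p)).ne', rank_rawQ_eq_one]

/-- The representative of determinant one of the class of `rawP x`, for `x` in the interior. -/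
def unitV (x : Fin 5 → ℝ) : Mat := (x 0 * x 1 ^ 2) ^ (-(1 / 3) : ℝ) • rawP x

theorem unembed_coord {σ : Equiv.Perm (Fin 3)} {p : Mbar} (hp : p ∈ (chart σ).source) :
    (unembed p).submatrix σ σ = unitV (coord σ p) := by
  have hx := coord_mem_quad σ p
  set x := coord σ p with hxdef
  have ht := rawP_trace_pos hx
  have hd : 0 ≤ x 0 * x 1 ^ 2 := mul_nonneg hx.1 (sq_nonneg _)
  have h1 : p.P.det = (rawP x).trace⁻¹ ^ 3 * (x 0 * x 1 ^ 2) := by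
    rw [← Matrix.det_submatrix_equiv_self σ p.P, P_coord hp, normalise, Matrix.det_smul, det_rawP]
    simp [hxdef]
  have h2 : (unembed p).submatrix σ σ = p.P.det ^ (-(1 / 3) : ℝ) • (p.P.submatrix σ σ) := rfl
  rw [h2, h1, P_coord hp, normalise, smul_smul, unitV, Real.mul_rpow (by positivity) hd,
    ← Real.rpow_natCast, ← Real.rpow_mul (by positivity)]
  congr 1
  rw [mul_right_comm]
  norm_num
  rw [Real.rpow_neg_one, inv_inv]
  rw [mul_inv_cancel₀ ht.ne', one_mul]

theorem posDef_unembed {p : Mbar} (hp : p ∈ openPart) : (unembed p).PosDef ∧ (unembed p).det = 1 := by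
  obtain ⟨V, rfl⟩ := hp
  rw [unembed_embed]
  exact ⟨V.posDef, V.det_eq⟩

theorem posDef_of_mem_openPart {p : Mbar} (hp : p ∈ openPart) : p.P.PosDef ∧ p.Q.PosDef := by
  obtain ⟨V, rfl⟩ := hp
  exact ⟨V.posDef.smul (inv_pos.2 V.posDef.trace_pos),
    V.posDef.inv.smul (inv_pos.2 V.posDef.inv.trace_pos)⟩

theorem openPart_subset_source (σ : Equiv.Perm (Fin 3)) : openPart ⊆ (chart σ).source := fun p hp => by
  obtain ⟨h1, h2⟩ := posDef_of_mem_openPart hp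
  exact mem_chart_source.2 ⟨h2.diag_pos.ne', h1.diag_pos.ne'⟩

/-- A point `(P, Q)` with `P` invertible lies in the symmetric space: then `Q` is determined by `P`, since
`P Q` is scalar and `Q` has trace one. -/
theorem mem_openPart_of_det_ne_zero {p : Mbar} (h : p.P.det ≠ 0) : p ∈ openPart := by
  have hP : p.P.PosDef := p.pos_P.posDef_iff_det_ne_zero.2 h
  have hdet := hP.det_pos
  set c : ℝ := p.P.det ^ (-(1 / 3) : ℝ) with hc
  have hc0 : 0 < c := Real.rpow_pos_of_pos hdet _
  have hc3 : c ^ 3 * p.P.det = 1 := by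
    rw [hc, ← Real.rpow_natCast, ← Real.rpow_mul hdet.le]
    norm_num
    rw [Real.rpow_neg_one, inv_mul_cancel₀ hdet.ne']
  let V : SymSpace := ⟨c • p.P, hP.smul hc0, by rw [Matrix.det_smul]; simpa using hc3⟩
  refine ⟨V, Mbar.ext ?_ ?_⟩
  · exact normalise_smul hc0.ne' p.trace_P
  · change normalise (c • p.P)⁻¹ = p.Q
    obtain ⟨d, hd⟩ := p.scalar
    have hQ : p.Q = d • p.P⁻¹ := by
      have := congrArg (fun M => p.P⁻¹ * M) hd
      simp only [← Matrix.mul_assoc, Matrix.nonsing_inv_mul _ h.isUnit, one_mul, Matrix.mul_smul,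
        mul_one] at this
      exact this
    have hd0 : d ≠ 0 := by
      rintro rfl
      have := p.trace_Q
      simp [hQ] at this
    have e : (c • p.P)⁻¹ = (c⁻¹ * d⁻¹) • p.Q := by
      refine Matrix.inv_eq_right_inv ?_
      rw [Matrix.smul_mul, Matrix.mul_smul, hd, smul_smul, smul_smul]
      field_simp
      simp
    rw [e]
    exact normalise_smul (mul_ne_zero (inv_ne_zero hc0.ne') (inv_ne_zero hd0)) p.trace_Q

theorem mem_openPart_iff {σ : Equiv.Perm (Fin 3)} {p : Mbar} (hp : p ∈ (chart σ).source) :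
    p ∈ openPart ↔ coord σ p ∈ quadInt := by
  have hx := coord_mem_quad σ p
  have h1 : p.P.det = (rawP (coord σ p)).trace⁻¹ ^ 3 * (coord σ p 0 * coord σ p 1 ^ 2) := by
    rw [← Matrix.det_submatrix_equiv_self σ p.P, P_coord hp, normalise, Matrix.det_smul, det_rawP]
    simp
  have ht := rawP_trace_pos hx
  constructor
  · intro h
    have h2 := (posDef_of_mem_openPart h).1.det_pos.ne'
    rw [h1] at h2
    have h3 := right_ne_zero_of_mul h2
    exact ⟨lt_of_le_of_ne hx.1 (left_ne_zero_of_mul h3).symm,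
      lt_of_le_of_ne hx.2 (pow_ne_zero_iff two_ne_zero |>.1 (right_ne_zero_of_mul h3)).symm⟩
  · intro h
    have h2 := h.1
    have h3 := h.2
    exact mem_openPart_of_det_ne_zero (by rw [h1]; positivity)

theorem coord_mem_quadInt (σ : Equiv.Perm (Fin 3)) {p : Mbar} (hp : p ∈ openPart) :
    coord σ p ∈ quadInt :=
  (mem_openPart_iff (openPart_subset_source σ hp)).1 hp

theorem point_mem_openPart (σ : Equiv.Perm (Fin 3)) {x : Fin 5 → ℝ} (hx : x ∈ quadInt) :
    point σ x ∈ openPart := by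
  rw [mem_openPart_iff (point_mem_source σ x), coord_point σ (quadInt_subset hx)]
  exact hx

theorem isOpen_openPart : IsOpen openPart := by
  have : openPart = (chart 1).source ∩ coord 1 ⁻¹' quadInt := by
    ext p
    constructor
    · exact fun h => ⟨openPart_subset_source 1 h, coord_mem_quadInt 1 h⟩
    · exact fun h => (mem_openPart_iff h.1).2 h.2
  rw [this]
  exact (contMDiffOn_coord 1).continuousOn.isOpen_inter_preimage (chart 1).open_source
    isOpen_quadInt

theorem quad_subset_closure : quad ⊆ closure quadInt := by
  intro x hx
  have h : Filter.Tendsto (fun s : ℝ => x + s • (fun _ => 1 : Fin 5 → ℝ)) (𝓝[>] 0) (𝓝 x) := by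
    have : Continuous fun s : ℝ => x + s • (fun _ => 1 : Fin 5 → ℝ) := by fun_prop
    have h0 := this.tendsto 0
    simp only [zero_smul, add_zero] at h0
    exact h0.mono_left nhdsWithin_le_nhds
  refine mem_closure_of_tendsto h ?_
  filter_upwards [self_mem_nhdsWithin] with s hs
  have hs' : (0 : ℝ) < s := hs
  have h1 := hx.1
  have h2 := hx.2
  constructor <;> simp <;> linarith

theorem dense_openPart : Dense openPart := by
  intro p
  obtain ⟨σ, hp⟩ := exists_chart p
  have hx := coord_mem_quad σ p
  have hc : ContinuousWithinAt (point σ) quadInt (coord σ p) :=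
    ((contMDiffOn_point σ).continuousOn _ hx).mono quadInt_subset
  have := hc.mem_closure (quad_subset_closure hx) fun x hx => point_mem_openPart σ hx
  rwa [point_coord hp] at this

/-! ### Derivatives of `V` -/

theorem fderiv_rawP (x v : Fin 5 → ℝ) (i j : Fin 3) : fderiv ℝ (fun y => rawP y i j) x v =
    !![v 0 * x 1 + x 0 * v 1 + 2 * x 2 * v 2 * x 1 + x 2 ^ 2 * v 1 + 2 * x 3 * v 3,
        v 2 * x 1 + x 2 * v 1 + v 3 * x 4 + x 3 * v 4, v 3;
       v 2 * x 1 + x 2 * v 1 + v 3 * x 4 + x 3 * v 4, v 1 + 2 * x 4 * v 4, v 4;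
       v 3, v 4, 0] i j := by
  simp only [rawP_eq]
  fin_cases i <;> fin_cases j <;>
    simp (disch := fun_prop) [fderiv_coord, fderiv_fun_add, fderiv_fun_mul, fderiv_fun_pow] <;> ring

theorem fderiv_rawQ (x v : Fin 5 → ℝ) (i j : Fin 3) : fderiv ℝ (fun y => rawQ y i j) x v =
    !![0, -v 2, v 2 * x 4 + x 2 * v 4 - v 3;
       -v 2, 2 * x 2 * v 2 + v 0,
        -v 2 * (x 2 * x 4 - x 3) - x 2 * (v 2 * x 4 + x 2 * v 4 - v 3) - v 0 * x 4 - x 0 * v 4;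
       v 2 * x 4 + x 2 * v 4 - v 3,
        -v 2 * (x 2 * x 4 - x 3) - x 2 * (v 2 * x 4 + x 2 * v 4 - v 3) - v 0 * x 4 - x 0 * v 4,
        2 * (x 2 * x 4 - x 3) * (v 2 * x 4 + x 2 * v 4 - v 3) + v 0 * x 4 ^ 2 +
          2 * x 0 * x 4 * v 4 + v 0 * x 1 + x 0 * v 1] i j := by
  simp only [rawQ_eq]
  fin_cases i <;> fin_cases j <;>
    simp (disch := fun_prop) [fderiv_coord, fderiv_fun_add, fderiv_fun_mul, fderiv_fun_pow,
      fderiv_fun_sub] <;> ring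

theorem fderiv_rawP_frameVec (x f : Fin 5 → ℝ) (i j : Fin 3) :
    fderiv ℝ (fun y => rawP y i j) x (frameVec x f) =
      ((frameK x f + ((f 0 + 2 * f 1) / 3) • (1 : Mat)) * rawP x) i j := by
  have e : (frameK x f + ((f 0 + 2 * f 1) / 3) • (1 : Mat)) * rawP x =
      unip x * (frameB x f * Matrix.diagonal ![x 0 * x 1, x 1, 1]) * (unip x).transpose := by
    rw [frameK, frameB₀, rawP]
    set a : Mat := Matrix.diagonal ![x 0 * x 1, x 1, 1]
    set r := (f 0 + 2 * f 1) / 3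
    rw [Matrix.mul_sub, Matrix.sub_mul, Matrix.mul_smul, mul_one, Matrix.smul_mul,
      unip_mul_unipInv, sub_add_cancel]
    calc unip x * frameB x f * unipInv x * (unip x * a * (unip x).transpose)
        = unip x * frameB x f * (unipInv x * unip x) * a * (unip x).transpose := by
          simp only [Matrix.mul_assoc]
      _ = _ := by rw [unipInv_mul_unip, mul_one, Matrix.mul_assoc (unip x)]
  have hB : frameB x f * Matrix.diagonal ![x 0 * x 1, x 1, 1] =
      !![(f 0 + f 1) * (x 0 * x 1), x 0 * f 2 * x 1, x 0 * x 1 * f 3;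
         f 2 * (x 0 * x 1), f 1 * x 1, x 1 * f 4;
         f 3 * (x 0 * x 1), f 4 * x 1, 0] := by
    ext i j
    fin_cases i <;> fin_cases j <;> simp [frameB]
  rw [e, fderiv_rawP, hB]
  fin_cases i <;> fin_cases j <;>
    simp [frameVec, unip, Matrix.mul_apply, Fin.sum_univ_three] <;> ring

theorem differentiable_rawP (i j : Fin 3) : Differentiable ℝ fun y => rawP y i j :=
  (contDiff_rawP i j).differentiable (by simp)

theorem differentiable_rawQ (i j : Fin 3) : Differentiable ℝ fun y => rawQ y i j :=
  (contDiff_rawQ i j).differentiable (by simp)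

theorem hasFDerivAt_scale {x : Fin 5 → ℝ} (hx : x ∈ quadInt) :
    HasFDerivAt (fun y : Fin 5 → ℝ => (y 0 * y 1 ^ 2) ^ (-(1 / 3) : ℝ))
      (((-(1 / 3) : ℝ) * (x 0 * x 1 ^ 2) ^ (-(1 / 3) - 1 : ℝ)) •
        fderiv ℝ (fun y : Fin 5 → ℝ => y 0 * y 1 ^ 2) x) x := by
  have h1 := hx.1
  have h2 := hx.2
  have hd : DifferentiableAt ℝ (fun y : Fin 5 → ℝ => y 0 * y 1 ^ 2) x := by fun_prop
  exact hd.hasFDerivAt.rpow_const (Or.inl (by positivity))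

theorem contDiffOn_unitV (i j : Fin 3) : ContDiffOn ℝ ∞ (fun y => unitV y i j) quadInt := by
  intro x hx
  have h1 := hx.1
  have h2 := hx.2
  have hd : ContDiffAt ℝ ∞ (fun y : Fin 5 → ℝ => y 0 * y 1 ^ 2) x := by fun_prop
  exact ((hd.rpow_const_of_ne (by positivity)).mul (contDiff_rawP i j).contDiffAt).contDiffWithinAt

theorem differentiableAt_unitV {x : Fin 5 → ℝ} (hx : x ∈ quadInt) (i j : Fin 3) :
    DifferentiableAt ℝ (fun y => unitV y i j) x :=
  ((contDiffOn_unitV i j).contDiffAt (isOpen_quadInt.mem_nhds hx)).differentiableAt (by simp)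

theorem fderiv_unitV_frameVec {x : Fin 5 → ℝ} (hx : x ∈ quadInt) (f : Fin 5 → ℝ) (i j : Fin 3) :
    fderiv ℝ (fun y => unitV y i j) x (frameVec x f) = (frameK x f * unitV x) i j := by
  have h1 := hx.1
  have h2 := hx.2
  have hpos : 0 < x 0 * x 1 ^ 2 := by positivity
  have h := (hasFDerivAt_scale hx).fun_mul (differentiable_rawP i j x).hasFDerivAt
  have e : fderiv ℝ (fun y : Fin 5 → ℝ => y 0 * y 1 ^ 2) x (frameVec x f) =
      (f 0 + 2 * f 1) * (x 0 * x 1 ^ 2) := by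
    simp (disch := fun_prop) [fderiv_coord, fderiv_fun_mul, fderiv_fun_pow, frameVec]
    ring
  have h3 : fderiv ℝ (fun y => unitV y i j) x = _ := h.fderiv
  rw [h3]
  simp only [add_apply, smul_apply, smul_eq_mul, e,
    fderiv_rawP_frameVec, unitV, Matrix.mul_smul, Matrix.smul_apply, Matrix.add_mul,
    Matrix.add_apply, Matrix.smul_mul, one_mul]
  rw [Real.rpow_sub_one hpos.ne']
  field_simp
  ring

theorem unitV_apply_symm (x : Fin 5 → ℝ) (i j : Fin 3) : unitV x j i = unitV x i j := by
  simp only [unitV, rawP_eq]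
  fin_cases i <;> fin_cases j <;> simp

theorem velocity_apply {σ : Equiv.Perm (Fin 3)} {p : Mbar} (hp : p ∈ openPart)
    (v : TangentSpace cornerModel p) (i j : Fin 3) :
    velocity p v (σ i) (σ j) = fderiv ℝ (fun y => unitV y i j) (coord σ p) (vecCoord σ p v) := by
  have hs := openPart_subset_source σ hp
  refine mfderiv_eq_of_coord hs (differentiableAt_unitV (coord_mem_quadInt σ hp) i j) ?_ v
  filter_upwards [(chart σ).open_source.mem_nhds hs] with q hq
  exact congrFun (congrFun (unembed_coord hq) i) j

/-- The logarithmic derivative of `V` along a tangent vector at a point of the symmetric space. -/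
def logDeriv (p : Mbar) (v : TangentSpace cornerModel p) : Mat := velocity p v * (unembed p)⁻¹

theorem velocity_submatrix {σ : Equiv.Perm (Fin 3)} {p : Mbar} (hp : p ∈ openPart)
    {v : TangentSpace cornerModel p} {f : Fin 5 → ℝ}
    (h : vecCoord σ p v = frameVec (coord σ p) f) :
    (velocity p v).submatrix σ σ = frameK (coord σ p) f * unitV (coord σ p) := by
  ext i j
  rw [Matrix.submatrix_apply, velocity_apply hp, h,
    fderiv_unitV_frameVec (coord_mem_quadInt σ hp)]

theorem logDeriv_submatrix {σ : Equiv.Perm (Fin 3)} {p : Mbar} (hp : p ∈ openPart)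
    {v : TangentSpace cornerModel p} {f : Fin 5 → ℝ}
    (h : vecCoord σ p v = frameVec (coord σ p) f) :
    (logDeriv p v).submatrix σ σ = frameK (coord σ p) f := by
  have hd : (unitV (coord σ p)).det = 1 := by
    rw [← unembed_coord (openPart_subset_source σ hp), Matrix.det_submatrix_equiv_self,
      (posDef_unembed hp).2]
  rw [logDeriv, ← Matrix.submatrix_mul_equiv _ _ σ σ σ, velocity_submatrix hp h,
    ← Matrix.inv_submatrix_equiv, unembed_coord (openPart_subset_source σ hp),
    Matrix.mul_assoc, Matrix.mul_nonsing_inv _ (by simp [hd]), mul_one]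

theorem isUnit_det_unembed {p : Mbar} (hp : p ∈ openPart) : IsUnit (unembed p).det := by
  simp [(posDef_unembed hp).2]

theorem logDeriv_mul {p : Mbar} (hp : p ∈ openPart) (v : TangentSpace cornerModel p) :
    logDeriv p v * unembed p = velocity p v := by
  rw [logDeriv, Matrix.mul_assoc, Matrix.nonsing_inv_mul _ (isUnit_det_unembed hp), mul_one]

theorem velocity_transpose {p : Mbar} (hp : p ∈ openPart) (v : TangentSpace cornerModel p) :
    (velocity p v).transpose = velocity p v := by
  ext i j
  have h1 := velocity_apply (σ := 1) hp v i j
  have h2 := velocity_apply (σ := 1) hp v j i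
  simp only [unitV_apply_symm _ i j] at h2
  exact h2.trans h1.symm

/-- The tangent vector at the identity that corresponds to `v` is the symmetric part of the logarithmic
derivative of `V`. -/
theorem toIdentity_velocity {p : Mbar} (hp : p ∈ openPart) (v : TangentSpace cornerModel p) :
    toIdentity (unembed p) (velocity p v) =
      (1 / 2 : ℝ) • (logDeriv p v + (logDeriv p v).transpose) := by
  have hV : (unembed p).transpose = unembed p := by simpa using (posDef_unembed hp).1.1.eq
  have hu := isUnit_det_unembed hp
  rw [toIdentity, logDeriv, Matrix.transpose_mul, velocity_transpose hp, Matrix.transpose_nonsing_inv,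
    hV, Matrix.mul_add, Matrix.add_mul, ← Matrix.mul_assoc, Matrix.nonsing_inv_mul _ hu, one_mul,
    ← Matrix.mul_assoc, Matrix.mul_assoc (_ * velocity p v), Matrix.mul_nonsing_inv _ hu, mul_one]

/-! ### Edge-to-edge vector fields in the charts -/

theorem fderivWithin_eq_zero_of_ray {F : (Fin 5 → ℝ) → ℝ} {x w : Fin 5 → ℝ}
    (hd : DifferentiableWithinAt ℝ F quad x) {δ : ℝ} (hδ : 0 < δ)
    (h : ∀ s ∈ Set.Icc 0 δ, x + s • w ∈ quad ∧ F (x + s • w) = 0) :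
    fderivWithin ℝ F quad x w = 0 := by
  have h0 : x + (0 : ℝ) • w = x := by simp
  have hl : HasDerivWithinAt (fun s : ℝ => x + s • w) w (Set.Icc 0 δ) 0 := by
    simpa using (((hasDerivAt_id (0 : ℝ)).smul_const w).const_add x).hasDerivWithinAt
  have hF : HasFDerivWithinAt F (fderivWithin ℝ F quad x) quad (x + (0 : ℝ) • w) := by
    rw [h0]
    exact hd.hasFDerivWithinAt
  have h1 := hF.comp_hasDerivWithinAt (f := fun s : ℝ => x + s • w) 0 hl fun s hs => (h s hs).1
  have h2 : HasDerivWithinAt (F ∘ fun s : ℝ => x + s • w) 0 (Set.Icc 0 δ) 0 :=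
    (hasDerivWithinAt_const 0 (Set.Icc 0 δ) (0 : ℝ)).congr (fun s hs => (h s hs).2)
      (h 0 ⟨le_rfl, hδ.le⟩).2
  exact (uniqueDiffOn_Icc hδ 0 ⟨le_rfl, hδ.le⟩).eq_deriv _ h1 h2

/-- Short segments in the direction of an edge-to-edge vector stay in the model corner. -/
theorem exists_segment_subset_quad {x : Fin 5 → ℝ} (hx : x ∈ quad) (f : Fin 5 → ℝ) :
    ∃ δ : ℝ, 0 < δ ∧ ∀ s ∈ Set.Icc 0 δ, x + s • frameVec x f ∈ quad := by
  have hpos : 0 < 1 + |f 0| + |f 1| := by positivity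
  refine ⟨(1 + |f 0| + |f 1|)⁻¹, inv_pos.2 hpos, fun s hs => ?_⟩
  have h1 : s * (1 + |f 0| + |f 1|) ≤ 1 := by
    calc s * (1 + |f 0| + |f 1|) ≤ (1 + |f 0| + |f 1|)⁻¹ * (1 + |f 0| + |f 1|) :=
          mul_le_mul_of_nonneg_right hs.2 hpos.le
      _ = 1 := inv_mul_cancel₀ hpos.ne'
  have a0 : 0 ≤ 1 + s * f 0 := by
    have := mul_le_mul_of_nonneg_left (neg_abs_le (f 0)) hs.1
    have := mul_nonneg hs.1 (abs_nonneg (f 1))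
    nlinarith [hs.1]
  have a1 : 0 ≤ 1 + s * f 1 := by
    have := mul_le_mul_of_nonneg_left (neg_abs_le (f 1)) hs.1
    have := mul_nonneg hs.1 (abs_nonneg (f 0))
    nlinarith [hs.1]
  have b0 : (x + s • frameVec x f) 0 = x 0 * (1 + s * f 0) := by
    simp [frameVec]
    ring
  have b1 : (x + s • frameVec x f) 1 = x 1 * (1 + s * f 1) := by
    simp [frameVec]
    ring
  exact ⟨by rw [b0]; exact mul_nonneg hx.1 a0, by rw [b1]; exact mul_nonneg hx.2 a1⟩

/-- A vector is tangent to every set that contains the short coordinate segments in its direction. -/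
theorem tangentTo_of_segment {σ : Equiv.Perm (Fin 3)} {p : Mbar} (hp : p ∈ (chart σ).source)
    {v : TangentSpace cornerModel p} {f : Fin 5 → ℝ} (h : vecCoord σ p v = frameVec (coord σ p) f)
    {S : Set Mbar} (hS : ∀ s : ℝ, coord σ p + s • frameVec (coord σ p) f ∈ quad →
      point σ (coord σ p + s • frameVec (coord σ p) f) ∈ S) : TangentTo S p v := by
  intro F hF hF0
  have hx := coord_mem_quad σ p
  rw [mfderiv_eq_fderivWithin hp ((hF p).mdifferentiableAt (by simp)), h]
  obtain ⟨δ, hδ, hseg⟩ := exists_segment_subset_quad hx f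
  refine fderivWithin_eq_zero_of_ray
    ((contDiffOn_comp_point hF.contMDiffOn).differentiableOn (by simp) _ hx) hδ fun s hs => ?_
  exact ⟨hseg s hs, hF0 _ (hS s (hseg s hs))⟩

theorem submatrix_injective (σ : Equiv.Perm (Fin 3)) {A B : Mat}
    (h : A.submatrix σ σ = B.submatrix σ σ) : A = B := by
  have := congrArg (fun M : Mat => M.submatrix σ.symm σ.symm) h
  simpa using this

theorem tangentTo_lowerFibre {σ : Equiv.Perm (Fin 3)} {p : Mbar} (hp : p ∈ (chart σ).source)
    (hl : p ∈ lowerFace) {v : TangentSpace cornerModel p} {f : Fin 5 → ℝ}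
    (h : vecCoord σ p v = frameVec (coord σ p) f) : TangentTo (lowerFibre p) p v := by
  refine tangentTo_of_segment hp h fun s hs => ?_
  have h1 := (mem_lowerFace_iff hp).1 hl
  set x := coord σ p with hxdef
  refine ⟨?_, submatrix_injective σ ?_⟩
  · rw [mem_lowerFace_iff (point_mem_source σ _), coord_point σ hs]
    simp [frameVec, h1]
  · rw [P_point σ hs, P_coord hp]
    congr 1
    rw [rawP_eq, rawP_eq]
    ext i j
    fin_cases i <;> fin_cases j <;> simp [frameVec, h1, ← hxdef]

theorem tangentTo_upperFibre {σ : Equiv.Perm (Fin 3)} {p : Mbar} (hp : p ∈ (chart σ).source)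
    (hu : p ∈ upperFace) {v : TangentSpace cornerModel p} {f : Fin 5 → ℝ}
    (h : vecCoord σ p v = frameVec (coord σ p) f) : TangentTo (upperFibre p) p v := by
  refine tangentTo_of_segment hp h fun s hs => ?_
  have h0 := (mem_upperFace_iff hp).1 hu
  set x := coord σ p with hxdef
  refine ⟨?_, submatrix_injective σ ?_⟩
  · rw [mem_upperFace_iff (point_mem_source σ _), coord_point σ hs]
    simp [frameVec, h0]
  · rw [Q_point σ hs, Q_coord hp]
    congr 1
    rw [rawQ_eq, rawQ_eq]
    ext i j
    fin_cases i <;> fin_cases j <;> simp [frameVec, h0, ← hxdef] <;>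
      first | ring1 | (left; ring1)

theorem contDiff_trace_rawP : ContDiff ℝ ∞ fun x => (rawP x).trace := by
  simp only [Matrix.trace_fin_three]
  exact ((contDiff_rawP 0 0).add (contDiff_rawP 1 1)).add (contDiff_rawP 2 2)

theorem contDiff_trace_rawQ : ContDiff ℝ ∞ fun x => (rawQ x).trace := by
  simp only [Matrix.trace_fin_three]
  exact ((contDiff_rawQ 0 0).add (contDiff_rawQ 1 1)).add (contDiff_rawQ 2 2)

theorem contMDiff_of_coord {h : Mbar → ℝ}
    (H : ∀ σ, ∃ F : (Fin 5 → ℝ) → ℝ, ContDiffOn ℝ ∞ F quad ∧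
      ∀ p ∈ (chart σ).source, h p = F (coord σ p)) : ContMDiff cornerModel 𝓘(ℝ) ∞ h := by
  intro p
  obtain ⟨σ, hp⟩ := exists_chart p
  obtain ⟨F, hF, hhF⟩ := H σ
  exact ((contMDiffOn_comp_coord hF).congr hhF).contMDiffAt ((chart σ).open_source.mem_nhds hp)

theorem contMDiff_P (a b : Fin 3) : ContMDiff cornerModel 𝓘(ℝ) ∞ fun q : Mbar => q.P a b := by
  refine contMDiff_of_coord fun σ => ⟨fun x => normalise (rawP x) (σ.symm a) (σ.symm b), ?_,
    fun p hp => ?_⟩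
  · exact (contDiff_trace_rawP.contDiffOn.inv fun x hx => (rawP_trace_pos hx).ne').mul
      (contDiff_rawP _ _).contDiffOn
  · beta_reduce
    rw [← P_coord hp]
    simp

theorem contMDiff_Q (a b : Fin 3) : ContMDiff cornerModel 𝓘(ℝ) ∞ fun q : Mbar => q.Q a b := by
  refine contMDiff_of_coord fun σ => ⟨fun x => normalise (rawQ x) (σ.symm a) (σ.symm b), ?_,
    fun p hp => ?_⟩
  · exact (contDiff_trace_rawQ.contDiffOn.inv fun x hx => (rawQ_trace_pos hx).ne').mul
      (contDiff_rawQ _ _).contDiffOn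
  · beta_reduce
    rw [← Q_coord hp]
    simp

/-- A derivation that annihilates the entries of the normalised matrix `A / Tr A`, one entry of `A`
being constant equal to one, annihilates the entries of `A`. -/
theorem fderiv_eq_zero_of_normalise {A : (Fin 5 → ℝ) → Mat} {x w : Fin 5 → ℝ}
    (hA : ∀ i j, DifferentiableAt ℝ (fun y => A y i j) x) (ht : (A x).trace ≠ 0) {k : Fin 3}
    (hk : ∀ y, A y k k = 1) (h : ∀ i j, fderiv ℝ (fun y => normalise (A y) i j) x w = 0)
    (i j : Fin 3) : fderiv ℝ (fun y => A y i j) x w = 0 := by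
  have hT : DifferentiableAt ℝ (fun y => (A y).trace⁻¹) x := by
    refine DifferentiableAt.inv ?_ ht
    simp only [Matrix.trace_fin_three]
    exact ((hA 0 0).add (hA 1 1)).add (hA 2 2)
  have key : ∀ i j, (A x).trace⁻¹ * fderiv ℝ (fun y => A y i j) x w +
      A x i j * fderiv ℝ (fun y => (A y).trace⁻¹) x w = 0 := fun i j => by
    have h1 := h i j
    have h2 : (fun y => normalise (A y) i j) = fun y => (A y).trace⁻¹ * A y i j := rfl
    rw [h2, fderiv_fun_mul hT (hA i j)] at h1
    exact h1
  have hk1 := key k k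
  simp only [hk, fderiv_const_apply, zero_apply, mul_zero, zero_add, one_mul] at hk1
  have h3 := key i j
  rw [hk1, mul_zero, add_zero] at h3
  exact (mul_eq_zero.1 h3).resolve_left (inv_ne_zero ht)

/-- The components in a chart of a vector tangent to the fibres of `lowerFace`. The entries of `P` are
constant on each fibre, and serve as test functions. -/
theorem vecCoord_of_tangentTo_lowerFibre {σ : Equiv.Perm (Fin 3)} {p : Mbar}
    (hp : p ∈ (chart σ).source) {v : TangentSpace cornerModel p}
    (h : TangentTo (lowerFibre p) p v) :
    vecCoord σ p v 1 = 0 ∧ vecCoord σ p v 3 = 0 ∧ vecCoord σ p v 4 = 0 := by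
  have hx := coord_mem_quad σ p
  have ht := (rawP_trace_pos hx).ne'
  have hn : ∀ i j, fderiv ℝ (fun y => normalise (rawP y) i j) (coord σ p) (vecCoord σ p v) = 0 :=
    fun i j => by
    have hd : DifferentiableAt ℝ (fun y => normalise (rawP y) i j) (coord σ p) :=
      ((contDiff_trace_rawP.differentiable (by simp) _).inv ht).mul (differentiable_rawP i j _)
    have h1 := h (fun q => q.P (σ i) (σ j) - p.P (σ i) (σ j))
      ((contMDiff_P (σ i) (σ j)).sub contMDiff_const) fun q hq => by rw [hq.2, sub_self]
    rw [mfderiv_eq_of_coord hp (hd.sub_const (p.P (σ i) (σ j)))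
      (Filter.eventually_of_mem ((chart σ).open_source.mem_nhds hp) fun q hq => by
        simp only [← P_coord hq, Matrix.submatrix_apply]), fderiv_sub_const] at h1
    exact h1
  have key := fderiv_eq_zero_of_normalise (A := rawP) (k := 2)
    (fun i j => differentiable_rawP i j _) ht (fun y => by simp [rawP_eq]) hn
  have k02 := key 0 2
  have k12 := key 1 2
  have k11 := key 1 1
  rw [fderiv_rawP] at k02 k12 k11
  simp at k02 k12 k11
  exact ⟨by rw [k12] at k11; simpa using k11, k02, k12⟩

/-- The components in a chart of a vector tangent to the fibres of `upperFace`. The entries of `Q` are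
constant on each fibre, and serve as test functions. -/
theorem vecCoord_of_tangentTo_upperFibre {σ : Equiv.Perm (Fin 3)} {p : Mbar}
    (hp : p ∈ (chart σ).source) {v : TangentSpace cornerModel p}
    (h : TangentTo (upperFibre p) p v) :
    vecCoord σ p v 0 = 0 ∧ vecCoord σ p v 2 = 0 ∧
      vecCoord σ p v 3 - coord σ p 2 * vecCoord σ p v 4 = 0 := by
  have hx := coord_mem_quad σ p
  have ht := (rawQ_trace_pos hx).ne'
  have hn : ∀ i j, fderiv ℝ (fun y => normalise (rawQ y) i j) (coord σ p) (vecCoord σ p v) = 0 :=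
    fun i j => by
    have hd : DifferentiableAt ℝ (fun y => normalise (rawQ y) i j) (coord σ p) :=
      ((contDiff_trace_rawQ.differentiable (by simp) _).inv ht).mul (differentiable_rawQ i j _)
    have h1 := h (fun q => q.Q (σ i) (σ j) - p.Q (σ i) (σ j))
      ((contMDiff_Q (σ i) (σ j)).sub contMDiff_const) fun q hq => by rw [hq.2, sub_self]
    rw [mfderiv_eq_of_coord hp (hd.sub_const (p.Q (σ i) (σ j)))
      (Filter.eventually_of_mem ((chart σ).open_source.mem_nhds hp) fun q hq => by
        simp only [← Q_coord hq, Matrix.submatrix_apply]), fderiv_sub_const] at h1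
    exact h1
  have key := fderiv_eq_zero_of_normalise (A := rawQ) (k := 0)
    (fun i j => differentiable_rawQ i j _) ht (fun y => by simp [rawQ_eq]) hn
  have k01 := key 0 1
  have k02 := key 0 2
  have k11 := key 1 1
  rw [fderiv_rawQ] at k01 k02 k11
  simp at k01 k02 k11
  rw [k01] at k02 k11
  exact ⟨by simpa using k11, k01, by linarith⟩

/-- In each chart, an edge-to-edge field has smooth coefficients with respect to the local frame. -/
theorem exists_comps_eq_frameVec (σ : Equiv.Perm (Fin 3)) (X : eeFields) :
    ∃ f : (Fin 5 → ℝ) → (Fin 5 → ℝ), ContDiffOn ℝ ∞ f quad ∧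
      ∀ x ∈ quad, comps σ X.1 x = frameVec x (f x) := by
  have hξ : ∀ k, ContDiffOn ℝ ∞ (fun x => comps σ X.1 x k) quad :=
    contDiffOn_pi.1 (contDiffOn_comps σ X.1)
  have low : ∀ x ∈ quad, x 1 = 0 →
      comps σ X.1 x 1 = 0 ∧ comps σ X.1 x 3 = 0 ∧ comps σ X.1 x 4 = 0 := fun x hx h1 => by
    refine vecCoord_of_tangentTo_lowerFibre (point_mem_source σ x) (X.2.1 _ ?_)
    rw [mem_lowerFace_iff (point_mem_source σ x), coord_point σ hx, h1]
  have upp : ∀ x ∈ quad, x 0 = 0 →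
      comps σ X.1 x 0 = 0 ∧ comps σ X.1 x 2 = 0 ∧ comps σ X.1 x 3 - x 2 * comps σ X.1 x 4 = 0 :=
    fun x hx h0 => by
    have := vecCoord_of_tangentTo_upperFibre (point_mem_source σ x) (X.2.2 _ (by
      rw [mem_upperFace_iff (point_mem_source σ x), coord_point σ hx, h0]))
    rw [coord_point σ hx] at this
    exact this
  have hω : ContDiffOn ℝ ∞ (fun x => comps σ X.1 x 3 - x 2 * comps σ X.1 x 4) quad :=
    (hξ 3).sub ((contDiff_apply ℝ ℝ (2 : Fin 5)).contDiffOn.mul (hξ 4))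
  obtain ⟨f0, hf0, e0⟩ := exists_eq_mul_of_eq_zero (hξ 0) 0 fun x hx h => (upp x hx h).1
  obtain ⟨f1, hf1, e1⟩ := exists_eq_mul_of_eq_zero (hξ 1) 1 fun x hx h => (low x hx h).1
  obtain ⟨f2, hf2, e2⟩ := exists_eq_mul_of_eq_zero (hξ 2) 0 fun x hx h => (upp x hx h).2.1
  obtain ⟨f4, hf4, e4⟩ := exists_eq_mul_of_eq_zero (hξ 4) 1 fun x hx h => (low x hx h).2.2
  obtain ⟨g, hg, eg⟩ := exists_eq_mul_of_eq_zero hω 0 fun x hx h => (upp x hx h).2.2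
  -- where `x 0 = 0`, the vanishing of the first quotient on the face `x 1 = 0` follows by continuity
  have hg0 : ∀ x ∈ quad, x 1 = 0 → g x = 0 := fun x hx h1 => by
    have pos : ∀ y ∈ quad, y 1 = 0 → y 0 ≠ 0 → g y = 0 := fun y hy h1 h0 => by
      have h2 := eg y hy
      obtain ⟨-, h3, h4⟩ := low y hy h1
      rw [h3, h4, mul_zero, sub_zero] at h2
      exact (mul_eq_zero.1 h2.symm).resolve_left h0
    let c : ℝ → Fin 5 → ℝ := fun s => x + s • Pi.single 0 1
    have hc0 : c 0 = x := by simp [c]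
    have hcq : ∀ s : ℝ, 0 < s → c s ∈ quad ∧ c s 1 = 0 ∧ c s 0 ≠ 0 := fun s hs => by
      have := hx.1
      have e : c s 0 = x 0 + s := by simp [c]
      have e' : c s 1 = 0 := by simp [c, h1]
      exact ⟨⟨by rw [e]; linarith, e'.ge⟩, e', by rw [e]; linarith⟩
    have h1 : Filter.Tendsto c (𝓝[>] 0) (𝓝[quad] x) := by
      refine tendsto_nhdsWithin_iff.2 ⟨?_, ?_⟩
      · have : Continuous c := by fun_prop
        have h0 := this.tendsto 0
        rw [hc0] at h0
        exact h0.mono_left nhdsWithin_le_nhds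
      · filter_upwards [self_mem_nhdsWithin] with s hs using (hcq s hs).1
    have h2 : Filter.Tendsto (fun s => g (c s)) (𝓝[>] 0) (𝓝 (g x)) :=
      (hg.continuousOn x hx).tendsto.comp h1
    refine tendsto_nhds_unique h2 (tendsto_const_nhds.congr' ?_)
    filter_upwards [self_mem_nhdsWithin] with s hs
    obtain ⟨h3, h4, h5⟩ := hcq s hs
    exact (pos _ h3 h4 h5).symm
  obtain ⟨f3, hf3, e3⟩ := exists_eq_mul_of_eq_zero hg 1 hg0
  refine ⟨fun x => ![f0 x, f1 x, f2 x, f3 x, f4 x], contDiffOn_pi.2 fun k => ?_, fun x hx => ?_⟩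
  · fin_cases k <;> assumption
  · have h3 := eg x hx
    rw [e3 x hx, e4 x hx] at h3
    funext k
    fin_cases k <;> simp [frameVec, e0 x hx, e1 x hx, e2 x hx, e4 x hx]
    linarith

/-! ### Smooth extension to the boundary -/

theorem eq_of_eq_on_openPart {f g : Mbar → ℝ} (hf : Continuous f) (hg : Continuous g)
    (h : ∀ p ∈ openPart, f p = g p) : f = g :=
  hf.ext_on dense_openPart hg h

/-- A function on the symmetric space extends smoothly to the compactification as soon as it does so in
each chart: the local extensions agree, because the symmetric space is dense. -/
theorem exists_smooth_extension {h : Mbar → ℝ}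
    (H : ∀ σ, ∃ F : (Fin 5 → ℝ) → ℝ, ContDiffOn ℝ ∞ F quad ∧
      ∀ p ∈ openPart, h p = F (coord σ p)) :
    ∃ h' : Mbar → ℝ, ContMDiff cornerModel 𝓘(ℝ) ∞ h' ∧ ∀ p ∈ openPart, h' p = h p := by
  choose F hF hhF using H
  have agree : ∀ σ τ, ∀ p ∈ (chart σ).source ∩ (chart τ).source,
      F σ (coord σ p) = F τ (coord τ p) := by
    intro σ τ
    have ho := (chart σ).open_source.inter (chart τ).open_source
    refine Set.EqOn.of_subset_closure
      (s := ((chart σ).source ∩ (chart τ).source) ∩ openPart) (fun p hp => ?_)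
      ((contMDiffOn_comp_coord (hF σ)).continuousOn.mono Set.inter_subset_left)
      ((contMDiffOn_comp_coord (hF τ)).continuousOn.mono Set.inter_subset_right)
      Set.inter_subset_left (dense_openPart.open_subset_closure_inter ho)
    rw [← hhF σ p hp.2, ← hhF τ p hp.2]
  refine ⟨fun p => F (chartIndex p) (coord (chartIndex p) p),
    contMDiff_of_coord fun σ => ⟨F σ, hF σ, fun p hp => agree _ _ p ⟨mem_chartIndex p, hp⟩⟩,
    fun p hp => (hhF _ p hp).symm⟩

/-- The logarithmic derivative of `V` along an edge-to-edge field is smooth up to the boundary. -/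
theorem exists_logDeriv_extension (X : eeFields) :
    ∃ K : Mbar → Mat, (∀ i j, ContMDiff cornerModel 𝓘(ℝ) ∞ fun p => K p i j) ∧
      ∀ p ∈ openPart, K p = logDeriv p (X.1 p) := by
  have h : ∀ a b, ∃ k : Mbar → ℝ, ContMDiff cornerModel 𝓘(ℝ) ∞ k ∧
      ∀ p ∈ openPart, k p = logDeriv p (X.1 p) a b := fun a b => by
    refine exists_smooth_extension fun σ => ?_
    obtain ⟨f, hf, hX⟩ := exists_comps_eq_frameVec σ X
    refine ⟨fun x => frameK x (f x) (σ.symm a) (σ.symm b), contDiffOn_frameK hf _ _,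
      fun p hp => ?_⟩
    have h1 := hX _ (coord_mem_quad σ p)
    rw [comps_coord (openPart_subset_source σ hp)] at h1
    beta_reduce
    rw [← logDeriv_submatrix hp h1]
    simp
  choose k hk hk' using h
  exact ⟨fun p => Matrix.of fun a b => k a b p, hk, fun p hp => by
    ext a b
    exact hk' a b p hp⟩

theorem velocity_add (p : Mbar) (v w : TangentSpace cornerModel p) :
    velocity p (v + w) = velocity p v + velocity p w := by
  ext i j
  exact (mfderiv cornerModel 𝓘(ℝ) (fun q : Mbar => unembed q i j) p).map_add v w

theorem velocity_smul (p : Mbar) (c : ℝ) (v : TangentSpace cornerModel p) :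
    velocity p (c • v) = c • velocity p v := by
  ext i j
  exact (mfderiv cornerModel 𝓘(ℝ) (fun q : Mbar => unembed q i j) p).map_smul c v

theorem logDeriv_add (p : Mbar) (v w : TangentSpace cornerModel p) :
    logDeriv p (v + w) = logDeriv p v + logDeriv p w := by
  rw [logDeriv, velocity_add, Matrix.add_mul]
  rfl

theorem logDeriv_smul (p : Mbar) (c : ℝ) (v : TangentSpace cornerModel p) :
    logDeriv p (c • v) = c • logDeriv p v := by
  rw [logDeriv, velocity_smul, Matrix.smul_mul]
  rfl

theorem TangentTo.add {S : Set Mbar} {p : Mbar} {v w : TangentSpace cornerModel p}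
    (hv : TangentTo S p v) (hw : TangentTo S p w) : TangentTo S p (v + w) := fun f hf h =>
  ((mfderiv cornerModel 𝓘(ℝ) f p).map_add v w).trans (by rw [hv f hf h, hw f hf h, add_zero])

theorem TangentTo.smul {S : Set Mbar} {p : Mbar} {v : TangentSpace cornerModel p}
    (hv : TangentTo S p v) (c : ℝ) : TangentTo S p (c • v) := fun f hf h =>
  ((mfderiv cornerModel 𝓘(ℝ) f p).map_smul c v).trans (by rw [hv f hf h, smul_zero])

theorem contDiffOn_frameVec {S : Set (Fin 5 → ℝ)} {f : (Fin 5 → ℝ) → (Fin 5 → ℝ)}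
    (hf : ContDiffOn ℝ ∞ f S) : ContDiffOn ℝ ∞ (fun x => frameVec x (f x)) S := by
  have hf' : ∀ k, ContDiffOn ℝ ∞ (fun x => f x k) S := contDiffOn_pi.1 hf
  have hx : ∀ k, ContDiffOn ℝ ∞ (fun x : Fin 5 → ℝ => x k) S := fun k =>
    (contDiff_apply ℝ ℝ k).contDiffOn
  refine contDiffOn_pi.2 fun k => ?_
  fin_cases k
  · exact (hx 0).mul (hf' 0)
  · exact (hx 1).mul (hf' 1)
  · exact (hx 0).mul (hf' 2)
  · exact (((hx 0).mul (hx 1)).mul (hf' 3)).add ((hx 2).mul ((hx 1).mul (hf' 4)))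
  · exact (hx 1).mul (hf' 4)

/-- Each trace-free symmetric matrix `M` is the value of a global edge-to-edge field: the symmetric part
of the logarithmic derivative of `V` trivialises the edge-to-edge tangent bundle. -/
theorem exists_field {M : Mat} (hM : M.transpose = M) (ht : M.trace = 0) :
    ∃ Z : eeFields, ∀ p ∈ openPart,
      (1 / 2 : ℝ) • (logDeriv p (Z.1 p) + (logDeriv p (Z.1 p)).transpose) = M := by
  let t : ∀ p : Mbar, Set (TangentSpace cornerModel p) := fun p => {v |
    (p ∈ lowerFace → TangentTo (lowerFibre p) p v) ∧
    (p ∈ upperFace → TangentTo (upperFibre p) p v) ∧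
    (p ∈ openPart → (1 / 2 : ℝ) • (logDeriv p v + (logDeriv p v).transpose) = M)}
  have hconv : ∀ p, Convex ℝ (t p) := by
    intro p v hv w hw a b _ _ hab
    refine ⟨fun h => ((hv.1 h).smul a).add ((hw.1 h).smul b),
      fun h => ((hv.2.1 h).smul a).add ((hw.2.1 h).smul b), fun h => ?_⟩
    rw [logDeriv_add, logDeriv_smul, logDeriv_smul, Matrix.transpose_add, Matrix.transpose_smul,
      Matrix.transpose_smul, add_add_add_comm, ← smul_add, ← smul_add, smul_add, smul_comm,
      hv.2.2 h, smul_comm, hw.2.2 h, ← add_smul, hab, one_smul]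
  obtain ⟨Z, hZ⟩ := exists_contMDiffSection_forall_mem_convex_of_local cornerModel (n := ⊤)
    (TangentSpace cornerModel : Mbar → Type) t hconv fun p => by
      obtain ⟨σ, hp⟩ := exists_chart p
      set N := M.submatrix σ σ with hN
      have hNs : N.transpose = N := by rw [hN, Matrix.transpose_submatrix, hM]
      have hNt : N.trace = 0 := by
        rw [← ht]
        simpa [Matrix.trace, hN] using Equiv.sum_comp σ fun i => M i i
      let ξ : (Fin 5 → ℝ) → (Fin 5 → ℝ) := fun x => frameVec x (frameSol N x)
      have hξ : ContDiffOn ℝ ∞ ξ quad := contDiffOn_frameVec (contDiffOn_frameSol N)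
      refine ⟨(chart σ).source, (chart σ).open_source.mem_nhds hp, localField σ ξ,
        contMDiffOn_localField σ hξ, fun q hq => ?_⟩
      have hq' := vecCoord_localField hq ξ
      refine ⟨fun h => tangentTo_lowerFibre hq h hq', fun h => tangentTo_upperFibre hq h hq',
        fun h => submatrix_injective σ ?_⟩
      have h1 := logDeriv_submatrix h hq'
      have h2 := frameK_frameSol hNs hNt (coord_mem_quad σ q)
      rw [← h1] at h2
      exact h2
  exact ⟨⟨Z, fun p h => (hZ p).1 h, fun p h => (hZ p).2.1 h⟩, fun p h => (hZ p).2.2 h⟩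

/-! ### The metric as an edge-to-edge tensor -/

/-- A matrix-valued function on the compactification with smooth entries. -/
def SmoothMat (K : Mbar → Mat) : Prop := ∀ i j, ContMDiff cornerModel 𝓘(ℝ) ∞ fun p => K p i j

theorem SmoothMat.mul {K L : Mbar → Mat} (hK : SmoothMat K) (hL : SmoothMat L) :
    SmoothMat fun p => K p * L p := fun i j => by
  simp only [Matrix.mul_apply, Fin.sum_univ_three]
  exact (((hK i 0).mul (hL 0 j)).add ((hK i 1).mul (hL 1 j))).add ((hK i 2).mul (hL 2 j))

theorem SmoothMat.add {K L : Mbar → Mat} (hK : SmoothMat K) (hL : SmoothMat L) :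
    SmoothMat fun p => K p + L p := fun i j => (hK i j).add (hL i j)

theorem SmoothMat.sub {K L : Mbar → Mat} (hK : SmoothMat K) (hL : SmoothMat L) :
    SmoothMat fun p => K p - L p := fun i j => (hK i j).sub (hL i j)

theorem SmoothMat.transpose {K : Mbar → Mat} (hK : SmoothMat K) :
    SmoothMat fun p => (K p).transpose := fun i j => hK j i

theorem smoothMat_const (M : Mat) : SmoothMat fun _ => M := fun _ _ => contMDiff_const

theorem SmoothMat.const_smul {K : Mbar → Mat} (hK : SmoothMat K) (c : ℝ) :
    SmoothMat fun p => c • K p := fun i j => contMDiff_const.mul (hK i j)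

theorem SmoothMat.trace {K : Mbar → Mat} (hK : SmoothMat K) :
    ContMDiff cornerModel 𝓘(ℝ) ∞ fun p => (K p).trace := by
  simp only [Matrix.trace_fin_three]
  exact ((hK 0 0).add (hK 1 1)).add (hK 2 2)

/-- The inner product of two edge-to-edge fields is `6 Tr (A Bᵗ)`, where `A` and `B` are the symmetric parts
of the logarithmic derivatives of `V` along them. It is therefore smooth up to the boundary. -/
theorem exists_metric_extension (X Y : eeFields) :
    ∃ h : Mbar → ℝ, ContMDiff cornerModel 𝓘(ℝ) ∞ h ∧
      ∀ p ∈ openPart, h p = invariantMetric p (X.1 p) (Y.1 p) := by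
  obtain ⟨K, hK, eK⟩ := exists_logDeriv_extension X
  obtain ⟨L, hL, eL⟩ := exists_logDeriv_extension Y
  have hK : SmoothMat K := hK
  have hL : SmoothMat L := hL
  refine ⟨fun p => 6 * (((1 / 2 : ℝ) • (K p + (K p).transpose)) *
    ((1 / 2 : ℝ) • (L p + (L p).transpose)).transpose).trace, ?_, fun p hp => ?_⟩
  · exact contMDiff_const.mul (((hK.add hK.transpose).const_smul _).mul
      ((hL.add hL.transpose).const_smul _).transpose).trace
  · beta_reduce
    rw [invariantMetric, killingMetric, toIdentity_velocity hp, toIdentity_velocity hp, eK p hp,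
      eL p hp]

/-- The smooth extension to the compactification of the inner product of two edge-to-edge fields. -/
def metricExt (X Y : eeFields) : Mbar → ℝ := (exists_metric_extension X Y).choose

theorem contMDiff_metricExt (X Y : eeFields) : ContMDiff cornerModel 𝓘(ℝ) ∞ (metricExt X Y) :=
  (exists_metric_extension X Y).choose_spec.1

theorem metricExt_eq (X Y : eeFields) {p : Mbar} (hp : p ∈ openPart) :
    metricExt X Y p = invariantMetric p (X.1 p) (Y.1 p) :=
  (exists_metric_extension X Y).choose_spec.2 p hp

theorem toIdentity_add (V X Y : Mat) : toIdentity V (X + Y) = toIdentity V X + toIdentity V Y := by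
  simp only [toIdentity, Matrix.mul_add, Matrix.add_mul, ← smul_add]
  congr 1
  abel

theorem toIdentity_smul (V X : Mat) (c : ℝ) : toIdentity V (c • X) = c • toIdentity V X := by
  simp only [toIdentity, Matrix.mul_smul, Matrix.smul_mul, ← smul_add]
  rw [smul_comm]

theorem killingMetric_symm (V X Y : Mat) : killingMetric V X Y = killingMetric V Y X := by
  rw [killingMetric, killingMetric, ← Matrix.trace_transpose, Matrix.transpose_mul,
    Matrix.transpose_transpose]

theorem killingMetric_add_left (V X Y Z : Mat) :
    killingMetric V (X + Y) Z = killingMetric V X Z + killingMetric V Y Z := by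
  simp only [killingMetric, toIdentity_add, Matrix.add_mul, Matrix.trace_add, mul_add]

theorem killingMetric_smul_left (V X Z : Mat) (c : ℝ) :
    killingMetric V (c • X) Z = c * killingMetric V X Z := by
  simp only [killingMetric, toIdentity_smul, Matrix.smul_mul, Matrix.trace_smul, smul_eq_mul]
  ring

theorem metricExt_symm (X Y : eeFields) : metricExt X Y = metricExt Y X :=
  eq_of_eq_on_openPart (contMDiff_metricExt X Y).continuous (contMDiff_metricExt Y X).continuous
    fun p hp => by rw [metricExt_eq X Y hp, metricExt_eq Y X hp]; exact killingMetric_symm _ _ _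

/-- The extended metric is linear over the smooth functions, so it is defined on the fibres of the
edge-to-edge tangent bundle. -/
theorem metricExt_of_eq_smul {X W : eeFields} {f : Mbar → ℝ} (hf : ContMDiff cornerModel 𝓘(ℝ) ∞ f)
    (h : ∀ q, X.1 q = f q • W.1 q) (Y : eeFields) :
    metricExt X Y = fun q => f q * metricExt W Y q :=
  eq_of_eq_on_openPart (contMDiff_metricExt X Y).continuous
    (hf.mul (contMDiff_metricExt W Y)).continuous fun p hp => by
      rw [metricExt_eq X Y hp, metricExt_eq W Y hp, h]
      simp only [invariantMetric, velocity_smul, killingMetric_smul_left]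

theorem metricExt_add_left (X X' Y : eeFields) :
    metricExt (X + X') Y = fun q => metricExt X Y q + metricExt X' Y q :=
  eq_of_eq_on_openPart (contMDiff_metricExt _ Y).continuous
    ((contMDiff_metricExt X Y).add (contMDiff_metricExt X' Y)).continuous fun p hp => by
      rw [metricExt_eq _ Y hp, metricExt_eq X Y hp, metricExt_eq X' Y hp]
      have : (X + X').1 p = X.1 p + X'.1 p := rfl
      simp only [invariantMetric, this, velocity_add, killingMetric_add_left]

theorem metricExt_smul_left (c : ℝ) (X Y : eeFields) :
    metricExt (c • X) Y = fun q => c * metricExt X Y q :=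
  metricExt_of_eq_smul contMDiff_const (fun _ => rfl) Y

/-- The extended metric at a point, as a bilinear form on the space of edge-to-edge fields. -/
def metricForm (p : Mbar) : eeFields →ₗ[ℝ] eeFields →ₗ[ℝ] ℝ :=
  LinearMap.mk₂ ℝ (fun X Y => metricExt X Y p)
    (fun X X' Y => by rw [metricExt_add_left])
    (fun c X Y => by rw [metricExt_smul_left, smul_eq_mul])
    (fun X Y Y' => by
      rw [metricExt_symm, metricExt_add_left, metricExt_symm Y X, metricExt_symm Y' X])
    (fun c X Y => by rw [metricExt_symm, metricExt_smul_left, metricExt_symm Y X, smul_eq_mul])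

theorem eeVanishing_le_ker (p : Mbar) : eeVanishing p ≤ LinearMap.ker (metricForm p) := by
  refine Submodule.span_le.2 ?_
  rintro Z ⟨f, W, hf, hfp, hZ⟩
  refine LinearMap.mem_ker.2 (LinearMap.ext fun Y => ?_)
  change metricExt Z Y p = 0
  rw [metricExt_of_eq_smul hf hZ Y]
  beta_reduce
  rw [hfp, zero_mul]

theorem metricForm_flip (p : Mbar) : (metricForm p).flip = metricForm p :=
  LinearMap.ext₂ fun X Y => congrFun (metricExt_symm Y X) p

/-- The extended metric at a point, with the second argument in the edge-to-edge tangent space. -/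
def metricFormRight (p : Mbar) : eeFields →ₗ[ℝ] eeTangent p →ₗ[ℝ] ℝ :=
  ((eeVanishing p).liftQ (metricForm p) (eeVanishing_le_ker p)).flip

/-- The invariant metric as a smooth section of the second symmetric power of the edge-to-edge cotangent
bundle. -/
def eeMetric : EESymmetricTensor where
  form p := (eeVanishing p).liftQ (metricFormRight p) <| by
    intro X hX
    refine LinearMap.mem_ker.2 (LinearMap.ext fun w => ?_)
    obtain ⟨Y, rfl⟩ := (eeVanishing p).mkQ_surjective w
    have h := LinearMap.mem_ker.1 (eeVanishing_le_ker p hX)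
    change metricForm p Y X = 0
    rw [← metricForm_flip, LinearMap.flip_apply, h]
    rfl
  symm p v w := by
    obtain ⟨X, rfl⟩ := (eeVanishing p).mkQ_surjective v
    obtain ⟨Y, rfl⟩ := (eeVanishing p).mkQ_surjective w
    exact congrFun (metricExt_symm Y X) p
  smooth X Y := contMDiff_metricExt Y X

theorem eeMetric_apply (X Y : eeFields) {p : Mbar} (hp : p ∈ openPart) :
    eeMetric.form p (eeValue X p) (eeValue Y p) = invariantMetric p (X.1 p) (Y.1 p) :=
  (congrFun (metricExt_symm Y X) p).trans (metricExt_eq X Y hp)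

/-! ### The Laplacian in a frame -/

/-- Jacobi's formula for the derivative of a determinant. -/
theorem hasFDerivAt_det {E : Type*} [NormedAddCommGroup E] [NormedSpace ℝ E] {n : ℕ}
    {A : E → Matrix (Fin n) (Fin n) ℝ} {A' : Fin n → Fin n → E →L[ℝ] ℝ} {x : E}
    (h : ∀ i j, HasFDerivAt (fun y => A y i j) (A' i j) x) :
    HasFDerivAt (fun y => (A y).det) (∑ i, ∑ j, (A x).adjugate j i • A' i j) x := by
  let D : ContinuousMultilinearMap ℝ (fun _ : Fin n => Fin n → ℝ) ℝ :=
    ⟨Matrix.detRowAlternating.toMultilinearMap, Continuous.matrix_det continuous_id⟩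
  have hrow : ∀ i, HasFDerivAt (fun y => A y i) (ContinuousLinearMap.pi (A' i)) x := fun i =>
    hasFDerivAt_pi.2 fun j => h i j
  have hD := HasFDerivAt.multilinear_comp (f := D) hrow
  refine hD.congr_fderiv (ContinuousLinearMap.ext fun v => ?_)
  simp only [sum_apply, smul_apply, smul_eq_mul, ContinuousLinearMap.comp_apply]
  refine Finset.sum_congr rfl fun i _ => ?_
  have h1 : (D.toContinuousLinearMap (fun j => A x j) i) (fun j => A' i j v) =
      ((A x).updateRow i fun j => A' i j v).det := rfl
  refine h1.trans ?_
  rw [← Matrix.cramer_transpose_apply, Matrix.cramer_eq_adjugate_mulVec, ← Matrix.adjugate_transpose]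
  rfl

theorem apply_eq_sum_single {F : Type*} [NormedAddCommGroup F] [NormedSpace ℝ F]
    (T : (Fin 5 → ℝ) →L[ℝ] F) (v : Fin 5 → ℝ) : T v = ∑ i, v i • T (Pi.single i 1) := by
  conv_lhs => rw [pi_eq_sum_univ' v]
  simp only [map_sum, map_smul]

/-- The coordinate formula for the Laplacian, rewritten in a frame `z` that is orthogonal for the metric
`G`. The coefficient of the first order term is the divergence of the frame vector, in which the
derivative of the density has been computed by Jacobi's formula. -/
theorem laplacian_eq_sum_frame {U : Set (Fin 5 → ℝ)} (hU : IsOpen U)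
    {G : (Fin 5 → ℝ) → Matrix (Fin 5) (Fin 5) ℝ} {z : Fin 5 → (Fin 5 → ℝ) → (Fin 5 → ℝ)}
    {n : Fin 5 → ℝ} (hn : ∀ a, 0 < n a) (hz : ∀ a, ContDiffOn ℝ ∞ (z a) U)
    (hG : ∀ y ∈ U, (Matrix.of fun i a => z a y i).transpose * G y * (Matrix.of fun i a => z a y i) =
      Matrix.diagonal n)
    {u : (Fin 5 → ℝ) → ℝ} (hu : ContDiffOn ℝ ∞ u U) {x : Fin 5 → ℝ} (hx : x ∈ U)
    {Θ : Matrix (Fin 5) (Fin 5) ℝ} (hΘ : Θ * (Matrix.of fun i a => z a x i) = 1) :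
    (√(G x).det)⁻¹ * ∑ i, fderiv ℝ (fun y => √(G y).det *
        ∑ j, (G y)⁻¹ i j * fderiv ℝ u y (Pi.single j 1)) x (Pi.single i 1) =
      ∑ c, (n c)⁻¹ * (fderiv ℝ (fun y => fderiv ℝ u y (z c y)) x (z c x) +
        (∑ i, fderiv ℝ (z c) x (Pi.single i 1) i - ∑ a, ∑ i, Θ a i * fderiv ℝ (z a) x (z c x) i) *
          fderiv ℝ u x (z c x)) := by
  set Z : (Fin 5 → ℝ) → Matrix (Fin 5) (Fin 5) ℝ := fun y => Matrix.of fun i a => z a y i with hZ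
  have hN : 0 < ∏ a, n a := Finset.prod_pos fun a _ => hn a
  have hdet : ∀ y ∈ U, (G y).det * (Z y).det ^ 2 = ∏ a, n a := fun y hy => by
    have h := congrArg Matrix.det (hG y hy)
    rw [Matrix.det_mul, Matrix.det_mul, Matrix.det_transpose, Matrix.det_diagonal] at h
    rw [← h]
    ring
  have hZ0 : ∀ y ∈ U, (Z y).det ≠ 0 := fun y hy h0 => by
    have h := hdet y hy
    rw [h0] at h
    simp at h
    exact hN.ne h
  have hGpos : ∀ y ∈ U, 0 < (G y).det := fun y hy => by
    have h := hdet y hy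
    rw [← h] at hN
    exact pos_of_mul_pos_left hN (sq_nonneg _)
  have hGinv : ∀ y ∈ U, (G y)⁻¹ = Z y * Matrix.diagonal (fun a => (n a)⁻¹) * (Z y).transpose := by
    intro y hy
    have hZu : IsUnit (Z y).det := (hZ0 y hy).isUnit
    have hZt : IsUnit (Z y).transpose.det := by rwa [Matrix.det_transpose]
    refine Matrix.inv_eq_left_inv ?_
    have h1 : (Z y).transpose * G y = Matrix.diagonal n * (Z y)⁻¹ := by
      rw [← hG y hy, Matrix.mul_assoc, Matrix.mul_nonsing_inv _ hZu, mul_one]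
    have h2 : (Matrix.diagonal fun a => (n a)⁻¹) * Matrix.diagonal n = 1 := by
      rw [Matrix.diagonal_mul_diagonal, ← Matrix.diagonal_one]
      congr 1
      funext a
      exact inv_mul_cancel₀ (hn a).ne'
    rw [Matrix.mul_assoc, h1, ← Matrix.mul_assoc, Matrix.mul_assoc (Z y), h2, mul_one,
      Matrix.mul_nonsing_inv _ hZu]
  have hxU := hU.mem_nhds hx
  have dz : ∀ a, HasFDerivAt (z a) (fderiv ℝ (z a) x) x := fun a =>
    (((hz a).contDiffAt hxU).differentiableAt (by simp)).hasFDerivAt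
  have dzi : ∀ a i, HasFDerivAt (fun y => z a y i)
      ((ContinuousLinearMap.proj i).comp (fderiv ℝ (z a) x)) x := fun a i =>
    hasFDerivAt_pi'.1 (dz a) i
  have hΘ' : (Z x)⁻¹ = Θ := Matrix.inv_eq_left_inv hΘ
  have dδ := hasFDerivAt_det (A := Z) (A' := fun i a => (ContinuousLinearMap.proj i).comp
    (fderiv ℝ (z a) x)) (x := x) fun i a => dzi a i
  set δ' : (Fin 5 → ℝ) →L[ℝ] ℝ := ∑ i, ∑ a, (Z x).adjugate a i •
    (ContinuousLinearMap.proj i).comp (fderiv ℝ (z a) x) with hδ'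
  have hδval : ∀ v, δ' v = (Z x).det * ∑ a, ∑ i, Θ a i * fderiv ℝ (z a) x v i := fun v => by
    rw [hδ', ← hΘ', Matrix.inv_def, Ring.inverse_eq_inv', Finset.sum_comm, Finset.mul_sum]
    simp only [sum_apply, smul_apply, smul_eq_mul, ContinuousLinearMap.comp_apply,
      ContinuousLinearMap.proj_apply, Matrix.smul_apply, Finset.mul_sum]
    refine Finset.sum_congr rfl fun a _ => Finset.sum_congr rfl fun i _ => ?_
    have := hZ0 x hx
    field_simp
  -- the density is a constant multiple of `|det Z|⁻¹`
  set w : (Fin 5 → ℝ) → ℝ := fun y => √(G y).det with hw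
  have hwpos : 0 < w x := Real.sqrt_pos.2 (hGpos x hx)
  obtain ⟨w', dw, hw'⟩ : ∃ w' : (Fin 5 → ℝ) →L[ℝ] ℝ, HasFDerivAt w w' x ∧
      ∀ v, w' v = -(w x * ∑ a, ∑ i, Θ a i * fderiv ℝ (z a) x v i) := by
    have e : w =ᶠ[𝓝 x] fun y => √((∏ a, n a) * ((Z y).det ^ 2)⁻¹) := by
      filter_upwards [hxU] with y hy
      rw [hw, ← hdet y hy, mul_inv_cancel_right₀ (pow_ne_zero 2 (hZ0 y hy))]
    have hZ2 : (Z x).det ^ 2 ≠ 0 := pow_ne_zero 2 (hZ0 x hx)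
    have h1 := ((hasDerivAt_inv hZ2).comp_hasFDerivAt x (dδ.pow 2)).const_mul (∏ a, n a)
    have hne : (∏ a, n a) * ((Z x).det ^ 2)⁻¹ ≠ 0 := mul_ne_zero hN.ne' (inv_ne_zero hZ2)
    refine ⟨_, (h1.sqrt hne).congr_of_eventuallyEq e, fun v => ?_⟩
    have e1 := e.self_of_nhds
    simp only [Function.comp] at e1 ⊢
    simp only [smul_apply, smul_eq_mul, hδval]
    rw [← e1]
    have e2 : w x ^ 2 = (∏ a, n a) * ((Z x).det ^ 2)⁻¹ := by
      rw [hw, Real.sq_sqrt (hGpos x hx).le, ← hdet x hx, mul_inv_cancel_right₀ hZ2]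
    have e3 : (∏ a, n a) = w x ^ 2 * (Z x).det ^ 2 := by
      rw [e2, inv_mul_cancel_right₀ hZ2]
    have hδ0 := hZ0 x hx
    have hw0 := hwpos.ne'
    rw [e3]
    simp
    field_simp
  set q : Fin 5 → (Fin 5 → ℝ) → ℝ := fun c y => fderiv ℝ u y (z c y) with hq
  have hdu : ContDiffOn ℝ ∞ (fderiv ℝ u) U := hu.fderiv_of_isOpen hU (by simp)
  have dq : ∀ c, HasFDerivAt (q c) (fderiv ℝ (q c) x) x := fun c =>
    (((hdu.clm_apply (hz c)).contDiffAt hxU).differentiableAt (by simp)).hasFDerivAt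
  have hflux : ∀ i, (fun y => w y * ∑ j, (G y)⁻¹ i j * fderiv ℝ u y (Pi.single j 1)) =ᶠ[𝓝 x]
      fun y => w y * ∑ c, (n c)⁻¹ * (z c y i * q c y) := fun i => by
    filter_upwards [hxU] with y hy
    congr 1
    rw [hGinv y hy]
    have e1 : ∀ j, (Z y * Matrix.diagonal (fun a => (n a)⁻¹) * (Z y).transpose) i j =
        ∑ c, (n c)⁻¹ * (z c y i * z c y j) := fun j => by
      rw [Matrix.mul_apply]
      simp only [Matrix.mul_diagonal, Matrix.transpose_apply]
      refine Finset.sum_congr rfl fun c _ => ?_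
      simp only [hZ, Matrix.of_apply]
      ring
    simp only [e1, Finset.sum_mul]
    rw [Finset.sum_comm]
    refine Finset.sum_congr rfl fun c _ => ?_
    rw [hq]
    beta_reduce
    rw [apply_eq_sum_single (fderiv ℝ u y) (z c y), Finset.mul_sum, Finset.mul_sum]
    refine Finset.sum_congr rfl fun j _ => ?_
    rw [smul_eq_mul]
    ring
  have hder : ∀ i, fderiv ℝ (fun y => w y * ∑ j, (G y)⁻¹ i j * fderiv ℝ u y (Pi.single j 1)) x
      (Pi.single i 1) = ∑ c, (n c)⁻¹ * (w x * (z c x i * fderiv ℝ (q c) x (Pi.single i 1)) +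
        w x * (q c x * fderiv ℝ (z c) x (Pi.single i 1) i) +
        q c x * (z c x i * w' (Pi.single i 1))) := fun i => by
    have h1 : HasFDerivAt (fun y => ∑ c, (n c)⁻¹ * (z c y i * q c y)) _ x :=
      HasFDerivAt.fun_sum fun c _ => ((dzi c i).fun_mul (dq c)).const_mul ((n c)⁻¹)
    have h2 := dw.fun_mul h1
    rw [(hflux i).fderiv_eq, h2.fderiv]
    simp only [add_apply, sum_apply, smul_apply, smul_eq_mul, ContinuousLinearMap.comp_apply,
      ContinuousLinearMap.proj_apply, Finset.mul_sum, Finset.sum_mul, ← Finset.sum_add_distrib]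
    refine Finset.sum_congr rfl fun c _ => ?_
    ring
  have hsum : ∀ (T : (Fin 5 → ℝ) →L[ℝ] ℝ) (v : Fin 5 → ℝ), ∑ i, v i * T (Pi.single i 1) = T v :=
    fun T v => (apply_eq_sum_single T v).symm
  rw [Finset.sum_congr rfl fun i _ => hder i, Finset.sum_comm, Finset.mul_sum]
  refine Finset.sum_congr rfl fun c _ => ?_
  rw [← Finset.mul_sum, Finset.sum_add_distrib, Finset.sum_add_distrib, ← Finset.mul_sum,
    ← Finset.mul_sum, ← Finset.mul_sum, ← Finset.mul_sum, hsum, hsum, hw']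
  have hwx : √(G x).det = w x := rfl
  have hqx : fderiv ℝ u x (z c x) = q c x := rfl
  have hw0 := hwpos.ne'
  have hn0 := (hn c).ne'
  rw [hwx, hqx]
  field_simp
  ring

/-! ### The structure equations of the frame -/

/-- The derivative of a matrix-valued function at `x` in the direction `w`, entry by entry. -/
def matDeriv (A : (Fin 5 → ℝ) → Mat) (x w : Fin 5 → ℝ) : Mat :=
  Matrix.of fun i j => fderiv ℝ (fun y => A y i j) x w

theorem matDeriv_sub (A : (Fin 5 → ℝ) → Mat) (x v w : Fin 5 → ℝ) :
    matDeriv A x (v - w) = matDeriv A x v - matDeriv A x w := by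
  ext i j
  simp [matDeriv]

theorem matDeriv_eq_sum (A : (Fin 5 → ℝ) → Mat) (x v : Fin 5 → ℝ) :
    matDeriv A x v = ∑ i, v i • matDeriv A x (Pi.single i 1) := by
  ext i j
  rw [Matrix.sum_apply]
  exact apply_eq_sum_single _ v

theorem matDeriv_mul {A B : (Fin 5 → ℝ) → Mat} {x : Fin 5 → ℝ}
    (hA : ∀ i j, DifferentiableAt ℝ (fun y => A y i j) x)
    (hB : ∀ i j, DifferentiableAt ℝ (fun y => B y i j) x) (w : Fin 5 → ℝ) :
    matDeriv (fun y => A y * B y) x w = matDeriv A x w * B x + A x * matDeriv B x w := by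
  ext i j
  have h : HasFDerivAt (fun y => (A y * B y) i j) (∑ k, (A x i k • fderiv ℝ (fun y => B y k j) x +
      B x k j • fderiv ℝ (fun y => A y i k) x)) x := by
    simp only [Matrix.mul_apply]
    exact HasFDerivAt.fun_sum fun k _ => (hA i k).hasFDerivAt.fun_mul (hB k j).hasFDerivAt
  change fderiv ℝ (fun y => (A y * B y) i j) x w = _
  rw [h.fderiv]
  simp only [matDeriv, Matrix.of_apply, Matrix.add_apply, Matrix.mul_apply,
    ← Finset.sum_add_distrib, sum_apply, add_apply, smul_apply, smul_eq_mul]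
  refine Finset.sum_congr rfl fun k _ => ?_
  ring

/-- If the derivatives of `V` along two fields `Y` and `Z` are `K V` and `L V`, then the derivative of `V`
along the bracket `[Y, Z]` is determined by `K` and `L` and their derivatives, because the second
derivative of `V` is symmetric. -/
theorem matDeriv_bracket {U : Set (Fin 5 → ℝ)} (hU : IsOpen U) {V K L : (Fin 5 → ℝ) → Mat}
    {Y Z : (Fin 5 → ℝ) → (Fin 5 → ℝ)} (hV : ∀ i j, ContDiffOn ℝ ∞ (fun y => V y i j) U)
    (hK : ∀ i j, ContDiffOn ℝ ∞ (fun y => K y i j) U)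
    (hL : ∀ i j, ContDiffOn ℝ ∞ (fun y => L y i j) U)
    (hY : ContDiffOn ℝ ∞ Y U) (hZ : ContDiffOn ℝ ∞ Z U)
    (eK : ∀ y ∈ U, matDeriv V y (Y y) = K y * V y) (eL : ∀ y ∈ U, matDeriv V y (Z y) = L y * V y)
    {x : Fin 5 → ℝ} (hx : x ∈ U) :
    matDeriv V x (fderiv ℝ Z x (Y x) - fderiv ℝ Y x (Z x)) =
      (matDeriv L x (Y x) - matDeriv K x (Z x) + L x * K x - K x * L x) * V x := by
  have hxU := hU.mem_nhds hx
  have dd : ∀ {A : (Fin 5 → ℝ) → Mat}, (∀ i j, ContDiffOn ℝ ∞ (fun y => A y i j) U) → ∀ i j,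
      DifferentiableAt ℝ (fun y => A y i j) x := fun hA i j =>
    ((hA i j).contDiffAt hxU).differentiableAt (by simp)
  have second : ∀ {W : (Fin 5 → ℝ) → (Fin 5 → ℝ)} {M : (Fin 5 → ℝ) → Mat}, ContDiffOn ℝ ∞ W U →
      (∀ y ∈ U, matDeriv V y (W y) = M y * V y) →
      ∀ v i j, matDeriv (fun y => M y * V y) x v i j =
        fderiv ℝ (fderiv ℝ fun y => V y i j) x v (W x) + matDeriv V x (fderiv ℝ W x v) i j := by
    intro W M hW e v i j
    have h1 : (fun y => (M y * V y) i j) =ᶠ[𝓝 x] fun y => fderiv ℝ (fun y => V y i j) y (W y) := by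
      filter_upwards [hxU] with y hy
      rw [← e y hy]
      rfl
    have h2 : DifferentiableAt ℝ (fderiv ℝ fun y => V y i j) x :=
      (((hV i j).fderiv_of_isOpen hU (m := ∞) (by simp)).contDiffAt hxU).differentiableAt (by simp)
    have h3 : DifferentiableAt ℝ W x := (hW.contDiffAt hxU).differentiableAt (by simp)
    change fderiv ℝ (fun y => (M y * V y) i j) x v = _
    rw [h1.fderiv_eq, (h2.hasFDerivAt.clm_apply h3.hasFDerivAt).fderiv]
    simp [matDeriv, add_comm]
  have symm : ∀ i j v w, fderiv ℝ (fderiv ℝ fun y => V y i j) x v w =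
      fderiv ℝ (fderiv ℝ fun y => V y i j) x w v := fun i j v w =>
    ((hV i j).contDiffAt hxU).isSymmSndFDerivAt (by
      rw [minSmoothness_of_isRCLikeNormedField]
      exact WithTop.coe_le_coe.2 (le_top : (2 : ℕ∞) ≤ ⊤)) v w
  have hZY := second hZ eL (Y x)
  have hYZ := second hY eK (Z x)
  rw [matDeriv_mul (dd hL) (dd hV), eK x hx] at hZY
  rw [matDeriv_mul (dd hK) (dd hV), eL x hx] at hYZ
  rw [matDeriv_sub, Matrix.sub_mul, Matrix.add_mul, Matrix.sub_mul, Matrix.mul_assoc,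
    Matrix.mul_assoc]
  ext i j
  have h1 := hZY i j
  have h2 := hYZ i j
  rw [symm] at h2
  simp only [Matrix.add_apply, Matrix.sub_apply] at h1 h2 ⊢
  linarith

/-- The divergence of a frame vector, computed with the dual coframe `Θ`, as the trace of brackets. -/
theorem divergence_eq_sum_bracket {z : Fin 5 → (Fin 5 → ℝ) → (Fin 5 → ℝ)} {x : Fin 5 → ℝ}
    {Θ : Matrix (Fin 5) (Fin 5) ℝ} (hΘ : Θ * (Matrix.of fun i a => z a x i) = 1) (c : Fin 5) :
    ∑ i, fderiv ℝ (z c) x (Pi.single i 1) i - ∑ a, ∑ i, Θ a i * fderiv ℝ (z a) x (z c x) i =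
      ∑ a, ∑ i, Θ a i * (fderiv ℝ (z c) x (z a x) - fderiv ℝ (z a) x (z c x)) i := by
  have h := mul_eq_one_comm.1 hΘ
  have hk : ∀ k i, ∑ a, z a x k * Θ a i = if k = i then 1 else 0 := fun k i => by
    have := congrFun (congrFun h k) i
    rwa [Matrix.mul_apply, Matrix.one_apply] at this
  simp only [Pi.sub_apply, mul_sub, Finset.sum_sub_distrib]
  congr 1
  have e : ∀ a i, Θ a i * fderiv ℝ (z c) x (z a x) i =
      ∑ k, (z a x k * Θ a i) * fderiv ℝ (z c) x (Pi.single k 1) i := fun a i => by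
    rw [apply_eq_sum_single (fderiv ℝ (z c) x) (z a x), Finset.sum_apply, Finset.mul_sum]
    refine Finset.sum_congr rfl fun k _ => ?_
    rw [Pi.smul_apply, smul_eq_mul]
    ring
  simp only [e]
  rw [Finset.sum_comm]
  refine Finset.sum_congr rfl fun i _ => ?_
  rw [Finset.sum_comm]
  simp only [← Finset.sum_mul, hk]
  simp

/-! ### The Laplacian as an edge-to-edge operator -/

theorem unembed_point {x : Fin 5 → ℝ} (hx : x ∈ quad) : unembed (point 1 x) = unitV x := by
  have h := unembed_coord (point_mem_source 1 x)
  rwa [coord_point 1 hx] at h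

theorem velocity_point {x : Fin 5 → ℝ} (hx : x ∈ quadInt) (v : TangentSpace cornerModel (point 1 x)) :
    velocity (point 1 x) v = matDeriv unitV x (vecCoord 1 (point 1 x) v) := by
  ext i j
  have h := velocity_apply (σ := 1) (point_mem_openPart 1 hx) v i j
  rw [coord_point 1 (quadInt_subset hx)] at h
  exact h

theorem contDiffOn_comp_point_of_openPart {f : Mbar → ℝ}
    (hf : ContMDiffOn cornerModel 𝓘(ℝ) ∞ f openPart) :
    ContDiffOn ℝ ∞ (fun x => f (point 1 x)) quadInt :=
  (hf.comp ((contMDiffOn_point 1).mono quadInt_subset) fun _ hx => point_mem_openPart 1 hx).contDiffOn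

theorem fieldDeriv_point (X : eeFields) {u : Mbar → ℝ}
    (hu : ContMDiffOn cornerModel 𝓘(ℝ) ∞ u openPart) {x : Fin 5 → ℝ} (hx : x ∈ quadInt) :
    fieldDeriv X u (point 1 x) = fderiv ℝ (fun y => u (point 1 y)) x (comps 1 X.1 x) := by
  have hd : MDifferentiableAt cornerModel 𝓘(ℝ) u (point 1 x) :=
    (hu.contMDiffAt (isOpen_openPart.mem_nhds (point_mem_openPart 1 hx))).mdifferentiableAt (by simp)
  have h := mfderiv_eq_fderivWithin (point_mem_source 1 x) hd (X.1 (point 1 x))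
  rw [coord_point 1 (quadInt_subset hx), fderivWithin_of_mem_nhds (quad_mem_nhds hx)] at h
  exact h

theorem contMDiffOn_fieldDeriv (X : eeFields) {u : Mbar → ℝ} {S : Set Mbar} (hS : IsOpen S)
    (hu : ContMDiffOn cornerModel 𝓘(ℝ) ∞ u S) :
    ContMDiffOn cornerModel 𝓘(ℝ) ∞ (fieldDeriv X u) S :=
  contMDiffOn_mfderiv_apply X.1 hS hu

/-- The derivative of a matrix-valued function along an edge-to-edge field. -/
def fieldMatDeriv (X : eeFields) (K : Mbar → Mat) (p : Mbar) : Mat :=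
  Matrix.of fun i j => fieldDeriv X (fun q => K q i j) p

theorem SmoothMat.fieldMatDeriv (X : eeFields) {K : Mbar → Mat} (hK : SmoothMat K) :
    SmoothMat (fieldMatDeriv X K) := fun i j =>
  contMDiffOn_univ.1 (contMDiffOn_fieldDeriv X isOpen_univ (hK i j).contMDiffOn)

theorem fieldMatDeriv_point (X : eeFields) {K : Mbar → Mat} (hK : SmoothMat K) {x : Fin 5 → ℝ}
    (hx : x ∈ quadInt) : fieldMatDeriv X K (point 1 x) =
      matDeriv (fun y => K (point 1 y)) x (comps 1 X.1 x) := by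
  ext i j
  exact fieldDeriv_point X (hK i j).contMDiffOn hx

/-- The matrix of the invariant metric in the standard chart. -/
def stdMetric (x : Fin 5 → ℝ) : Matrix (Fin 5) (Fin 5) ℝ :=
  Matrix.of fun i j => killingMetric (unitV x) (matDeriv unitV x (Pi.single i 1))
    (matDeriv unitV x (Pi.single j 1))

theorem extChartAt_eq_extend {p : Mbar} (hp : p ∈ openPart) :
    extChartAt cornerModel p = (chart 1).extend cornerModel := by
  change (chart (chartIndex p)).extend cornerModel = _
  rw [chartIndex, if_pos (openPart_subset_source 1 hp)]

theorem coordMetric_eq_stdMetric {p : Mbar} (hp : p ∈ openPart) {x : Fin 5 → ℝ} (hx : x ∈ quadInt) :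
    coordMetric invariantMetric p x = stdMetric x := by
  have hv : ∀ w, velocity (point 1 x) (vecPoint 1 x w) = matDeriv unitV x w := fun w => by
    rw [velocity_point hx, vecCoord_vecPoint 1 (quadInt_subset hx)]
  ext i j
  rw [coordMetric, extChartAt_eq_extend hp, range_cornerModel]
  change invariantMetric (point 1 x) (vecPoint 1 x (Pi.single i 1)) (vecPoint 1 x (Pi.single j 1)) = _
  rw [invariantMetric, hv, hv, unembed_point (quadInt_subset hx)]
  rfl

/-- The Laplacian in the standard chart, which is the preferred chart around every point of the symmetric
space. -/
theorem laplacian_eq_std {p : Mbar} (hp : p ∈ openPart) (u : Mbar → ℝ) :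
    laplacian invariantMetric u p = -((√(stdMetric (coord 1 p)).det)⁻¹ *
      ∑ i, fderiv ℝ (fun y => √(stdMetric y).det *
        ∑ j, (stdMetric y)⁻¹ i j * fderiv ℝ (fun x => u (point 1 x)) y (Pi.single j 1))
          (coord 1 p) (Pi.single i 1)) := by
  have hx := coord_mem_quadInt 1 hp
  have e0 : extChartAt cornerModel p p = coord 1 p := by
    rw [extChartAt_eq_extend hp]
    rfl
  have e1 : u ∘ (extChartAt cornerModel p).symm = fun x => u (point 1 x) := by
    rw [extChartAt_eq_extend hp]
    rfl
  have e2 : (fun y => √(coordMetric invariantMetric p y).det) =ᶠ[𝓝 (coord 1 p)]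
      fun y => √(stdMetric y).det := by
    filter_upwards [isOpen_quadInt.mem_nhds hx] with y hy
    rw [coordMetric_eq_stdMetric hp hy]
  have e3 : ∀ i j, (fun y => (coordMetric invariantMetric p y)⁻¹ i j) =ᶠ[𝓝 (coord 1 p)]
      fun y => (stdMetric y)⁻¹ i j := fun i j => by
    filter_upwards [isOpen_quadInt.mem_nhds hx] with y hy
    rw [coordMetric_eq_stdMetric hp hy]
  have e4 : ∀ i, (fun y => √(coordMetric invariantMetric p y).det *
      ∑ j, (coordMetric invariantMetric p y)⁻¹ i j *
        fderiv ℝ (fun x => u (point 1 x)) y (Pi.single j 1)) =ᶠ[𝓝 (coord 1 p)]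
      fun y => √(stdMetric y).det *
        ∑ j, (stdMetric y)⁻¹ i j * fderiv ℝ (fun x => u (point 1 x)) y (Pi.single j 1) := fun i => by
    filter_upwards [e2, Filter.eventually_all.2 (e3 i)] with y h2 h3
    rw [h2]
    simp only [h3]
  rw [laplacian, e0, e1, coordMetric_eq_stdMetric hp hx, neg_mul]
  simp only [(e4 _).fderiv_eq]

/-- A global frame of edge-to-edge fields, which on the symmetric space corresponds to the matrices
`symBasis` under the identification of the tangent spaces with the one at the identity. In
particular it is orthogonal there. -/
def eeFrame (a : Fin 5) : eeFields :=
  (exists_field (symBasis_transpose a) (symBasis_trace a)).choose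

theorem eeFrame_spec (a : Fin 5) {p : Mbar} (hp : p ∈ openPart) :
    (1 / 2 : ℝ) • (logDeriv p ((eeFrame a).1 p) + (logDeriv p ((eeFrame a).1 p)).transpose) =
      symBasis a :=
  (exists_field (symBasis_transpose a) (symBasis_trace a)).choose_spec p hp

/-- The smooth extension to the compactification of the logarithmic derivative of `V` along `eeFrame a`. -/
def eeFrameLog (a : Fin 5) : Mbar → Mat := (exists_logDeriv_extension (eeFrame a)).choose

theorem smoothMat_eeFrameLog (a : Fin 5) : SmoothMat (eeFrameLog a) :=
  (exists_logDeriv_extension (eeFrame a)).choose_spec.1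

theorem eeFrameLog_eq (a : Fin 5) {p : Mbar} (hp : p ∈ openPart) :
    eeFrameLog a p = logDeriv p ((eeFrame a).1 p) :=
  (exists_logDeriv_extension (eeFrame a)).choose_spec.2 p hp

theorem symCoef_eeFrameLog (a b : Fin 5) {p : Mbar} (hp : p ∈ openPart) :
    symCoef a (eeFrameLog b p) = if a = b then 1 else 0 := by
  rw [← symCoef_symBasis, ← eeFrame_spec b hp, symCoef_smul, symCoef_add, symCoef_transpose,
    eeFrameLog_eq b hp]
  ring

theorem velocity_eeFrame (a : Fin 5) {x : Fin 5 → ℝ} (hx : x ∈ quadInt) :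
    matDeriv unitV x (comps 1 (eeFrame a).1 x) = eeFrameLog a (point 1 x) * unitV x := by
  have hp := point_mem_openPart 1 hx
  rw [eeFrameLog_eq a hp, ← unembed_point (quadInt_subset hx), logDeriv_mul hp, velocity_point hx]
  rfl

/-- The divergence of `eeFrame c`, as a smooth function on the compactification. -/
def frameDiv (c : Fin 5) (p : Mbar) : ℝ :=
  ∑ a, symCoef a (fieldMatDeriv (eeFrame a) (eeFrameLog c) p -
    fieldMatDeriv (eeFrame c) (eeFrameLog a) p + eeFrameLog c p * eeFrameLog a p -
    eeFrameLog a p * eeFrameLog c p)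

theorem contMDiff_frameDiv (c : Fin 5) : ContMDiff cornerModel 𝓘(ℝ) ∞ (frameDiv c) := by
  refine contMDiff_finsetSum fun a _ => contMDiff_const.mul (contMDiff_const.mul ?_)
  have hL := smoothMat_eeFrameLog
  exact ((smoothMat_const (symBasis a)).mul (((((hL c).fieldMatDeriv (eeFrame a)).sub
    ((hL a).fieldMatDeriv (eeFrame c))).add ((hL c).mul (hL a))).sub ((hL a).mul (hL c)))).trace

/-- The global frame is orthogonal for the invariant metric. -/
theorem stdMetric_frame {x : Fin 5 → ℝ} (hx : x ∈ quadInt) :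
    (Matrix.of fun i a => comps 1 (eeFrame a).1 x i).transpose * stdMetric x *
      (Matrix.of fun i a => comps 1 (eeFrame a).1 x i) = Matrix.diagonal symNorm := by
  have hp := point_mem_openPart 1 hx
  have key : ∀ v w, ∑ i, ∑ j, v i * stdMetric x i j * w j =
      killingMetric (unitV x) (matDeriv unitV x v) (matDeriv unitV x w) := by
    intro v w
    have sumL : ∀ (A : Fin 5 → Mat) (M : Mat), killingMetric (unitV x) (∑ i, v i • A i) M =
        ∑ i, v i * killingMetric (unitV x) (A i) M := fun A M => by
      simp only [Fin.sum_univ_five, killingMetric_add_left, killingMetric_smul_left]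
    have sumR : ∀ (A : Fin 5 → Mat) (M : Mat), killingMetric (unitV x) M (∑ i, w i • A i) =
        ∑ i, w i * killingMetric (unitV x) M (A i) := fun A M => by
      simp only [killingMetric_symm _ M, Fin.sum_univ_five, killingMetric_add_left,
        killingMetric_smul_left]
    rw [matDeriv_eq_sum unitV x v, matDeriv_eq_sum unitV x w, sumL]
    refine Finset.sum_congr rfl fun i _ => ?_
    rw [sumR, Finset.mul_sum]
    refine Finset.sum_congr rfl fun j _ => ?_
    rw [stdMetric, Matrix.of_apply]
    ring
  have val : ∀ a b, killingMetric (unitV x) (matDeriv unitV x (comps 1 (eeFrame a).1 x))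
      (matDeriv unitV x (comps 1 (eeFrame b).1 x)) = if a = b then symNorm a else 0 := by
    intro a b
    have h : ∀ c, toIdentity (unitV x) (matDeriv unitV x (comps 1 (eeFrame c).1 x)) = symBasis c :=
      fun c => by
        have h1 := toIdentity_velocity hp ((eeFrame c).1 (point 1 x))
        rw [eeFrame_spec c hp, unembed_point (quadInt_subset hx), velocity_point hx] at h1
        exact h1
    have hn := (symNorm_pos a).ne'
    have h2 := symCoef_symBasis a b
    rw [symCoef, inv_mul_eq_iff_eq_mul₀ hn] at h2
    rw [killingMetric, h, h, symBasis_transpose, h2, mul_ite, mul_one, mul_zero]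
  ext a b
  rw [Matrix.diagonal_apply, ← val a b, ← key, Matrix.mul_apply, Finset.sum_comm]
  refine Finset.sum_congr rfl fun j _ => ?_
  rw [Matrix.mul_apply, Finset.sum_mul]
  rfl

/-- The coframe dual to `eeFrame`, in the standard chart. -/
def coframe (x : Fin 5 → ℝ) : Matrix (Fin 5) (Fin 5) ℝ :=
  Matrix.of fun a i => symCoef a (matDeriv unitV x (Pi.single i 1) * (unitV x)⁻¹)

theorem isUnit_det_unitV {x : Fin 5 → ℝ} (hx : x ∈ quadInt) : IsUnit (unitV x).det := by
  rw [← unembed_point (quadInt_subset hx)]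
  exact isUnit_det_unembed (point_mem_openPart 1 hx)

theorem sum_coframe_mul (a : Fin 5) (x v : Fin 5 → ℝ) :
    ∑ i, coframe x a i * v i = symCoef a (matDeriv unitV x v * (unitV x)⁻¹) := by
  rw [matDeriv_eq_sum unitV x v]
  simp only [Fin.sum_univ_five, coframe, Matrix.of_apply, Matrix.add_mul, Matrix.smul_mul, symCoef_add,
    symCoef_smul]
  ring

theorem coframe_mul {x : Fin 5 → ℝ} (hx : x ∈ quadInt) :
    coframe x * (Matrix.of fun i a => comps 1 (eeFrame a).1 x i) = 1 := by
  ext a b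
  rw [Matrix.mul_apply, Matrix.one_apply, ← symCoef_eeFrameLog a b (point_mem_openPart 1 hx)]
  simp only [Matrix.of_apply]
  rw [sum_coframe_mul, velocity_eeFrame b hx, Matrix.mul_nonsing_inv_cancel_right _ _ (isUnit_det_unitV hx)]

/-- On the symmetric space the divergence of `eeFrame c` is the trace of the brackets with the frame fields,
which the structure equations express through the logarithmic derivatives of `V`. -/
theorem divergence_eq_frameDiv (c : Fin 5) {x : Fin 5 → ℝ} (hx : x ∈ quadInt) :
    ∑ i, fderiv ℝ (comps 1 (eeFrame c).1) x (Pi.single i 1) i -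
      ∑ a, ∑ i, coframe x a i * fderiv ℝ (comps 1 (eeFrame a).1) x (comps 1 (eeFrame c).1 x) i =
      frameDiv c (point 1 x) := by
  rw [divergence_eq_sum_bracket (z := fun a => comps 1 (eeFrame a).1) (coframe_mul hx)]
  refine Finset.sum_congr rfl fun a _ => ?_
  have hz : ∀ b, ContDiffOn ℝ ∞ (comps 1 (eeFrame b).1) quadInt := fun b =>
    (contDiffOn_comps 1 _).mono quadInt_subset
  have hL := smoothMat_eeFrameLog
  have hl : ∀ b i j, ContDiffOn ℝ ∞ (fun y => eeFrameLog b (point 1 y) i j) quadInt := fun b i j =>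
    contDiffOn_comp_point_of_openPart (hL b i j).contMDiffOn
  rw [sum_coframe_mul, matDeriv_bracket isOpen_quadInt contDiffOn_unitV (hl a) (hl c) (hz a) (hz c)
    (fun y hy => velocity_eeFrame a hy) (fun y hy => velocity_eeFrame c hy) hx,
    Matrix.mul_nonsing_inv_cancel_right _ _ (isUnit_det_unitV hx), fieldMatDeriv_point _ (hL c) hx,
    fieldMatDeriv_point _ (hL a) hx]

/-- The product of an edge-to-edge field with a smooth function. -/
def smulField (f : Mbar → ℝ) (hf : ContMDiff cornerModel 𝓘(ℝ) ∞ f) (X : eeFields) : eeFields :=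
  ⟨⟨fun p => f p • X.1 p, hf.smul_section X.1.contMDiff⟩,
    fun p hp => (X.2.1 p hp).smul (f p), fun p hp => (X.2.2 p hp).smul (f p)⟩

/-- The Laplacian as an edge-to-edge operator: `- ∑ ‖Z‖⁻² (Z Z + (div Z) Z)` over the frame. -/
def eeLaplacian : (Mbar → ℝ) → (Mbar → ℝ) :=
  -∑ c, (symNorm c)⁻¹ • (eeProduct [eeFrame c, eeFrame c] +
    eeProduct [smulField (frameDiv c) (contMDiff_frameDiv c) (eeFrame c)])

theorem eeLaplacian_mem : eeLaplacian ∈ eeDiffOps 2 :=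
  Submodule.neg_mem _ <| Submodule.sum_mem _ fun _ _ => Submodule.smul_mem _ _ <|
    Submodule.add_mem _ (Submodule.subset_span ⟨_, by simp, rfl⟩)
      (Submodule.subset_span ⟨_, by simp, rfl⟩)

theorem eeLaplacian_apply {u : Mbar → ℝ} (hu : ContMDiffOn cornerModel 𝓘(ℝ) ∞ u openPart) {p : Mbar}
    (hp : p ∈ openPart) : eeLaplacian u p = laplacian invariantMetric u p := by
  have hx := coord_mem_quadInt 1 hp
  have hpx := point_coord (openPart_subset_source 1 hp)
  rw [laplacian_eq_std hp, laplacian_eq_sum_frame isOpen_quadInt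
    (z := fun a => comps 1 (eeFrame a).1) symNorm_pos
    (fun a => (contDiffOn_comps 1 _).mono quadInt_subset) (fun y hy => stdMetric_frame hy)
    (contDiffOn_comp_point_of_openPart hu) hx (coframe_mul hx)]
  have e : eeLaplacian u p = -∑ c, (symNorm c)⁻¹ * (fieldDeriv (eeFrame c) (fieldDeriv (eeFrame c) u) p +
      fieldDeriv (smulField (frameDiv c) (contMDiff_frameDiv c) (eeFrame c)) u p) := by
    simp [eeLaplacian, eeProduct, mul_add]
  rw [e]
  congr 1
  refine Finset.sum_congr rfl fun c _ => ?_
  rw [divergence_eq_frameDiv c hx]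
  have h1 : fieldDeriv (eeFrame c) u p =
      fderiv ℝ (fun y => u (point 1 y)) (coord 1 p) (comps 1 (eeFrame c).1 (coord 1 p)) := by
    rw [← fieldDeriv_point _ hu hx, hpx]
  have h2 : fieldDeriv (smulField (frameDiv c) (contMDiff_frameDiv c) (eeFrame c)) u p =
      frameDiv c p * fieldDeriv (eeFrame c) u p :=
    (mfderiv cornerModel 𝓘(ℝ) u p).map_smul (frameDiv c p) ((eeFrame c).1 p)
  have h3 : fieldDeriv (eeFrame c) (fieldDeriv (eeFrame c) u) p =
      fderiv ℝ (fun y => fderiv ℝ (fun y => u (point 1 y)) y (comps 1 (eeFrame c).1 y)) (coord 1 p)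
        (comps 1 (eeFrame c).1 (coord 1 p)) := by
    have h := fieldDeriv_point (eeFrame c) (contMDiffOn_fieldDeriv (eeFrame c) isOpen_openPart hu) hx
    rw [hpx] at h
    rw [h]
    congr 1
    refine Filter.EventuallyEq.fderiv_eq ?_
    filter_upwards [isOpen_quadInt.mem_nhds hx] with y hy
    exact fieldDeriv_point _ hu hy
  rw [h2, h3, h1, hpx]

end SL3

end

theorem mainTheorem11 :
    (∃ γ : SL3.EESymmetricTensor, ∀ p ∈ SL3.openPart, ∀ X Y : SL3.eeFields,
      γ.form p (SL3.eeValue X p) (SL3.eeValue Y p) =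
        SL3.invariantMetric p (X.1 p) (Y.1 p)) ∧
    ∃ D ∈ SL3.eeDiffOps 2, ∀ u : SL3.Mbar → ℝ,
      ContMDiffOn SL3.cornerModel 𝓘(ℝ) ∞ u SL3.openPart → ∀ p ∈ SL3.openPart,
        D u p = SL3.laplacian SL3.invariantMetric u p :=
  ⟨⟨SL3.eeMetric, fun _ hp X Y => SL3.eeMetric_apply X Y hp⟩,
    SL3.eeLaplacian, SL3.eeLaplacian_mem, fun _ hu _ hp => SL3.eeLaplacian_apply hu hp⟩
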